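/- Let $\Omega=(0,1)$ and, for $T>0$, $Q_T=\Omega\times(0,T)$. Let $H^1_{(0)}(\Omega)=\{z\in H^1(\Omega): z(0)=0\}$ with norm $\|z\|_{H^1_{(0)}}=\|\partial_x z\|_{L^2(\Omega)}$, and let $H^{-1}_{(0)}(\Omega)$ be its dual with the dual norm; $L^2(\Omega)$ is embedded in $H^{-1}_{(0)}(\Omega)$ by $\langle f,z\rangle=\int_\Omega fz\,dx$. All functions are real-valued. For $A\in L^\infty(Q_T)$, $B\in L^2(Q_T)$ and $(\varphi_0,\varphi_1)\in L^2(\Omega)\times H^{-1}_{(0)}(\Omega)$ consider $$\partial_{tt}\varphi-\partial_{xx}\varphi+A\varphi=B \text{ in } Q_T,\qquad \varphi(0,\cdot)=0,\ \partial_x\varphi(1,\cdot)=0 \text{ in } (0,T),\qquad (\varphi,\partial_t\varphi)(\cdot,0)=(\varphi_0,\varphi_1) \text{ in } \Omega. \tag{$\star$}$$ A function $\varphi\in L^2(Q_T)$ is a solution of $(\star)$ in the sense of transposition if for every $g\in L^2(Q_T)$ $$\int_{Q_T}\varphi g\,dx\,dt=\int_{Q_T}Bw\,dx\,dt+\langle\varphi_1,w(\cdot,0)\rangle_{H^{-1}_{(0)},H^1_{(0)}}-\int_\Omega\varphi_0\,\partial_tw(\cdot,0)\,dx,$$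 where $w\in C^0([0,T];H^1_{(0)}(\Omega))\cap C^1([0,T];L^2(\Omega))\cap H^2(0,T;H^{-1}_{(0)}(\Omega))$ is the weak solution of the backward problem $\partial_{tt}w-\partial_{xx}w+Aw=g$ in $Q_T$, $w(0,\cdot)=0$, $\partial_xw(1,\cdot)=0$, $(w,\partial_tw)(\cdot,T)=(0,0)$, that is, for a.e. $t\in(0,T)$ and all $z\in H^1_{(0)}(\Omega)$, $$\langle\partial_{tt}w(\cdot,t),z\rangle_{H^{-1}_{(0)},H^1_{(0)}}+\int_\Omega\partial_xw\,\partial_xz\,dx+\int_\Omega Awz\,dx=\int_\Omega gz\,dx .$$ **Theorem.** Let $T>2$. There exists a constant $C=C(T)>0$ such that for all $A\in L^\infty(Q_T)$, $B\in L^2(Q_T)$, $(\varphi_0,\varphi_1)\in L^2(\Omega)\times H^{-1}_{(0)}(\Omega)$ and every solution $\varphi$ of $(\star)$ in the sense of transposition the following holds. The function $\varphi$ has a representative in $C^0([0,T];L^2(\Omega))\cap C^1([0,T];H^{-1}_{(0)}(\Omega))$, with $(\varphi(\cdot,0),\partial_t\varphi(\cdot,0))=(\varphi_0,\varphi_1)$;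 the trace $\varphi(1,\cdot)=\lim_{\varepsilon\to0^+}\frac1\varepsilon\int_{1-\varepsilon}^1\varphi(x,\cdot)\,dx$ exists in $L^2(0,T)$; $\partial_{tt}\varphi-\partial_{xx}\varphi+A\varphi=B$ in the sense of distributions in $Q_T$; and $$\|\varphi(\cdot,0)\|^2_{L^2(\Omega)}+\|\partial_t\varphi(\cdot,0)\|^2_{H^{-1}_{(0)}(\Omega)}\le C_{\mathrm{obs}}\Big(\|\varphi(1,\cdot)\|^2_{L^2(0,T)}+\|\partial_{tt}\varphi-\partial_{xx}\varphi+A\varphi\|^2_{L^2(Q_T)}\Big),\qquad C_{\mathrm{obs}}=C\,e^{C\sqrt{\|A\|_{L^\infty(Q_T)}}}.$$ -/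

import Mathlib

open MeasureTheory Set Filter Topology
open scoped ENNReal ContDiff

noncomputable section

/-- Lebesgue measure on `Ω = (0,1)`. -/
abbrev muOm : Measure ℝ := volume.restrict (Ioo 0 1)

/-- Lebesgue measure on `(0,T)`. -/
abbrev muT (T : ℝ) : Measure ℝ := volume.restrict (Ioo 0 T)

/-- Lebesgue measure on `Q_T = Ω × (0,T)`; points are written `(x, t)`. -/
abbrev muQ (T : ℝ) : Measure (ℝ × ℝ) := volume.restrict (Ioo 0 1 ×ˢ Ioo 0 T)

/-- `L²(Ω)`. -/
abbrev L2Om : Type := Lp ℝ 2 muOm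

/-- `L²(0,T)`. -/
abbrev L2T (T : ℝ) : Type := Lp ℝ 2 (muT T)

/-- `L²(Q_T)`. -/
abbrev L2Q (T : ℝ) : Type := Lp ℝ 2 (muQ T)

/-- `L^∞(Q_T)`. -/
abbrev LinfQ (T : ℝ) : Type := Lp ℝ ∞ (muQ T)

theorem L2Om.integrable (f : L2Om) : Integrable (f : ℝ → ℝ) muOm :=
  (Lp.memLp f).integrable (by norm_num)

theorem L2Om.intervalIntegrable (f : L2Om) {x : ℝ} (hx : x ∈ Ioo (0 : ℝ) 1) :
    IntervalIntegrable (f : ℝ → ℝ) volume 0 x := by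
  rw [intervalIntegrable_iff_integrableOn_Ioo_of_le hx.1.le]
  have h : IntegrableOn (f : ℝ → ℝ) (Ioo 0 1) volume := f.integrable
  exact h.mono_set (Ioo_subset_Ioo_right hx.2.le)

/-- Equality almost everywhere in `Ω` restricts to equality of the primitives vanishing at `0`. -/
theorem L2Om.primitive_congr {f g : ℝ → ℝ} (h : f =ᵐ[muOm] g) {x : ℝ}
    (hx : x ∈ Ioo (0 : ℝ) 1) : (∫ s in (0 : ℝ)..x, f s) = ∫ s in (0 : ℝ)..x, g s := by
  rw [intervalIntegral.integral_of_le hx.1.le, intervalIntegral.integral_of_le hx.1.le,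
    integral_Ioc_eq_integral_Ioo, integral_Ioc_eq_integral_Ioo]
  exact integral_congr_ae (ae_mono
    (Measure.restrict_mono (Ioo_subset_Ioo_right hx.2.le) le_rfl) h)

/-- The pairs `(z, ∂ₓz)` with `z ∈ H¹(Ω)` and `z(0) = 0`: both components are in `L²(Ω)`, and
(the continuous representative of) `z` is the primitive of `∂ₓz` that vanishes at `0`. -/
def H10Sub : Submodule ℝ (L2Om × L2Om) where
  carrier := {p | (p.1 : ℝ → ℝ) =ᵐ[muOm] fun x => ∫ s in (0 : ℝ)..x, p.2 s}
  zero_mem' := by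
    filter_upwards [Lp.coeFn_zero ℝ 2 muOm, ae_restrict_mem measurableSet_Ioo] with x h hx
    have h2 := L2Om.primitive_congr (Lp.coeFn_zero ℝ 2 muOm) hx
    change (0 : L2Om) x = ∫ s in (0 : ℝ)..x, (0 : L2Om) s
    rw [h, h2]
    simp
  add_mem' := by
    intro p q hp hq
    have hp' : (p.1 : ℝ → ℝ) =ᵐ[muOm] fun x => ∫ s in (0 : ℝ)..x, p.2 s := hp
    have hq' : (q.1 : ℝ → ℝ) =ᵐ[muOm] fun x => ∫ s in (0 : ℝ)..x, q.2 s := hq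
    filter_upwards [Lp.coeFn_add p.1 q.1, hp', hq', ae_restrict_mem measurableSet_Ioo]
      with x h h1 h2 hx
    have h3 := L2Om.primitive_congr (Lp.coeFn_add p.2 q.2) hx
    change (p.1 + q.1 : L2Om) x = ∫ s in (0 : ℝ)..x, (p.2 + q.2 : L2Om) s
    rw [h, h3, Pi.add_apply, h1, h2]
    exact (intervalIntegral.integral_add (p.2.intervalIntegrable hx)
      (q.2.intervalIntegrable hx)).symm
  smul_mem' := by
    intro c p hp
    have hp' : (p.1 : ℝ → ℝ) =ᵐ[muOm] fun x => ∫ s in (0 : ℝ)..x, p.2 s := hp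
    filter_upwards [Lp.coeFn_smul c p.1, hp', ae_restrict_mem measurableSet_Ioo] with x h h1 hx
    have h3 := L2Om.primitive_congr (Lp.coeFn_smul c p.2) hx
    change (c • p.1 : L2Om) x = ∫ s in (0 : ℝ)..x, (c • p.2 : L2Om) s
    rw [h, h3, Pi.smul_apply, h1]
    exact (intervalIntegral.integral_smul c (fun s => p.2 s)).symm

/-- The space `H¹₍₀₎(Ω) = {z ∈ H¹(Ω) : z(0) = 0}`. -/
def H10 : Type := ↥H10Sub

namespace H10

instance : AddCommGroup H10 := inferInstanceAs (AddCommGroup ↥H10Sub)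

instance : Module ℝ H10 := inferInstanceAs (Module ℝ ↥H10Sub)

/-- The underlying function `z` as an element of `L²(Ω)`. -/
def fn : H10 →ₗ[ℝ] L2Om := (LinearMap.fst ℝ L2Om L2Om).comp H10Sub.subtype

/-- The weak derivative `∂ₓz ∈ L²(Ω)`. -/
def dx : H10 →ₗ[ℝ] L2Om := (LinearMap.snd ℝ L2Om L2Om).comp H10Sub.subtype

theorem fn_ae (z : H10) : (fn z : ℝ → ℝ) =ᵐ[muOm] fun x => ∫ s in (0 : ℝ)..x, dx z s := z.2

theorem dx_injective : Function.Injective dx := by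
  intro y z h
  have h1 : fn y = fn z := by
    apply Lp.ext
    filter_upwards [fn_ae y, fn_ae z] with x hy hz
    rw [hy, hz, h]
  exact Subtype.ext (Prod.ext h1 h)

/-- The norm of `H¹₍₀₎(Ω)` is `‖z‖ = ‖∂ₓz‖` in `L²(Ω)`. -/
instance : NormedAddCommGroup H10 := NormedAddCommGroup.induced H10 L2Om dx dx_injective

instance : NormedSpace ℝ H10 := NormedSpace.induced ℝ H10 L2Om dx

theorem norm_def (z : H10) : ‖z‖ = ‖dx z‖ := rfl

/-- The Poincaré inequality, which makes the inclusion in `L²(Ω)` continuous. -/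
theorem norm_fn_le (z : H10) : ‖fn z‖ ≤ 1 * ‖z‖ := by
  rw [one_mul, norm_def]
  have hvol : muOm univ = 1 := by simp
  have : IsProbabilityMeasure muOm := ⟨hvol⟩
  have hL1 : (∫ s, ‖dx z s‖ ∂muOm) ≤ ‖dx z‖ := by
    have h1 : eLpNorm (dx z : ℝ → ℝ) 1 muOm ≤ eLpNorm (dx z : ℝ → ℝ) 2 muOm :=
      eLpNorm_le_eLpNorm_of_exponent_le (by norm_num) (Lp.memLp (dx z)).1
    rw [Lp.norm_def, integral_norm_eq_lintegral_enorm (Lp.memLp (dx z)).1,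
      ← eLpNorm_one_eq_lintegral_enorm]
    exact ENNReal.toReal_mono (Lp.memLp (dx z)).2.ne h1
  have hb : ∀ᵐ x ∂muOm, ‖fn z x‖ ≤ ‖dx z‖ := by
    filter_upwards [fn_ae z, ae_restrict_mem measurableSet_Ioo] with x hz hx
    rw [hz]
    refine (intervalIntegral.norm_integral_le_integral_norm hx.1.le).trans (le_trans ?_ hL1)
    rw [intervalIntegral.integral_of_le hx.1.le, integral_Ioc_eq_integral_Ioo]
    exact setIntegral_mono_set (L2Om.integrable (dx z)).norm
      (Eventually.of_forall fun s => norm_nonneg _)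
      (Ioo_subset_Ioo_right hx.2.le).eventuallyLE
  have h := Lp.norm_le_of_ae_bound (f := fn z) (norm_nonneg _) hb
  have hv : measureUnivNNReal muOm = 1 := by simp [measureUnivNNReal]
  simpa [hv] using h

/-- The continuous inclusion `H¹₍₀₎(Ω) ↪ L²(Ω)`. -/
def toL2 : H10 →L[ℝ] L2Om := fn.mkContinuous 1 norm_fn_le

end H10

/-- `H⁻¹₍₀₎(Ω)`, the dual of `H¹₍₀₎(Ω)` with the dual norm. -/
abbrev Hm1 : Type := H10 →L[ℝ] ℝ

/-- The inclusion `L²(Ω) ↪ H⁻¹₍₀₎(Ω)`, `f ↦ (z ↦ ∫_Ω f z)`. -/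
def L2toHm1 (f : L2Om) : Hm1 := (innerSL ℝ f).comp H10.toL2

/-- `w` (with time derivatives `w₁ = ∂ₜw`, `w₂ = ∂ₜₜw`) is the weak solution of the backward problem
`∂ₜₜw - ∂ₓₓw + A w = g` in `Q_T`, `w(0,·) = 0`, `∂ₓw(1,·) = 0`, `(w, ∂ₜw)(·,T) = (0,0)`,
of class `C⁰([0,T]; H¹₍₀₎) ∩ C¹([0,T]; L²) ∩ H²(0,T; H⁻¹₍₀₎)`.
Only the values at times in `[0,T]` matter. -/
structure IsBackwardWeakSolution (T : ℝ) (A : LinfQ T) (g : L2Q T)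
    (w : ℝ → H10) (w₁ : ℝ → L2Om) (w₂ : ℝ → Hm1) : Prop where
  continuousOn : ContinuousOn w (Icc 0 T)
  hasDeriv : ∀ t ∈ Icc 0 T, HasDerivWithinAt (fun s => H10.toL2 (w s)) (w₁ t) (Icc 0 T) t
  continuousOn_deriv : ContinuousOn w₁ (Icc 0 T)
  /-- `∂ₜₜw ∈ L²(0,T; H⁻¹₍₀₎)` -/
  memLp_deriv2 : MemLp w₂ 2 (muT T)
  /-- `w₂` is the time derivative of `∂ₜw` in `H⁻¹₍₀₎`. -/
  deriv2_eq : ∀ t ∈ Icc 0 T, L2toHm1 (w₁ t) = L2toHm1 (w₁ 0) + ∫ s in (0 : ℝ)..t, w₂ s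
  equation : ∀ᵐ t ∂(muT T), ∀ z : H10,
    w₂ t z + (∫ x, H10.dx (w t) x * H10.dx z x ∂muOm)
      + (∫ x, A (x, t) * H10.toL2 (w t) x * H10.toL2 z x ∂muOm)
      = ∫ x, g (x, t) * H10.toL2 z x ∂muOm
  final : w T = 0
  final_deriv : w₁ T = 0

/-- `φ ∈ L²(Q_T)` is a solution in the sense of transposition of
`∂ₜₜφ - ∂ₓₓφ + A φ = B` in `Q_T`, `φ(0,·) = 0`, `∂ₓφ(1,·) = 0`, `(φ, ∂ₜφ)(·,0) = (φ₀, φ₁)`. -/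
def IsTranspositionSolution (T : ℝ) (A : LinfQ T) (B : L2Q T) (φ₀ : L2Om) (φ₁ : Hm1)
    (φ : L2Q T) : Prop :=
  ∀ (g : L2Q T) (w : ℝ → H10) (w₁ : ℝ → L2Om) (w₂ : ℝ → Hm1),
    IsBackwardWeakSolution T A g w w₁ w₂ →
      (∫ p, φ p * g p ∂(muQ T))
        = (∫ t, (∫ x, B (x, t) * H10.toL2 (w t) x ∂muOm) ∂(muT T))
          + φ₁ (w 0) - ∫ x, φ₀ x * w₁ 0 x ∂muOm

/-- `t ↦ Φ t` is the representative of `φ` in `C⁰([0,T]; L²(Ω)) ∩ C¹([0,T]; H⁻¹₍₀₎(Ω))`, and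
`t ↦ Φ' t` is its time derivative in `H⁻¹₍₀₎(Ω)`. Both are determined by `φ` on `[0,T]`. -/
structure IsTimeRepresentative (T : ℝ) (φ : L2Q T) (Φ : ℝ → L2Om) (Φ' : ℝ → Hm1) : Prop where
  ae_eq : ∀ᵐ t ∂(muT T), (Φ t : ℝ → ℝ) =ᵐ[muOm] fun x => φ (x, t)
  continuousOn : ContinuousOn Φ (Icc 0 T)
  hasDeriv : ∀ t ∈ Icc 0 T, HasDerivWithinAt (fun s => L2toHm1 (Φ s)) (Φ' t) (Icc 0 T) t
  continuousOn_deriv : ContinuousOn Φ' (Icc 0 T)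

/-- `u ∈ L²(0,T)` is the trace `φ(1,·)`: the averages of `φ(x,·)` over `1 - ε < x < 1` converge
to `u` in `L²(0,T)` as `ε → 0⁺`. -/
def IsTraceAtOne (T : ℝ) (φ : L2Q T) (u : L2T T) : Prop :=
  Tendsto (fun ε : ℝ => eLpNorm (fun t => ε⁻¹ * (∫ x in (1 - ε)..1, φ (x, t)) - u t) 2 (muT T))
    (𝓝[>] 0) (𝓝 0)

/-- `∂ₜₜφ - ∂ₓₓφ + A φ = F` in the sense of distributions in `Q_T`. -/
def IsWaveOperator (T : ℝ) (A : LinfQ T) (φ F : L2Q T) : Prop :=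
  ∀ θ : ℝ × ℝ → ℝ, ContDiff ℝ ∞ θ → HasCompactSupport θ → tsupport θ ⊆ Ioo 0 1 ×ˢ Ioo 0 T →
    (∫ p, φ p * (iteratedDeriv 2 (fun t => θ (p.1, t)) p.2
        - iteratedDeriv 2 (fun x => θ (x, p.2)) p.1 + A p * θ p) ∂(muQ T))
      = ∫ p, F p * θ p ∂(muQ T)

end

/-!
Let `G` be the primitive of `∂ₜφ` that vanishes at `x = 1`. The wave equation `∂ₜₜφ - ∂ₓₓφ = F`
becomes a first-order system for `(φ, G)`, whose energy `∫_Ω φ² + G²` is the squared norm of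
`(φ, ∂ₜφ)` in `L² × H⁻¹₍₀₎`.

For classical solutions the system is solved sideways, with `x` in the role of time: an energy
estimate in the cone `1 - x < t < T - 1 + x` bounds `φ² + G²` there by the trace at `x = 1`. As
`T > 2`, the cone contains a time interval times the whole of `Ω`, and multiplying by a cut-off
that decreases from `1` to `0` on this interval gives a backward energy estimate for the data at
`t = 0`. In both estimates a primitive of the source enters the energy with the weight `m⁻²`,
where `m = 1 + √‖A‖`, so that a potential of size `m²` costs only a factor `exp(C m)`.

In general, the data and the source `F = B - Aφ` are approximated by the data of finite sums of
eigenmodes. The energy estimate and hidden regularity carry the solution, its velocity and its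
trace to a limit. Tested with a backward solution `w = sin((n + 1/2) π x) a(t)`, whose source is
`∂ₜₜw - ∂ₓₓw + Aw`, the transposition identity for `φ` and Green's formula for the limit agree up to
`∫ Aφw`, which the choice of `F` absorbs; hence the limit is `φ`.
-/

noncomputable section

/-! ### Continuous functions in the `L²` spaces -/

theorem memLp_restrict_of_continuous {X E : Type*} [TopologicalSpace X] [MeasurableSpace X]
    [OpensMeasurableSpace X] [NormedAddCommGroup E] [SecondCountableTopologyEither X E]
    {μ : Measure X} [IsFiniteMeasureOnCompacts μ] {f : X → E} (hf : Continuous f) {s K : Set X}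
    (hK : IsCompact K) (hs : s ⊆ K) (hm : MeasurableSet s) (p : ℝ≥0∞) :
    MemLp f p (μ.restrict s) := by
  have : IsFiniteMeasure (μ.restrict s) :=
    ⟨by simpa using (measure_mono hs).trans_lt hK.measure_lt_top⟩
  obtain ⟨C, hC⟩ := hK.exists_bound_of_continuousOn hf.continuousOn
  refine MemLp.of_bound hf.aestronglyMeasurable C ?_
  filter_upwards [ae_restrict_mem hm] with x hx using hC x (hs hx)

theorem memLp_muOm {f : ℝ → ℝ} (hf : Continuous f) (p : ℝ≥0∞) : MemLp f p muOm :=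
  memLp_restrict_of_continuous hf isCompact_Icc Ioo_subset_Icc_self measurableSet_Ioo p

theorem memLp_muT {E : Type*} [NormedAddCommGroup E] {f : ℝ → E} (hf : Continuous f) (T : ℝ)
    (p : ℝ≥0∞) : MemLp f p (muT T) :=
  memLp_restrict_of_continuous hf isCompact_Icc Ioo_subset_Icc_self measurableSet_Ioo p

theorem memLp_muQ {f : ℝ × ℝ → ℝ} (hf : Continuous f) (T : ℝ) (p : ℝ≥0∞) : MemLp f p (muQ T) :=
  memLp_restrict_of_continuous hf (isCompact_Icc.prod isCompact_Icc)
    (prod_mono Ioo_subset_Icc_self Ioo_subset_Icc_self)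
    (measurableSet_Ioo.prod measurableSet_Ioo) p

theorem integrable_muQ {f : ℝ × ℝ → ℝ} (hf : Continuous f) (T : ℝ) : Integrable f (muQ T) :=
  memLp_one_iff_integrable.1 (memLp_muQ hf T 1)

/-- The class in `L²(Ω)` of a continuous function. -/
def L2Om.ofContinuous (f : ℝ → ℝ) (hf : Continuous f) : L2Om := (memLp_muOm hf 2).toLp f

/-- The class in `L²(0,T)` of a continuous function. -/
def L2T.ofContinuous (T : ℝ) (f : ℝ → ℝ) (hf : Continuous f) : L2T T := (memLp_muT hf T 2).toLp f

/-- The class in `L²(Q_T)` of a continuous function. -/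
def L2Q.ofContinuous (T : ℝ) (f : ℝ × ℝ → ℝ) (hf : Continuous f) : L2Q T :=
  (memLp_muQ hf T 2).toLp f

theorem L2Om.coeFn_ofContinuous {f : ℝ → ℝ} (hf : Continuous f) :
    (L2Om.ofContinuous f hf : ℝ → ℝ) =ᵐ[muOm] f :=
  MemLp.coeFn_toLp _

theorem L2T.coeFn_ofContinuous {T : ℝ} {f : ℝ → ℝ} (hf : Continuous f) :
    (L2T.ofContinuous T f hf : ℝ → ℝ) =ᵐ[muT T] f :=
  MemLp.coeFn_toLp _

theorem L2Q.coeFn_ofContinuous {T : ℝ} {f : ℝ × ℝ → ℝ} (hf : Continuous f) :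
    (L2Q.ofContinuous T f hf : ℝ × ℝ → ℝ) =ᵐ[muQ T] f :=
  MemLp.coeFn_toLp _

theorem integral_muOm (f : ℝ → ℝ) : ∫ x, f x ∂muOm = ∫ x in (0 : ℝ)..1, f x := by
  rw [intervalIntegral.integral_of_le zero_le_one, integral_Ioc_eq_integral_Ioo]

theorem integral_muT {T : ℝ} (hT : 0 ≤ T) (f : ℝ → ℝ) :
    ∫ x, f x ∂(muT T) = ∫ x in (0 : ℝ)..T, f x := by
  rw [intervalIntegral.integral_of_le hT, integral_Ioc_eq_integral_Ioo]

theorem muQ_eq_prod (T : ℝ) : muQ T = muOm.prod (muT T) := by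
  rw [Measure.prod_restrict]; rfl

theorem integral_muQ_eq_iterated {T : ℝ} {f : ℝ × ℝ → ℝ} (hf : Integrable f (muQ T)) :
    ∫ p, f p ∂(muQ T) = ∫ t, ∫ x, f (x, t) ∂muOm ∂(muT T) := by
  rw [muQ_eq_prod] at hf ⊢
  exact integral_prod_symm f hf

theorem integral_muQ_eq_interval {T : ℝ} (hT : 0 ≤ T) {f : ℝ × ℝ → ℝ} (hf : Continuous f) :
    ∫ p, f p ∂(muQ T) = ∫ t in (0 : ℝ)..T, ∫ x in (0 : ℝ)..1, f (x, t) := by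
  rw [integral_muQ_eq_iterated (integrable_muQ hf T), integral_muT hT]
  simp_rw [integral_muOm]

theorem ae_muQ_mem_Icc (T : ℝ) : ∀ᵐ z ∂(muQ T), z.1 ∈ Icc (0 : ℝ) 1 ∧ z.2 ∈ Icc 0 T := by
  filter_upwards [ae_restrict_mem (measurableSet_Ioo.prod measurableSet_Ioo)] with z hz
  exact ⟨Ioo_subset_Icc_self hz.1, Ioo_subset_Icc_self hz.2⟩

theorem ae_muQ_slice {T : ℝ} {P : ℝ × ℝ → Prop} (h : ∀ᵐ p ∂(muQ T), P p) :
    ∀ᵐ t ∂(muT T), ∀ᵐ x ∂muOm, P (x, t) := by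
  rw [muQ_eq_prod, ← Measure.prod_swap] at h
  exact Measure.ae_ae_of_ae_prod (ae_of_ae_map measurable_swap.aemeasurable h)

theorem Lp_two_inner {X : Type*} [MeasurableSpace X] {μ : Measure X} (f g : Lp ℝ 2 μ) :
    inner ℝ f g = ∫ x, f x * g x ∂μ := by
  rw [L2.inner_def]
  exact integral_congr_ae (Eventually.of_forall fun x => by simp [mul_comm])

theorem Lp_two_norm_sq {X : Type*} [MeasurableSpace X] {μ : Measure X} (f : Lp ℝ 2 μ) :
    ‖f‖ ^ 2 = ∫ x, f x ^ 2 ∂μ := by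
  rw [← real_inner_self_eq_norm_sq, Lp_two_inner]
  simp only [sq]

theorem L2Om.norm_sq_ofContinuous {f : ℝ → ℝ} (hf : Continuous f) :
    ‖L2Om.ofContinuous f hf‖ ^ 2 = ∫ x in (0 : ℝ)..1, f x ^ 2 := by
  rw [Lp_two_norm_sq, ← integral_muOm]
  exact integral_congr_ae ((coeFn_ofContinuous hf).mono fun x hx => by simp only [hx])

theorem L2T.norm_sq_ofContinuous {T : ℝ} (hT : 0 ≤ T) {f : ℝ → ℝ} (hf : Continuous f) :
    ‖L2T.ofContinuous T f hf‖ ^ 2 = ∫ x in (0 : ℝ)..T, f x ^ 2 := by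
  rw [Lp_two_norm_sq, ← integral_muT hT]
  exact integral_congr_ae ((coeFn_ofContinuous hf).mono fun x hx => by simp only [hx])

theorem L2Q.norm_sq_ofContinuous {T : ℝ} {f : ℝ × ℝ → ℝ} (hf : Continuous f) :
    ‖L2Q.ofContinuous T f hf‖ ^ 2 = ∫ p, f p ^ 2 ∂(muQ T) := by
  rw [Lp_two_norm_sq]
  exact integral_congr_ae ((coeFn_ofContinuous hf).mono fun x hx => by simp only [hx])

/-! ### Calculus on rectangles -/

/-- `f' = ∂ₓf`, where points of the plane are written `(x, t)`. -/
abbrev HasDerivX (f f' : ℝ × ℝ → ℝ) : Prop :=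
  ∀ x t, HasDerivAt (fun s => f (s, t)) (f' (x, t)) x

/-- `f' = ∂ₜf`, where points of the plane are written `(x, t)`. -/
abbrev HasDerivT (f f' : ℝ × ℝ → ℝ) : Prop :=
  ∀ x t, HasDerivAt (fun s => f (x, s)) (f' (x, t)) t

theorem continuous_integral_slice_left {f : ℝ × ℝ → ℝ} (hf : Continuous f) (c d : ℝ) :
    Continuous fun t => ∫ x in c..d, f (x, t) :=
  intervalIntegral.continuous_parametric_intervalIntegral_of_continuous' (f := fun t x => f (x, t))
    (by fun_prop) c d

theorem continuous_integral_slice_right {f : ℝ × ℝ → ℝ} (hf : Continuous f) (c d : ℝ) :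
    Continuous fun x => ∫ t in c..d, f (x, t) :=
  intervalIntegral.continuous_parametric_intervalIntegral_of_continuous' (f := fun x t => f (x, t))
    (by fun_prop) c d

theorem intervalIntegral_swap {f : ℝ × ℝ → ℝ} (hf : Continuous f) (a b c d : ℝ) :
    ∫ t in a..b, ∫ x in c..d, f (x, t) = ∫ x in c..d, ∫ t in a..b, f (x, t) := by
  refine intervalIntegral_intervalIntegral_swap ?_
  have h : Continuous (Function.uncurry fun t x => f (x, t)) := by
    simp only [Function.uncurry_def]; fun_prop
  exact (h.continuousOn.integrableOn_compact
    (isCompact_uIcc.prod isCompact_uIcc)).mono_set (prod_mono uIoc_subset_uIcc uIoc_subset_uIcc)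

theorem integral_mono_on_of_continuous {f g : ℝ → ℝ} (hf : Continuous f) (hg : Continuous g)
    {a b : ℝ} (hab : a ≤ b) (h : ∀ x ∈ Icc a b, f x ≤ g x) :
    ∫ x in a..b, f x ≤ ∫ x in a..b, g x :=
  intervalIntegral.integral_mono_on hab (hf.intervalIntegrable _ _) (hg.intervalIntegrable _ _) h

theorem integral_integral_mono {f g : ℝ × ℝ → ℝ} (hf : Continuous f) (hg : Continuous g)
    {a b c d : ℝ} (hab : a ≤ b) (hcd : c ≤ d)
    (h : ∀ x ∈ Icc c d, ∀ t ∈ Icc a b, f (x, t) ≤ g (x, t)) :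
    ∫ t in a..b, ∫ x in c..d, f (x, t) ≤ ∫ t in a..b, ∫ x in c..d, g (x, t) :=
  integral_mono_on_of_continuous (continuous_integral_slice_left hf c d)
    (continuous_integral_slice_left hg c d) hab fun t ht =>
      integral_mono_on_of_continuous (by fun_prop) (by fun_prop) hcd fun x hx => h x hx t ht

theorem integral_le_integral_of_subset {f g : ℝ → ℝ} (hf : Continuous f) (hg : Continuous g)
    {a b c : ℝ} (hab : a ≤ b) (hbc : b ≤ c) (h : ∀ x ∈ Icc a b, f x ≤ g x) (hg0 : ∀ x, 0 ≤ g x) :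
    ∫ x in a..b, f x ≤ ∫ x in a..c, g x :=
  (integral_mono_on_of_continuous hf hg hab h).trans
    (intervalIntegral.integral_mono_interval le_rfl hab hbc (Eventually.of_forall hg0)
      (hg.intervalIntegrable _ _))

theorem HasDerivX.integral_eq_sub {f f' : ℝ × ℝ → ℝ} (h : HasDerivX f f') (hf' : Continuous f')
    (a b t : ℝ) : ∫ x in a..b, f' (x, t) = f (b, t) - f (a, t) :=
  intervalIntegral.integral_eq_sub_of_hasDerivAt (fun x _ => h x t)
    (Continuous.intervalIntegrable (by fun_prop) _ _)

theorem HasDerivT.integral_eq_sub {f f' : ℝ × ℝ → ℝ} (h : HasDerivT f f') (hf' : Continuous f')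
    (a b x : ℝ) : ∫ t in a..b, f' (x, t) = f (x, b) - f (x, a) :=
  intervalIntegral.integral_eq_sub_of_hasDerivAt (fun t _ => h x t)
    (Continuous.intervalIntegrable (by fun_prop) _ _)

theorem HasDerivX.integral_slice {f f' : ℝ × ℝ → ℝ} (h : HasDerivX f f') (hf : Continuous f)
    (hf' : Continuous f') (a b x : ℝ) :
    HasDerivAt (fun s => ∫ t in a..b, f (s, t)) (∫ t in a..b, f' (x, t)) x := by
  have h1 : (fun s => ∫ t in a..b, f (s, t))
      = fun s => (∫ t in a..b, f (0, t)) + ∫ y in (0 : ℝ)..s, ∫ t in a..b, f' (y, t) := by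
    ext s
    rw [← intervalIntegral_swap hf', ← sub_eq_iff_eq_add', ← intervalIntegral.integral_sub
      (Continuous.intervalIntegrable (by fun_prop) _ _)
      (Continuous.intervalIntegrable (by fun_prop) _ _)]
    exact intervalIntegral.integral_congr fun t _ => (h.integral_eq_sub hf' 0 s t).symm
  rw [h1]
  exact ((continuous_integral_slice_right hf' a b).integral_hasStrictDerivAt
    0 x).hasDerivAt.const_add _

theorem hasDerivT_integral {f : ℝ × ℝ → ℝ} (hf : Continuous f) (a : ℝ) :
    HasDerivT (fun z => ∫ s in a..z.2, f (z.1, s)) f := fun x t =>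
  ((by fun_prop : Continuous fun s => f (x, s)).integral_hasStrictDerivAt a t).hasDerivAt

/-- `D` is the divergence `∂ₓf + ∂ₜg` of the flux `(f, g)`, with continuous partial derivatives. -/
def IsDivergence (f g D : ℝ × ℝ → ℝ) : Prop :=
  ∃ f' g' : ℝ × ℝ → ℝ, Continuous f' ∧ Continuous g' ∧ HasDerivX f f' ∧ HasDerivT g g' ∧
    ∀ z, D z = f' z + g' z

namespace IsDivergence

variable {f g D f₂ g₂ D₂ : ℝ × ℝ → ℝ}

theorem continuous (h : IsDivergence f g D) : Continuous D := by
  obtain ⟨f', g', hf', hg', -, -, hD⟩ := h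
  exact (hf'.add hg').congr fun z => (hD z).symm

theorem add (h : IsDivergence f g D) (h₂ : IsDivergence f₂ g₂ D₂) :
    IsDivergence (fun z => f z + f₂ z) (fun z => g z + g₂ z) (fun z => D z + D₂ z) := by
  obtain ⟨f', g', hf', hg', hfd, hgd, hD⟩ := h
  obtain ⟨f₂', g₂', hf₂', hg₂', hf₂d, hg₂d, hD₂⟩ := h₂
  exact ⟨fun z => f' z + f₂' z, fun z => g' z + g₂' z, hf'.add hf₂', hg'.add hg₂',
    fun x t => (hfd x t).fun_add (hf₂d x t), fun x t => (hgd x t).fun_add (hg₂d x t),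
    fun z => by simp only [hD, hD₂]; ring⟩

theorem integral_eq (h : IsDivergence f g D) (a b c d : ℝ) :
    ∫ t in a..b, ∫ x in c..d, D (x, t)
      = (∫ t in a..b, (f (d, t) - f (c, t))) + ∫ x in c..d, (g (x, b) - g (x, a)) := by
  obtain ⟨f', g', hf', hg', hfd, hgd, hD⟩ := h
  have hD' : ∀ t, ∫ x in c..d, D (x, t)
      = (∫ x in c..d, f' (x, t)) + ∫ x in c..d, g' (x, t) := fun t => by
    simp_rw [hD]
    exact intervalIntegral.integral_add (Continuous.intervalIntegrable (by fun_prop) _ _)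
      (Continuous.intervalIntegrable (by fun_prop) _ _)
  simp_rw [hD']
  rw [intervalIntegral.integral_add
    ((continuous_integral_slice_left hf' c d).intervalIntegrable _ _)
    ((continuous_integral_slice_left hg' c d).intervalIntegrable _ _), intervalIntegral_swap hg']
  simp_rw [hfd.integral_eq_sub hf', hgd.integral_eq_sub hg']

end IsDivergence

theorem sq_intervalIntegral_le_mul {f : ℝ → ℝ} (hf : Continuous f) {c d : ℝ} (hcd : c ≤ d) :
    (∫ x in c..d, f x) ^ 2 ≤ (d - c) * ∫ x in c..d, f x ^ 2 := by
  set m := ∫ x in c..d, f x with hm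
  have key : 0 ≤ ∫ x in c..d, ((d - c) * f x - m) ^ 2 :=
    intervalIntegral.integral_nonneg hcd fun x _ => sq_nonneg _
  have hexp : ∫ x in c..d, ((d - c) * f x - m) ^ 2
      = (d - c) * ((d - c) * (∫ x in c..d, f x ^ 2) - m ^ 2) := by
    have h1 : ∀ x, ((d - c) * f x - m) ^ 2
        = (d - c) ^ 2 * f x ^ 2 - 2 * (d - c) * m * f x + m ^ 2 := fun x => by ring
    simp_rw [h1]
    rw [intervalIntegral.integral_add, intervalIntegral.integral_sub,
      intervalIntegral.integral_const_mul, intervalIntegral.integral_const_mul,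
      intervalIntegral.integral_const, ← hm]
    · simp only [smul_eq_mul]; ring
    all_goals exact Continuous.intervalIntegrable (by fun_prop) _ _
  rcases hcd.eq_or_lt with h | h
  · simp [hm, ← h]
  · rw [hexp] at key
    linarith [nonneg_of_mul_nonneg_right key (sub_pos.2 h)]

theorem sq_intervalIntegral_le {f : ℝ → ℝ} (hf : Continuous f) {c d : ℝ} (hc : 0 ≤ c)
    (hcd : c ≤ d) (hd : d ≤ 1) :
    (∫ x in c..d, f x) ^ 2 ≤ (d - c) * ∫ x in (0 : ℝ)..1, f x ^ 2 :=
  (sq_intervalIntegral_le_mul hf hcd).trans (mul_le_mul_of_nonneg_left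
    (intervalIntegral.integral_mono_interval hc hcd hd
      (Eventually.of_forall fun _ => sq_nonneg _) ((hf.pow 2).intervalIntegrable _ _))
    (sub_nonneg.2 hcd))

theorem HasDerivX.sq_le_of_eq_zero_at_one {f f' : ℝ × ℝ → ℝ} (h : HasDerivX f f')
    (hf' : Continuous f') {t : ℝ} (h_one : f (1, t) = 0) {x : ℝ} (hx : x ∈ Icc (0 : ℝ) 1) :
    f (x, t) ^ 2 ≤ ∫ y in (0 : ℝ)..1, f' (y, t) ^ 2 := by
  have hsq := sq_intervalIntegral_le (f := fun y => f' (y, t)) (by fun_prop) hx.1 hx.2 le_rfl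
  rw [h.integral_eq_sub hf', h_one, zero_sub, neg_sq] at hsq
  exact hsq.trans (mul_le_of_le_one_left
    (intervalIntegral.integral_nonneg zero_le_one fun _ _ => sq_nonneg _) (by linarith [hx.1]))

/-! ### First-order systems and the wave equation -/

/-- A first-order form `∂ₜu = ∂ₓv + P`, `∂ₜv = ∂ₓu + R` of a wave equation, with continuous source
terms `P`, `R` and continuous derivatives `ux = ∂ₓu`, `vx = ∂ₓv`. -/
structure IsFirstOrderSystem (u v P R ux vx : ℝ × ℝ → ℝ) : Prop where
  u_cont : Continuous u
  v_cont : Continuous v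
  P_cont : Continuous P
  R_cont : Continuous R
  ux_cont : Continuous ux
  vx_cont : Continuous vx
  u_dx : HasDerivX u ux
  v_dx : HasDerivX v vx
  u_dt : HasDerivT u fun z => vx z + P z
  v_dt : HasDerivT v fun z => ux z + R z

namespace IsFirstOrderSystem

variable {u v P R ux vx : ℝ × ℝ → ℝ}

theorem isDivergence_energy (h : IsFirstOrderSystem u v P R ux vx) {a a' : ℝ → ℝ}
    (ha : ∀ t, HasDerivAt a (a' t) t) (ha' : Continuous a') :
    IsDivergence (fun z => -(2 * a z.2 * (u z * v z))) (fun z => a z.2 * (u z ^ 2 + v z ^ 2))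
      (fun z => a' z.2 * (u z ^ 2 + v z ^ 2) + 2 * a z.2 * (u z * P z + v z * R z)) := by
  have ha_cont : Continuous a := continuous_iff_continuousAt.2 fun t => (ha t).continuousAt
  obtain ⟨hu, hv, hP, hR, hux, hvx, u_dx, v_dx, u_dt, v_dt⟩ := h
  refine ⟨fun z => -(2 * a z.2 * (ux z * v z + u z * vx z)), fun z => a' z.2 * (u z ^ 2 + v z ^ 2)
      + a z.2 * (2 * u z * (vx z + P z) + 2 * v z * (ux z + R z)), by fun_prop, by fun_prop,
    fun x t => (((u_dx x t).fun_mul (v_dx x t)).const_mul (2 * a t)).fun_neg, fun x t => ?_,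
    fun z => ?_⟩
  · convert! (ha t).fun_mul (((u_dt x t).fun_pow 2).fun_add ((v_dt x t).fun_pow 2)) using 1
    push_cast; ring
  · ring

theorem isDivergence_momentum (h : IsFirstOrderSystem u v P R ux vx) {b bx bt : ℝ × ℝ → ℝ}
    (hb : Continuous b) (hbx : Continuous bx) (hbt : Continuous bt)
    (b_dx : HasDerivX b bx) (b_dt : HasDerivT b bt) :
    IsDivergence (fun z => b z * (u z ^ 2 + v z ^ 2)) (fun z => -(2 * (b z * (u z * v z))))
      (fun z => bx z * (u z ^ 2 + v z ^ 2) - 2 * (bt z * (u z * v z))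
        - 2 * b z * (v z * P z + u z * R z)) := by
  obtain ⟨hu, hv, hP, hR, hux, hvx, u_dx, v_dx, u_dt, v_dt⟩ := h
  refine ⟨fun z => bx z * (u z ^ 2 + v z ^ 2) + b z * (2 * u z * ux z + 2 * v z * vx z),
    fun z => -(2 * (bt z * (u z * v z) + b z * ((vx z + P z) * v z + u z * (ux z + R z)))),
    by fun_prop, by fun_prop, fun x t => ?_,
    fun x t => (((b_dt x t).fun_mul ((u_dt x t).fun_mul (v_dt x t))).const_mul 2).fun_neg,
    fun z => ?_⟩
  · convert! (b_dx x t).fun_mul (((u_dx x t).fun_pow 2).fun_add ((v_dx x t).fun_pow 2)) using 1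
    push_cast; ring
  · ring

end IsFirstOrderSystem

/-- A classical solution `φ` of `∂ₜₜφ - ∂ₓₓφ = F`, `φ(0,·) = 0`, `∂ₓφ(1,·) = 0`, written as the
system `∂ₜφ = ∂ₓG`, `∂ₜG = ∂ₓφ + H` with `∂ₓH = F` and `G(1,·) = H(1,·) = 0`. The norm of
`(φ, ∂ₜφ)` in `L² × H⁻¹₍₀₎` is the norm of `(φ, G)` in `L² × L²`. -/
structure WaveSolution where
  /-- the solution -/
  φ : ℝ × ℝ → ℝ
  /-- the primitive of `∂ₜφ` that vanishes at `x = 1` -/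
  G : ℝ × ℝ → ℝ
  /-- the primitive of `F` that vanishes at `x = 1` -/
  H : ℝ × ℝ → ℝ
  /-- the right-hand side of the wave equation -/
  F : ℝ × ℝ → ℝ
  /-- `∂ₜφ` -/
  p : ℝ × ℝ → ℝ
  /-- `∂ₓφ` -/
  q : ℝ × ℝ → ℝ
  hφ : Continuous φ
  hG : Continuous G
  hH : Continuous H
  hF : Continuous F
  hp : Continuous p
  hq : Continuous q
  φ_dx : HasDerivX φ q
  φ_dt : HasDerivT φ p
  G_dx : HasDerivX G p
  G_dt : HasDerivT G fun z => q z + H z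
  H_dx : HasDerivX H F
  φ_zero : ∀ t, φ (0, t) = 0
  G_one : ∀ t, G (1, t) = 0
  H_one : ∀ t, H (1, t) = 0

namespace WaveSolution

/-- The zero solution. -/
def zero : WaveSolution where
  φ := fun _ => 0
  G := fun _ => 0
  H := fun _ => 0
  F := fun _ => 0
  p := fun _ => 0
  q := fun _ => 0
  hφ := continuous_const
  hG := continuous_const
  hH := continuous_const
  hF := continuous_const
  hp := continuous_const
  hq := continuous_const
  φ_dx := fun x _ => hasDerivAt_const x 0
  φ_dt := fun _ t => hasDerivAt_const t 0
  G_dx := fun x _ => hasDerivAt_const x 0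
  G_dt := fun _ t => by simpa using hasDerivAt_const t (0 : ℝ)
  H_dx := fun x _ => hasDerivAt_const x 0
  φ_zero := fun _ => rfl
  G_one := fun _ => rfl
  H_one := fun _ => rfl

/-- The solution `S + c S'`. -/
def addSMul (S : WaveSolution) (c : ℝ) (S' : WaveSolution) : WaveSolution where
  φ := fun z => S.φ z + c * S'.φ z
  G := fun z => S.G z + c * S'.G z
  H := fun z => S.H z + c * S'.H z
  F := fun z => S.F z + c * S'.F z
  p := fun z => S.p z + c * S'.p z
  q := fun z => S.q z + c * S'.q z
  hφ := S.hφ.add (continuous_const.mul S'.hφ)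
  hG := S.hG.add (continuous_const.mul S'.hG)
  hH := S.hH.add (continuous_const.mul S'.hH)
  hF := S.hF.add (continuous_const.mul S'.hF)
  hp := S.hp.add (continuous_const.mul S'.hp)
  hq := S.hq.add (continuous_const.mul S'.hq)
  φ_dx := fun x t => (S.φ_dx x t).add ((S'.φ_dx x t).const_mul c)
  φ_dt := fun x t => (S.φ_dt x t).add ((S'.φ_dt x t).const_mul c)
  G_dx := fun x t => (S.G_dx x t).add ((S'.G_dx x t).const_mul c)
  G_dt := fun x t => by
    convert! (S.G_dt x t).add ((S'.G_dt x t).const_mul c) using 1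
    ring
  H_dx := fun x t => (S.H_dx x t).add ((S'.H_dx x t).const_mul c)
  φ_zero := fun t => by simp [S.φ_zero, S'.φ_zero]
  G_one := fun t => by simp [S.G_one, S'.G_one]
  H_one := fun t => by simp [S.H_one, S'.H_one]

variable (S : WaveSolution)

theorem isFirstOrderSystem : IsFirstOrderSystem S.φ S.G (fun _ => 0) S.H S.q S.p where
  u_cont := S.hφ
  v_cont := S.hG
  P_cont := continuous_const
  R_cont := S.hH
  ux_cont := S.hq
  vx_cont := S.hp
  u_dx := S.φ_dx
  v_dx := S.G_dx
  u_dt := fun x t => by simpa using S.φ_dt x t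
  v_dt := S.G_dt

/-! ### Energy estimate and hidden regularity -/

/-- The energy `∫_Ω φ² + G²` at time `t`. -/
def energy (t : ℝ) : ℝ := ∫ x in (0 : ℝ)..1, (S.φ (x, t) ^ 2 + S.G (x, t) ^ 2)

/-- The squared norm of the Cauchy data and of the right-hand side on `Q_T`. -/
def dataSq (T : ℝ) : ℝ := S.energy 0 + ∫ t in (0 : ℝ)..T, ∫ x in (0 : ℝ)..1, S.F (x, t) ^ 2

theorem energy_nonneg (t : ℝ) : 0 ≤ S.energy t :=
  intervalIntegral.integral_nonneg zero_le_one fun _ _ => by positivity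

theorem continuous_energy : Continuous S.energy :=
  continuous_integral_slice_left ((S.hφ.pow 2).add (S.hG.pow 2)) 0 1

theorem integral_sq_F_nonneg {T : ℝ} (hT : 0 ≤ T) :
    0 ≤ ∫ t in (0 : ℝ)..T, ∫ x in (0 : ℝ)..1, S.F (x, t) ^ 2 :=
  intervalIntegral.integral_nonneg hT fun _ _ =>
    intervalIntegral.integral_nonneg zero_le_one fun _ _ => sq_nonneg _

theorem dataSq_nonneg {T : ℝ} (hT : 0 ≤ T) : 0 ≤ S.dataSq T :=
  add_nonneg (S.energy_nonneg 0) (S.integral_sq_F_nonneg hT)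

theorem dataSq_mono {s t : ℝ} (hs : 0 ≤ s) (hst : s ≤ t) : S.dataSq s ≤ S.dataSq t :=
  add_le_add_right (intervalIntegral.integral_mono_interval le_rfl hs hst
    (Eventually.of_forall fun _ => intervalIntegral.integral_nonneg zero_le_one
      fun _ _ => sq_nonneg _)
    ((continuous_integral_slice_left (S.hF.pow 2) 0 1).intervalIntegrable _ _)) _

theorem sq_H_le {x : ℝ} (hx : x ∈ Icc (0 : ℝ) 1) (t : ℝ) :
    S.H (x, t) ^ 2 ≤ ∫ y in (0 : ℝ)..1, S.F (y, t) ^ 2 :=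
  S.H_dx.sq_le_of_eq_zero_at_one S.hF (S.H_one t) hx

theorem integral_sq_H_le {T : ℝ} (hT : 0 ≤ T) :
    ∫ t in (0 : ℝ)..T, ∫ x in (0 : ℝ)..1, S.H (x, t) ^ 2
      ≤ ∫ t in (0 : ℝ)..T, ∫ x in (0 : ℝ)..1, S.F (x, t) ^ 2 := by
  refine integral_mono_on_of_continuous (continuous_integral_slice_left (S.hH.pow 2) 0 1)
    (continuous_integral_slice_left (S.hF.pow 2) 0 1) hT fun t _ => ?_
  calc ∫ x in (0 : ℝ)..1, S.H (x, t) ^ 2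
      ≤ ∫ x in (0 : ℝ)..1, ∫ y in (0 : ℝ)..1, S.F (y, t) ^ 2 :=
        intervalIntegral.integral_mono_on zero_le_one
          (Continuous.intervalIntegrable (by have := S.hH; fun_prop) _ _)
          intervalIntegrable_const fun x hx => S.sq_H_le hx t
    _ = ∫ y in (0 : ℝ)..1, S.F (y, t) ^ 2 := by simp

theorem exp_neg_mul_energy_le {t : ℝ} (ht : 0 ≤ t) :
    Real.exp (-t) * S.energy t ≤ S.dataSq t := by
  have hdiv := S.isFirstOrderSystem.isDivergence_energy (a := fun t => Real.exp (-t))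
    (a' := fun t => -Real.exp (-t)) (fun t => by simpa using (hasDerivAt_neg t).exp)
    (by fun_prop)
  have hle := integral_integral_mono (g := fun z => S.H z ^ 2) hdiv.continuous (S.hH.pow 2) ht
    zero_le_one fun x _ s hs => by
      have he : Real.exp (-s) ≤ 1 := Real.exp_le_one_iff.2 (by linarith [hs.1])
      calc -Real.exp (-s) * (S.φ (x, s) ^ 2 + S.G (x, s) ^ 2)
            + 2 * Real.exp (-s) * (S.φ (x, s) * 0 + S.G (x, s) * S.H (x, s))
          = Real.exp (-s) * (S.H (x, s) ^ 2 - (S.φ (x, s) ^ 2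
            + (S.G (x, s) - S.H (x, s)) ^ 2)) := by ring
        _ ≤ Real.exp (-s) * S.H (x, s) ^ 2 := by gcongr; exact sub_le_self _ (by positivity)
        _ ≤ S.H (x, s) ^ 2 := mul_le_of_le_one_left (sq_nonneg _) he
  have hE : ∫ x in (0 : ℝ)..1, (Real.exp (-t) * (S.φ (x, t) ^ 2 + S.G (x, t) ^ 2)
      - (S.φ (x, 0) ^ 2 + S.G (x, 0) ^ 2)) = Real.exp (-t) * S.energy t - S.energy 0 := by
    have hφ := S.hφ; have hG := S.hG
    rw [intervalIntegral.integral_sub (Continuous.intervalIntegrable (by fun_prop) _ _)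
      (Continuous.intervalIntegrable (by fun_prop) _ _), intervalIntegral.integral_const_mul,
      energy, energy]
  rw [hdiv.integral_eq] at hle
  simp only [S.φ_zero, S.G_one, mul_zero, zero_mul, neg_zero, sub_zero,
    intervalIntegral.integral_zero, zero_add, Real.exp_zero, one_mul, hE] at hle
  rw [dataSq]
  linarith [S.integral_sq_H_le ht]

theorem energy_le {T t : ℝ} (ht : t ∈ Icc 0 T) : S.energy t ≤ Real.exp T * S.dataSq T :=
  calc S.energy t = Real.exp t * (Real.exp (-t) * S.energy t) := by
        rw [← mul_assoc, ← Real.exp_add]; simp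
    _ ≤ Real.exp t * S.dataSq t := by gcongr; exact S.exp_neg_mul_energy_le ht.1
    _ ≤ Real.exp T * S.dataSq T := mul_le_mul (Real.exp_le_exp.2 ht.2) (S.dataSq_mono ht.1 ht.2)
        (S.dataSq_nonneg ht.1) (Real.exp_pos T).le

/-- The multiplier is `x ∂ₓφ`, integrated over `(0,x₀) × (0,T)`. -/
theorem integral_momentum_eq (T x₀ : ℝ) :
    (∫ t in (0 : ℝ)..T, x₀ * (S.φ (x₀, t) ^ 2 + S.G (x₀, t) ^ 2))
      = (∫ t in (0 : ℝ)..T, ∫ x in (0 : ℝ)..x₀,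
          (S.φ (x, t) ^ 2 + S.G (x, t) ^ 2 - 2 * x * (S.φ (x, t) * S.H (x, t))))
        + (∫ x in (0 : ℝ)..x₀, 2 * (x * (S.φ (x, T) * S.G (x, T))))
        - ∫ x in (0 : ℝ)..x₀, 2 * (x * (S.φ (x, 0) * S.G (x, 0))) := by
  have hφ := S.hφ; have hG := S.hG
  have h := (S.isFirstOrderSystem.isDivergence_momentum (b := fun z => z.1) (bx := fun _ => 1)
    (bt := fun _ => 0) (by fun_prop) (by fun_prop) (by fun_prop) (fun x _ => hasDerivAt_id' x)
    (fun x t => hasDerivAt_const t x)).integral_eq 0 T 0 x₀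
  rw [intervalIntegral.integral_sub (f := fun x => -(2 * (x * (S.φ (x, T) * S.G (x, T)))))
    (Continuous.intervalIntegrable (by fun_prop) _ _)
    (Continuous.intervalIntegrable (by fun_prop) _ _), intervalIntegral.integral_neg,
    intervalIntegral.integral_neg] at h
  simp only [mul_zero, zero_mul, sub_zero, one_mul, zero_add] at h
  linarith

theorem mul_mul_mul_le_sq_add_sq {c x : ℝ} (hc : |c| ≤ 2) (hx0 : 0 ≤ x) (hx1 : x ≤ 1) (a b : ℝ) :
    c * (x * (a * b)) ≤ a ^ 2 + b ^ 2 :=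
  calc c * (x * (a * b)) ≤ |c| * (x * (|a| * |b|)) := by
        rw [← abs_mul a b]
        nth_rw 2 [← abs_of_nonneg hx0]
        rw [← abs_mul, ← abs_mul]
        exact le_abs_self _
    _ ≤ 2 * (1 * (|a| * |b|)) := by gcongr
    _ ≤ a ^ 2 + b ^ 2 := by nlinarith [sq_nonneg (|a| - |b|), sq_abs a, sq_abs b]

theorem integral_momentum_density_le {T : ℝ} (hT : 0 ≤ T) {x₀ : ℝ} (h0 : 0 ≤ x₀) (h1 : x₀ ≤ 1) :
    ∫ t in (0 : ℝ)..T, ∫ x in (0 : ℝ)..x₀,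
        (S.φ (x, t) ^ 2 + S.G (x, t) ^ 2 - 2 * x * (S.φ (x, t) * S.H (x, t)))
      ≤ (∫ t in (0 : ℝ)..T, 2 * S.energy t)
        + ∫ t in (0 : ℝ)..T, ∫ x in (0 : ℝ)..1, S.H (x, t) ^ 2 := by
  have hφ := S.hφ; have hG := S.hG; have hH := S.hH; have hE := S.continuous_energy
  have hH2 := continuous_integral_slice_left (f := fun z => S.H z ^ 2) (by fun_prop) 0 1
  rw [← intervalIntegral.integral_add (Continuous.intervalIntegrable (by fun_prop) _ _)
    (hH2.intervalIntegrable _ _)]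
  refine integral_mono_on_of_continuous (continuous_integral_slice_left
    (f := fun z => S.φ z ^ 2 + S.G z ^ 2 - 2 * z.1 * (S.φ z * S.H z)) (by fun_prop) 0 x₀)
    ((continuous_const.mul hE).add hH2) hT fun t _ => ?_
  change _ ≤ 2 * (∫ x in (0 : ℝ)..1, (S.φ (x, t) ^ 2 + S.G (x, t) ^ 2))
    + ∫ x in (0 : ℝ)..1, S.H (x, t) ^ 2
  rw [← intervalIntegral.integral_const_mul, ← intervalIntegral.integral_add
    (Continuous.intervalIntegrable (by fun_prop) _ _)
    (Continuous.intervalIntegrable (by fun_prop) _ _)]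
  refine integral_le_integral_of_subset (by fun_prop) (by fun_prop) h0 h1
    (fun x hx => ?_) fun x => by positivity
  have := mul_mul_mul_le_sq_add_sq (c := -2) (by norm_num) hx.1 (hx.2.trans h1) (S.φ (x, t))
    (S.H (x, t))
  linarith [sq_nonneg (S.G (x, t))]

/-- Hidden regularity. -/
theorem integral_sq_slice_le {T : ℝ} (hT : 0 ≤ T) {x₀ : ℝ} (h0 : 1 / 2 ≤ x₀) (h1 : x₀ ≤ 1) :
    ∫ t in (0 : ℝ)..T, S.φ (x₀, t) ^ 2 ≤ (4 * T + 6) * (Real.exp T * S.dataSq T) := by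
  have hφ := S.hφ; have hG := S.hG; have hE := S.continuous_energy
  set D := Real.exp T * S.dataSq T
  have hx₀ : 0 ≤ x₀ := by linarith
  have h_trace : (1 / 2) * ∫ t in (0 : ℝ)..T, S.φ (x₀, t) ^ 2
      ≤ ∫ t in (0 : ℝ)..T, x₀ * (S.φ (x₀, t) ^ 2 + S.G (x₀, t) ^ 2) := by
    rw [← intervalIntegral.integral_const_mul]
    refine integral_mono_on_of_continuous (by fun_prop) (by fun_prop) hT fun t _ => ?_
    have := mul_nonneg hx₀ (sq_nonneg (S.G (x₀, t)))
    nlinarith [sq_nonneg (S.φ (x₀, t))]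
  have h_endpoint {t c : ℝ} (ht : t ∈ Icc 0 T) (hc : |c| ≤ 2) :
      ∫ x in (0 : ℝ)..x₀, c * (x * (S.φ (x, t) * S.G (x, t))) ≤ D :=
    (integral_le_integral_of_subset (by fun_prop) (by fun_prop) hx₀ h1
      (fun x hx => mul_mul_mul_le_sq_add_sq hc hx.1 (hx.2.trans h1) _ _)
      fun x => by positivity).trans (S.energy_le ht)
  have h_energy : ∫ t in (0 : ℝ)..T, 2 * S.energy t ≤ 2 * T * D :=
    calc ∫ t in (0 : ℝ)..T, 2 * S.energy t ≤ ∫ _t in (0 : ℝ)..T, 2 * D :=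
          integral_mono_on_of_continuous (by fun_prop) continuous_const hT fun t ht => by
            linarith [S.energy_le ht]
      _ = 2 * T * D := by simp only [intervalIntegral.integral_const, smul_eq_mul]; ring
  have h_source : ∫ t in (0 : ℝ)..T, ∫ x in (0 : ℝ)..1, S.H (x, t) ^ 2 ≤ D :=
    calc ∫ t in (0 : ℝ)..T, ∫ x in (0 : ℝ)..1, S.H (x, t) ^ 2 ≤ S.dataSq T :=
          (S.integral_sq_H_le hT).trans (le_add_of_nonneg_left (S.energy_nonneg 0))
      _ ≤ D := le_mul_of_one_le_left (S.dataSq_nonneg hT) (Real.one_le_exp hT)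
  have h_final := h_endpoint (c := 2) ⟨hT, le_rfl⟩ (by norm_num)
  have h_initial := h_endpoint (c := -2) ⟨le_rfl, hT⟩ (by norm_num)
  simp only [neg_mul, intervalIntegral.integral_neg] at h_initial
  linarith [S.integral_momentum_eq T x₀, S.integral_momentum_density_le hT hx₀ h1]

end WaveSolution

/-! ### Green's formula -/

/-- A `C²` function `w` with `w(0,·) = 0`, `∂ₓw(1,·) = 0` and `(w, ∂ₜw)(·,T) = (0,0)`, given with
its derivatives. Classical solutions on `Q_T` are tested against such functions. -/
structure WaveTest (T : ℝ) where
  /-- the test function -/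
  w : ℝ × ℝ → ℝ
  /-- `∂ₜw` -/
  wt : ℝ × ℝ → ℝ
  /-- `∂ₓw` -/
  wx : ℝ × ℝ → ℝ
  /-- `∂ₜₜw` -/
  wtt : ℝ × ℝ → ℝ
  /-- `∂ₜₓw` -/
  wtx : ℝ × ℝ → ℝ
  /-- `∂ₓₓw` -/
  wxx : ℝ × ℝ → ℝ
  hw : Continuous w
  hwt : Continuous wt
  hwx : Continuous wx
  hwtt : Continuous wtt
  hwtx : Continuous wtx
  hwxx : Continuous wxx
  w_dx : HasDerivX w wx
  wt_dt : HasDerivT wt wtt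
  wt_dx : HasDerivX wt wtx
  wx_dt : HasDerivT wx wtx
  wx_dx : HasDerivX wx wxx
  w_zero : ∀ t, w (0, t) = 0
  wt_zero : ∀ t, wt (0, t) = 0
  wx_one : ∀ t, wx (1, t) = 0
  wt_final : ∀ x, wt (x, T) = 0
  wx_final : ∀ x, wx (x, T) = 0

theorem WaveSolution.green (S : WaveSolution) {T : ℝ} (hT : 0 ≤ T) (W : WaveTest T) :
    ∫ z, S.φ z * (W.wtt z - W.wxx z) ∂(muQ T) = (∫ z, S.F z * W.w z ∂(muQ T))
      - (∫ x in (0 : ℝ)..1, S.φ (x, 0) * W.wt (x, 0))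
      - ∫ x in (0 : ℝ)..1, S.G (x, 0) * W.wx (x, 0) := by
  obtain ⟨φ, G, H, F, p, q, hφ, hG, hH, hF, hp, hq, φ_dx, φ_dt, G_dx, G_dt, H_dx, φ_zero, G_one,
    H_one⟩ := S
  obtain ⟨w, wt, wx, wtt, wtx, wxx, hw, hwt, hwx, hwtt, hwtx, hwxx, w_dx, wt_dt, wt_dx, wx_dt,
    wx_dx, w_zero, wt_zero, wx_one, wt_final, wx_final⟩ := W
  have hdiv : IsDivergence (fun z => -(φ z * wx z + H z * w z + G z * wt z))
      (fun z => φ z * wt z + G z * wx z) (fun z => φ z * (wtt z - wxx z) - F z * w z) :=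
    ⟨fun z => -((q z * wx z + φ z * wxx z) + (F z * w z + H z * wx z)
        + (p z * wt z + G z * wtx z)),
      fun z => (p z * wt z + φ z * wtt z) + ((q z + H z) * wx z + G z * wtx z),
      by fun_prop, by fun_prop,
      fun x t => ((((φ_dx x t).fun_mul (wx_dx x t)).fun_add
        ((H_dx x t).fun_mul (w_dx x t))).fun_add ((G_dx x t).fun_mul (wt_dx x t))).fun_neg,
      fun x t => ((φ_dt x t).fun_mul (wt_dt x t)).fun_add ((G_dt x t).fun_mul (wx_dt x t)),
      fun z => by ring⟩
  have h := hdiv.integral_eq 0 T 0 1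
  rw [← integral_muQ_eq_interval hT hdiv.continuous, integral_sub
    (integrable_muQ (by fun_prop) T) (integrable_muQ (by fun_prop) T)] at h
  simp only [w_zero, wt_zero, wx_one, wt_final, wx_final, φ_zero, G_one, H_one, mul_zero, zero_mul,
    add_zero, neg_zero, sub_zero, intervalIntegral.integral_zero, zero_add, zero_sub,
    intervalIntegral.integral_neg] at h
  rw [intervalIntegral.integral_add (Continuous.intervalIntegrable (by fun_prop) _ _)
    (Continuous.intervalIntegrable (by fun_prop) _ _)] at h
  linarith

/-! ### The observability inequality for classical solutions -/

theorem hasDerivAt_max_zero_sq (s : ℝ) : HasDerivAt (fun s : ℝ => max s 0 ^ 2) (2 * max s 0) s := by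
  refine hasDerivAt_of_hasDerivAt_of_ne' (f := fun s : ℝ => max s 0 ^ 2)
    (g := fun s : ℝ => 2 * max s 0) (x := 0) (fun y hy => ?_) (by fun_prop) (by fun_prop) s
  rcases hy.lt_or_gt with h_neg | h_pos
  · rw [max_eq_right h_neg.le, mul_zero]
    refine (hasDerivAt_const y (0 : ℝ)).congr_of_eventuallyEq ?_
    filter_upwards [Iio_mem_nhds h_neg] with z hz
    simp [max_eq_right (le_of_lt (mem_Iio.1 hz))]
  · rw [max_eq_left h_pos.le]
    have h_sq : HasDerivAt (fun z : ℝ => z ^ 2) (2 * y) y := by simpa using hasDerivAt_pow 2 y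
    refine h_sq.congr_of_eventuallyEq ?_
    filter_upwards [Ioi_mem_nhds h_pos] with z hz
    simp [max_eq_left (le_of_lt (mem_Ioi.1 hz))]

theorem hasDerivAt_max_zero_sq_comp {f : ℝ → ℝ} {f' x : ℝ} (hf : HasDerivAt f f' x) :
    HasDerivAt (fun s => max (f s) 0 ^ 2) (2 * max (f x) 0 * f') x :=
  (hasDerivAt_max_zero_sq (f x)).comp x hf

/-- Weighting `H` by `m⁻¹` in the energy balances a potential of size `m²` against a growth rate
`4 m`, which is why the observability constant is an exponential of `√‖A‖`. -/
theorem sq_add_sq_sub_sq_le_weighted_energy {m φ G H F b s : ℝ} (hm : 1 ≤ m) (hs : |s| ≤ 1)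
    (hF : |F| ≤ m ^ 2 * |φ| + |b|) :
    φ ^ 2 + G ^ 2 - b ^ 2
      ≤ 4 * m * (φ ^ 2 + G ^ 2 + H ^ 2 / m ^ 2) + 2 * (H * F) / m ^ 2 + 2 * s * (φ * H) := by
  have hm0 : 0 < m := by linarith
  obtain ⟨h, rfl⟩ : ∃ h, H = m * h := ⟨H / m, by field_simp⟩
  obtain ⟨f, rfl⟩ : ∃ f, F = m * f := ⟨F / m, by field_simp⟩
  have hf : |f| ≤ m * |φ| + |b| := by
    rw [abs_mul, abs_of_pos hm0] at hF
    refine le_of_mul_le_mul_left (a := m) ?_ hm0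
    nlinarith [abs_nonneg b]
  have h_source : -(|h| * (m * |φ| + |b|)) ≤ h * f :=
    calc -(|h| * (m * |φ| + |b|)) ≤ -(|h| * |f|) := by gcongr
      _ ≤ h * f := by rw [← abs_mul]; exact neg_abs_le _
  have h_cross : -(m * (|φ| * |h|)) ≤ s * (φ * (m * h)) :=
    calc -(m * (|φ| * |h|)) ≤ -(|s| * (m * (|φ| * |h|))) :=
          neg_le_neg (mul_le_of_le_one_left (by positivity) hs)
      _ = -|s * (φ * (m * h))| := by rw [abs_mul, abs_mul, abs_mul, abs_of_pos hm0]; ring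
      _ ≤ s * (φ * (m * h)) := neg_abs_le _
  have h_scale : (m * h) ^ 2 / m ^ 2 = h ^ 2 := by field_simp
  have h_scale' : 2 * (m * h * (m * f)) / m ^ 2 = 2 * (h * f) := by field_simp
  have h_young : 4 * m * (|φ| * |h|) + 2 * (|h| * |b|) ≤ 2 * m * φ ^ 2 + 3 * m * h ^ 2 + b ^ 2 := by
    rw [← sq_abs φ, ← sq_abs h, ← sq_abs b]
    nlinarith [mul_nonneg hm0.le (sq_nonneg (|φ| - |h|)), sq_nonneg (|h| - |b|),
      mul_nonneg (sub_nonneg.2 hm) (sq_nonneg |h|)]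
  rw [h_scale, h_scale']
  nlinarith [mul_nonneg (sub_nonneg.2 hm) (sq_nonneg φ), mul_nonneg (sub_nonneg.2 hm) (sq_nonneg G),
    mul_nonneg hm0.le (sq_nonneg h), mul_nonneg hm0.le (sq_nonneg G)]

/-- The weight of the sideways energy estimate; it vanishes outside the sideways cone
`1 - x < t < T - 1 + x` of the observation `{1} × (0,T)`. -/
def coneWeight (T m : ℝ) (z : ℝ × ℝ) : ℝ :=
  Real.exp (4 * m * z.1) * (max (z.2 - 1 + z.1) 0 ^ 2 * max (T - 1 + z.1 - z.2) 0 ^ 2)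

/-- The part of `∂ₓ` of the cone weight that comes from the opening of the cone, see
`hasDerivX_coneWeight`. -/
def coneWeightSlope (T m : ℝ) (z : ℝ × ℝ) : ℝ :=
  Real.exp (4 * m * z.1) * (2 * max (z.2 - 1 + z.1) 0 * max (T - 1 + z.1 - z.2) 0 ^ 2
    + max (z.2 - 1 + z.1) 0 ^ 2 * (2 * max (T - 1 + z.1 - z.2) 0))

/-- The time derivative of the cone weight. -/
def coneWeightDt (T m : ℝ) (z : ℝ × ℝ) : ℝ :=
  Real.exp (4 * m * z.1) * (2 * max (z.2 - 1 + z.1) 0 * max (T - 1 + z.1 - z.2) 0 ^ 2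
    - max (z.2 - 1 + z.1) 0 ^ 2 * (2 * max (T - 1 + z.1 - z.2) 0))

theorem continuous_coneWeight (T m : ℝ) : Continuous (coneWeight T m) := by
  unfold coneWeight; fun_prop

theorem continuous_coneWeightSlope (T m : ℝ) : Continuous (coneWeightSlope T m) := by
  unfold coneWeightSlope; fun_prop

theorem continuous_coneWeightDt (T m : ℝ) : Continuous (coneWeightDt T m) := by
  unfold coneWeightDt; fun_prop

theorem hasDerivX_coneWeight (T m : ℝ) :
    HasDerivX (coneWeight T m) fun z => 4 * m * coneWeight T m z + coneWeightSlope T m z := by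
  intro x t
  have d_left : HasDerivAt (fun s => max (t - 1 + s) 0 ^ 2) (2 * max (t - 1 + x) 0 * 1) x :=
    hasDerivAt_max_zero_sq_comp ((hasDerivAt_id' x).const_add (t - 1))
  have d_right : HasDerivAt (fun s => max (T - 1 + s - t) 0 ^ 2)
      (2 * max (T - 1 + x - t) 0 * 1) x :=
    hasDerivAt_max_zero_sq_comp (((hasDerivAt_id' x).const_add (T - 1)).sub_const t)
  convert! (((hasDerivAt_id' x).const_mul (4 * m)).exp).fun_mul (d_left.fun_mul d_right) using 1
  simp only [coneWeight, coneWeightSlope]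
  ring

theorem hasDerivT_coneWeight (T m : ℝ) : HasDerivT (coneWeight T m) (coneWeightDt T m) := by
  intro x t
  have d_left : HasDerivAt (fun s => max (s - 1 + x) 0 ^ 2) (2 * max (t - 1 + x) 0 * 1) t :=
    hasDerivAt_max_zero_sq_comp (((hasDerivAt_id' t).sub_const 1).add_const x)
  have d_right : HasDerivAt (fun s => max (T - 1 + x - s) 0 ^ 2)
      (2 * max (T - 1 + x - t) 0 * (-1)) t :=
    hasDerivAt_max_zero_sq_comp ((hasDerivAt_id' t).const_sub (T - 1 + x))
  convert! (d_left.fun_mul d_right).const_mul (Real.exp (4 * m * x)) using 1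
  simp only [coneWeightDt]
  ring

theorem abs_coneWeightDt_le (T m : ℝ) (z : ℝ × ℝ) :
    |coneWeightDt T m z| ≤ coneWeightSlope T m z := by
  rw [coneWeightDt, coneWeightSlope, abs_mul, abs_of_pos (Real.exp_pos _)]
  refine mul_le_mul_of_nonneg_left (abs_le.2 ⟨?_, ?_⟩) (Real.exp_pos _).le
  · have : 0 ≤ 2 * max (z.2 - 1 + z.1) 0 * max (T - 1 + z.1 - z.2) 0 ^ 2 := by positivity
    linarith
  · have : 0 ≤ max (z.2 - 1 + z.1) 0 ^ 2 * (2 * max (T - 1 + z.1 - z.2) 0) := by positivity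
    linarith

theorem coneWeight_nonneg (T m : ℝ) (z : ℝ × ℝ) : 0 ≤ coneWeight T m z := by
  unfold coneWeight; positivity

theorem coneWeight_le {T m x t : ℝ} (hm : 0 ≤ m) (hx : x ∈ Icc (0 : ℝ) 1) (ht : t ∈ Icc 0 T) :
    coneWeight T m (x, t) ≤ Real.exp (4 * m) * T ^ 4 := by
  have h_left : max (t - 1 + x) 0 ≤ T := max_le (by linarith [hx.2, ht.2]) (ht.1.trans ht.2)
  have h_right : max (T - 1 + x - t) 0 ≤ T := max_le (by linarith [hx.2, ht.1]) (ht.1.trans ht.2)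
  have h_exp : 4 * m * x ≤ 4 * m := mul_le_of_le_one_right (by positivity) hx.2
  calc Real.exp (4 * m * x) * (max (t - 1 + x) 0 ^ 2 * max (T - 1 + x - t) 0 ^ 2)
      ≤ Real.exp (4 * m) * (T ^ 2 * T ^ 2) := by gcongr
    _ = Real.exp (4 * m) * T ^ 4 := by ring

theorem coneWeight_initial (T m : ℝ) {x : ℝ} (hx : x ≤ 1) : coneWeight T m (x, 0) = 0 := by
  have h : max ((0 : ℝ) - 1 + x) 0 = 0 := max_eq_right (by linarith)
  simp only [coneWeight, h]
  ring

theorem coneWeight_final (T m : ℝ) {x : ℝ} (hx : x ≤ 1) : coneWeight T m (x, T) = 0 := by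
  have h : max (T - 1 + x - T) 0 = 0 := max_eq_right (by linarith)
  simp only [coneWeight, h]
  ring

/-- A cut-off function in time, equal to `1` at time `0` and to `0` at time `T`, whose derivative is
controlled by the cone weight, uniformly in `x`. It localizes the energy to the sideways cone. -/
structure IsConeCutoff (T K : ℝ) (ρ ρ' : ℝ → ℝ) : Prop where
  hasDerivAt : ∀ t, HasDerivAt ρ (ρ' t) t
  continuous_deriv : Continuous ρ'
  initial : ρ 0 = 1
  final : ρ T = 0
  mem_Icc : ∀ t ∈ Icc 0 T, ρ t ∈ Icc (0 : ℝ) 1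
  deriv_sq_le : ∀ m, 0 ≤ m → ∀ x, 0 ≤ x → ∀ t, ρ' t ^ 2 ≤ K * coneWeight T m (x, t)

theorem sq_max_mul_max_le_coneWeight {T m x : ℝ} (hm : 0 ≤ m) (hx : 0 ≤ x) (t : ℝ) :
    (max (t - 1) 0 * max (T - 1 - t) 0) ^ 2 ≤ coneWeight T m (x, t) := by
  have h_left : max (t - 1) 0 ≤ max (t - 1 + x) 0 := max_le_max (by linarith) le_rfl
  have h_right : max (T - 1 - t) 0 ≤ max (T - 1 + x - t) 0 := max_le_max (by linarith) le_rfl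
  calc (max (t - 1) 0 * max (T - 1 - t) 0) ^ 2
      ≤ (max (t - 1 + x) 0 * max (T - 1 + x - t) 0) ^ 2 := by gcongr
    _ = max (t - 1 + x) 0 ^ 2 * max (T - 1 + x - t) 0 ^ 2 := mul_pow _ _ 2
    _ ≤ coneWeight T m (x, t) :=
      le_mul_of_one_le_left (by positivity) (Real.one_le_exp (by positivity))

theorem exists_isConeCutoff {T : ℝ} (hT : 2 < T) :
    ∃ (K : ℝ) (ρ ρ' : ℝ → ℝ), 0 ≤ K ∧ IsConeCutoff T K ρ ρ' := by
  set r : ℝ → ℝ := fun s => max (s - 1) 0 * max (T - 1 - s) 0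
  have hr : Continuous r := by fun_prop
  have hr0 (s : ℝ) : 0 ≤ r s := mul_nonneg (le_max_right _ _) (le_max_right _ _)
  set c := ∫ s in (0 : ℝ)..T, r s
  have hc : 0 < c := intervalIntegral.integral_pos (by linarith) hr.continuousOn (fun s _ => hr0 s)
    ⟨T / 2, ⟨by linarith, by linarith⟩,
      mul_pos (lt_max_of_lt_left (by linarith)) (lt_max_of_lt_left (by linarith))⟩
  refine ⟨c⁻¹ ^ 2, fun t => 1 - c⁻¹ * ∫ s in (0 : ℝ)..t, r s, fun t => -(c⁻¹ * r t), by positivity,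
    fun t => ((hr.integral_hasStrictDerivAt 0 t).hasDerivAt.const_mul _).const_sub 1, by fun_prop,
    by simp, by simp [c, hc.ne'], fun t ht => ?_, fun m hm x hx t => ?_⟩
  · have h_nonneg : 0 ≤ ∫ s in (0 : ℝ)..t, r s :=
      intervalIntegral.integral_nonneg ht.1 fun s _ => hr0 s
    have h_le : ∫ s in (0 : ℝ)..t, r s ≤ c := intervalIntegral.integral_mono_interval le_rfl ht.1
      ht.2 (Eventually.of_forall hr0) (hr.intervalIntegrable _ _)
    have h_le_one : c⁻¹ * ∫ s in (0 : ℝ)..t, r s ≤ 1 := by rwa [inv_mul_le_iff₀ hc, mul_one]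
    exact ⟨by linarith, by linarith [mul_nonneg (inv_nonneg.2 hc.le) h_nonneg]⟩
  · rw [neg_sq, mul_pow]
    gcongr
    exact sq_max_mul_max_le_coneWeight hm hx t

namespace WaveSolution

section Sideways

variable (S : WaveSolution) {T m : ℝ} {b : ℝ × ℝ → ℝ}

theorem isDivergence_coneWeight (T m : ℝ) :
    IsDivergence (fun z => coneWeight T m z * (S.φ z ^ 2 + S.G z ^ 2 + S.H z ^ 2 / m ^ 2))
      (fun z => -(2 * (coneWeight T m z * (S.φ z * S.G z))))
      (fun z => coneWeight T m z * (4 * m * (S.φ z ^ 2 + S.G z ^ 2 + S.H z ^ 2 / m ^ 2)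
          + 2 * (S.H z * S.F z) / m ^ 2 + 2 * (-1) * (S.φ z * S.H z))
        + (coneWeightSlope T m z * (S.φ z ^ 2 + S.G z ^ 2 + S.H z ^ 2 / m ^ 2)
          - 2 * coneWeightDt T m z * (S.φ z * S.G z))) := by
  have hH := S.hH; have hF := S.hF
  have hχ := continuous_coneWeight T m
  have hσ := continuous_coneWeightSlope T m
  have h_momentum := S.isFirstOrderSystem.isDivergence_momentum hχ (by fun_prop)
    (continuous_coneWeightDt T m) (hasDerivX_coneWeight T m) (hasDerivT_coneWeight T m)
  have h_source : IsDivergence (fun z => coneWeight T m z * (S.H z ^ 2 / m ^ 2)) (fun _ => 0)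
      fun z => (4 * m * coneWeight T m z + coneWeightSlope T m z) * (S.H z ^ 2 / m ^ 2)
        + coneWeight T m z * (2 * S.H z * S.F z / m ^ 2) := by
    refine ⟨_, fun _ => 0, by fun_prop, continuous_const, fun x t => ?_,
      fun _ t => hasDerivAt_const t 0, fun z => (add_zero _).symm⟩
    convert! (hasDerivX_coneWeight T m x t).fun_mul
      (((S.H_dx x t).fun_pow 2).div_const (m ^ 2)) using 1
    push_cast; ring
  convert h_momentum.add h_source using 1 <;> ext z <;> ring

theorem coneWeight_mul_sub_le_divergence (hm : 1 ≤ m) {z : ℝ × ℝ}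
    (hF : |S.F z| ≤ m ^ 2 * |S.φ z| + |b z|) :
    coneWeight T m z * (S.φ z ^ 2 + S.G z ^ 2 - b z ^ 2)
      ≤ coneWeight T m z * (4 * m * (S.φ z ^ 2 + S.G z ^ 2 + S.H z ^ 2 / m ^ 2)
          + 2 * (S.H z * S.F z) / m ^ 2 + 2 * (-1) * (S.φ z * S.H z))
        + (coneWeightSlope T m z * (S.φ z ^ 2 + S.G z ^ 2 + S.H z ^ 2 / m ^ 2)
          - 2 * coneWeightDt T m z * (S.φ z * S.G z)) := by
  have h_weighted := mul_le_mul_of_nonneg_left (sq_add_sq_sub_sq_le_weighted_energy (G := S.G z)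
    (H := S.H z) (s := -1) hm (by simp) hF) (coneWeight_nonneg T m z)
  have hτ := abs_le.1 (abs_coneWeightDt_le T m z)
  have hσ : 0 ≤ coneWeightSlope T m z * (S.H z ^ 2 / m ^ 2) :=
    mul_nonneg ((abs_nonneg _).trans (abs_coneWeightDt_le T m z)) (by positivity)
  nlinarith [mul_nonneg (sub_nonneg.2 hτ.2) (sq_nonneg (S.φ z + S.G z)),
    mul_nonneg (by linarith : 0 ≤ coneWeightSlope T m z + coneWeightDt T m z)
      (sq_nonneg (S.φ z - S.G z))]

theorem integral_divergence_coneWeight_le (hT : 0 ≤ T) (hm : 0 ≤ m) :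
    ∫ z, (coneWeight T m z * (4 * m * (S.φ z ^ 2 + S.G z ^ 2 + S.H z ^ 2 / m ^ 2)
          + 2 * (S.H z * S.F z) / m ^ 2 + 2 * (-1) * (S.φ z * S.H z))
        + (coneWeightSlope T m z * (S.φ z ^ 2 + S.G z ^ 2 + S.H z ^ 2 / m ^ 2)
          - 2 * coneWeightDt T m z * (S.φ z * S.G z))) ∂(muQ T)
      ≤ Real.exp (4 * m) * T ^ 4 * ∫ t in (0 : ℝ)..T, S.φ (1, t) ^ 2 := by
  have hφ := S.hφ; have hG := S.hG; have hH := S.hH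
  have hχ := continuous_coneWeight T m
  have h_div := S.isDivergence_coneWeight T m
  have h_caps : ∫ x in (0 : ℝ)..1, (-(2 * (coneWeight T m (x, T) * (S.φ (x, T) * S.G (x, T))))
      - -(2 * (coneWeight T m (x, 0) * (S.φ (x, 0) * S.G (x, 0))))) = 0 := by
    refine intervalIntegral.integral_zero_ae (ae_of_all _ fun x hx => ?_)
    rw [uIoc_of_le zero_le_one] at hx
    simp [coneWeight_initial T m hx.2, coneWeight_final T m hx.2]
  rw [integral_muQ_eq_interval hT h_div.continuous, h_div.integral_eq, h_caps, add_zero,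
    ← intervalIntegral.integral_const_mul]
  refine integral_mono_on_of_continuous (by fun_prop) (by fun_prop) hT fun t ht => ?_
  have h_one := mul_le_mul_of_nonneg_right (coneWeight_le hm (x := 1) (by simp) ht)
    (sq_nonneg (S.φ (1, t)))
  have h_zero : 0 ≤ coneWeight T m (0, t)
      * (S.φ (0, t) ^ 2 + S.G (0, t) ^ 2 + S.H (0, t) ^ 2 / m ^ 2) :=
    mul_nonneg (coneWeight_nonneg _ _ _) (by positivity)
  simp only [S.G_one, S.H_one, ne_eq, OfNat.ofNat_ne_zero, not_false_eq_true, zero_pow, zero_div,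
    add_zero]
  linarith

/-- Here `x` is the evolution variable. -/
theorem integral_coneWeight_le (hT : 0 ≤ T) (hm : 1 ≤ m)
    (hb : Integrable (fun z => b z ^ 2) (muQ T))
    (hF : ∀ᵐ z ∂(muQ T), |S.F z| ≤ m ^ 2 * |S.φ z| + |b z|) :
    ∫ z, coneWeight T m z * (S.φ z ^ 2 + S.G z ^ 2) ∂(muQ T)
      ≤ Real.exp (4 * m) * T ^ 4 *
        ((∫ t in (0 : ℝ)..T, S.φ (1, t) ^ 2) + ∫ z, b z ^ 2 ∂(muQ T)) := by
  have hφ := S.hφ; have hG := S.hG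
  have hχ := continuous_coneWeight T m
  have h_cone : Integrable (fun z => coneWeight T m z * (S.φ z ^ 2 + S.G z ^ 2)) (muQ T) :=
    integrable_muQ (by fun_prop) T
  have h_pointwise : ∀ᵐ z ∂(muQ T), coneWeight T m z * (S.φ z ^ 2 + S.G z ^ 2)
      - Real.exp (4 * m) * T ^ 4 * b z ^ 2
        ≤ coneWeight T m z * (4 * m * (S.φ z ^ 2 + S.G z ^ 2 + S.H z ^ 2 / m ^ 2)
            + 2 * (S.H z * S.F z) / m ^ 2 + 2 * (-1) * (S.φ z * S.H z))
          + (coneWeightSlope T m z * (S.φ z ^ 2 + S.G z ^ 2 + S.H z ^ 2 / m ^ 2)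
            - 2 * coneWeightDt T m z * (S.φ z * S.G z)) := by
    filter_upwards [hF, ae_muQ_mem_Icc T] with z hz hzQ
    have h_weight := mul_le_mul_of_nonneg_right
      (coneWeight_le (by linarith : 0 ≤ m) hzQ.1 hzQ.2) (sq_nonneg (b z))
    linarith [S.coneWeight_mul_sub_le_divergence (T := T) hm hz]
  have h_integrated := integral_mono_ae (h_cone.sub (hb.const_mul _))
    (integrable_muQ (S.isDivergence_coneWeight T m).continuous T) h_pointwise
  rw [integral_sub' h_cone (hb.const_mul _), integral_const_mul] at h_integrated
  linarith [S.integral_divergence_coneWeight_le hT (by linarith : 0 ≤ m)]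

end Sideways

section Cutoff

variable (S : WaveSolution) {T K m : ℝ} {b : ℝ × ℝ → ℝ} {ρ ρ' : ℝ → ℝ}

/-- The time primitive of `ρ F` that vanishes at time `T`. -/
def cutoffSource (ρ : ℝ → ℝ) (T : ℝ) (z : ℝ × ℝ) : ℝ := ∫ s in T..z.2, ρ s * S.F (z.1, s)

/-- The corrector by which `ρ G` must be changed so that no `H` is left in the equation of `ρ φ`. -/
def cutoffCorrector (ρ : ℝ → ℝ) (T : ℝ) (z : ℝ × ℝ) : ℝ := -∫ s in T..z.2, ρ s * S.H (z.1, s)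

/-- The companion of `ρ φ` in the first-order form of its wave equation. -/
def cutoffG (ρ : ℝ → ℝ) (T : ℝ) (z : ℝ × ℝ) : ℝ := ρ z.2 * S.G z + S.cutoffCorrector ρ T z

theorem hasDerivT_cutoffSource (hρ : Continuous ρ) (T : ℝ) :
    HasDerivT (S.cutoffSource ρ T) fun z => ρ z.2 * S.F z :=
  hasDerivT_integral ((hρ.comp continuous_snd).mul S.hF) T

theorem continuous_cutoffSource (hρ : Continuous ρ) (T : ℝ) : Continuous (S.cutoffSource ρ T) :=
  intervalIntegral.continuous_parametric_primitive_of_continuous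
    (f := fun x s => ρ s * S.F (x, s)) ((hρ.comp continuous_snd).mul S.hF)

theorem continuous_cutoffG (hρ : Continuous ρ) (T : ℝ) : Continuous (S.cutoffG ρ T) :=
  ((hρ.comp continuous_snd).mul S.hG).add
    (intervalIntegral.continuous_parametric_primitive_of_continuous
      (f := fun x s => ρ s * S.H (x, s)) ((hρ.comp continuous_snd).mul S.hH)).neg

theorem hasDerivX_cutoffCorrector (hρ : Continuous ρ) (T : ℝ) :
    HasDerivX (S.cutoffCorrector ρ T) fun z => -S.cutoffSource ρ T z := fun x t =>
  (HasDerivX.integral_slice (f := fun z => ρ z.2 * S.H z) (fun y s => (S.H_dx y s).const_mul (ρ s))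
    ((hρ.comp continuous_snd).mul S.hH) ((hρ.comp continuous_snd).mul S.hF) T t x).fun_neg

theorem cutoffCorrector_one (ρ : ℝ → ℝ) (T t : ℝ) : S.cutoffCorrector ρ T (1, t) = 0 := by
  simp [cutoffCorrector, S.H_one]

theorem isFirstOrderSystem_cutoff (hρ : ∀ t, HasDerivAt ρ (ρ' t) t) (hρ' : Continuous ρ') (T : ℝ) :
    IsFirstOrderSystem (fun z => ρ z.2 * S.φ z) (S.cutoffG ρ T)
      (fun z => ρ' z.2 * S.φ z + S.cutoffSource ρ T z) (fun z => ρ' z.2 * S.G z)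
      (fun z => ρ z.2 * S.q z) (fun z => ρ z.2 * S.p z + -S.cutoffSource ρ T z) := by
  have hρ_cont : Continuous ρ := continuous_iff_continuousAt.2 fun t => (hρ t).continuousAt
  have hφ := S.hφ; have hG := S.hG; have hp := S.hp; have hq := S.hq; have hH := S.hH
  have hJ := S.continuous_cutoffSource hρ_cont T
  refine ⟨by fun_prop, S.continuous_cutoffG hρ_cont T, by fun_prop, by fun_prop, by fun_prop,
    by fun_prop, fun x t => (S.φ_dx x t).const_mul (ρ t),
    fun x t => ((S.G_dx x t).const_mul (ρ t)).fun_add (S.hasDerivX_cutoffCorrector hρ_cont T x t),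
    fun x t => ?_, fun x t => ?_⟩
  · convert! (hρ t).fun_mul (S.φ_dt x t) using 1
    ring
  · convert! ((hρ t).fun_mul (S.G_dt x t)).fun_add
      (hasDerivT_integral (f := fun z => ρ z.2 * S.H z) (by fun_prop) T x t).fun_neg using 1
    ring

theorem isDivergence_cutoff (hρ : ∀ t, HasDerivAt ρ (ρ' t) t) (hρ' : Continuous ρ') (T m : ℝ) :
    IsDivergence (fun z => -(2 * Real.exp (4 * m * z.2) * (ρ z.2 * S.φ z * S.cutoffG ρ T z)))
      (fun z => Real.exp (4 * m * z.2) *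
        ((ρ z.2 * S.φ z) ^ 2 + S.cutoffG ρ T z ^ 2 + S.cutoffSource ρ T z ^ 2 / m ^ 2))
      (fun z => Real.exp (4 * m * z.2) *
        (4 * m * ((ρ z.2 * S.φ z) ^ 2 + S.cutoffG ρ T z ^ 2 + S.cutoffSource ρ T z ^ 2 / m ^ 2)
          + 2 * (S.cutoffSource ρ T z * (ρ z.2 * S.F z)) / m ^ 2
          + 2 * 1 * (ρ z.2 * S.φ z * S.cutoffSource ρ T z)
          + 2 * (ρ z.2 * S.φ z * (ρ' z.2 * S.φ z) + S.cutoffG ρ T z * (ρ' z.2 * S.G z)))) := by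
  have hρ_cont : Continuous ρ := continuous_iff_continuousAt.2 fun t => (hρ t).continuousAt
  have hF := S.hF; have hJ := S.continuous_cutoffSource hρ_cont T
  have h_exp (t : ℝ) : HasDerivAt (fun t => Real.exp (4 * m * t)) (Real.exp (4 * m * t) * (4 * m))
      t := by simpa using ((hasDerivAt_id' t).const_mul (4 * m)).exp
  have h_energy := (S.isFirstOrderSystem_cutoff hρ hρ' T).isDivergence_energy h_exp (by fun_prop)
  have h_source : IsDivergence (fun _ => 0)
      (fun z => Real.exp (4 * m * z.2) * (S.cutoffSource ρ T z ^ 2 / m ^ 2))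
      fun z => Real.exp (4 * m * z.2) * (4 * m) * (S.cutoffSource ρ T z ^ 2 / m ^ 2)
        + Real.exp (4 * m * z.2) * (2 * S.cutoffSource ρ T z * (ρ z.2 * S.F z) / m ^ 2) := by
    refine ⟨fun _ => 0, _, continuous_const, by fun_prop, fun x _ => hasDerivAt_const x 0,
      fun x t => ?_, fun z => (zero_add _).symm⟩
    convert! (h_exp t).fun_mul
      (((S.hasDerivT_cutoffSource hρ_cont T x t).fun_pow 2).div_const (m ^ 2)) using 1
    push_cast; ring
  convert h_energy.add h_source using 1 <;> ext z <;> ring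

theorem neg_le_divergence_cutoff (h : IsConeCutoff T K ρ ρ') (hm : 1 ≤ m) {z : ℝ × ℝ}
    (hz : z ∈ Icc (0 : ℝ) 1 ×ˢ Icc 0 T) (hF : |S.F z| ≤ m ^ 2 * |S.φ z| + |b z|) :
    -(Real.exp (4 * m * T) * (K * (coneWeight T m z * (S.φ z ^ 2 + S.G z ^ 2)) + b z ^ 2))
      ≤ Real.exp (4 * m * z.2) *
        (4 * m * ((ρ z.2 * S.φ z) ^ 2 + S.cutoffG ρ T z ^ 2 + S.cutoffSource ρ T z ^ 2 / m ^ 2)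
          + 2 * (S.cutoffSource ρ T z * (ρ z.2 * S.F z)) / m ^ 2
          + 2 * 1 * (ρ z.2 * S.φ z * S.cutoffSource ρ T z)
          + 2 * (ρ z.2 * S.φ z * (ρ' z.2 * S.φ z) + S.cutoffG ρ T z * (ρ' z.2 * S.G z))) := by
  have hρz := h.mem_Icc z.2 hz.2
  have hF' : |ρ z.2 * S.F z| ≤ m ^ 2 * |ρ z.2 * S.φ z| + |b z| := by
    rw [abs_mul, abs_mul, abs_of_nonneg hρz.1]
    nlinarith [abs_nonneg (b z), mul_le_mul_of_nonneg_left hF hρz.1, hρz.2]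
  have h_weighted := sq_add_sq_sub_sq_le_weighted_energy (G := S.cutoffG ρ T z)
    (H := S.cutoffSource ρ T z) (s := 1) hm (by simp) hF'
  have hK := h.deriv_sq_le m (by linarith) z.1 hz.1.1 z.2
  have h_cutoff : ρ' z.2 ^ 2 * (S.φ z ^ 2 + S.G z ^ 2)
      ≤ K * (coneWeight T m z * (S.φ z ^ 2 + S.G z ^ 2)) := by
    rw [← mul_assoc]
    exact mul_le_mul_of_nonneg_right hK (by positivity)
  have h_nonneg : 0 ≤ K * (coneWeight T m z * (S.φ z ^ 2 + S.G z ^ 2)) + b z ^ 2 :=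
    add_nonneg ((by positivity : (0 : ℝ) ≤ _).trans h_cutoff) (sq_nonneg _)
  have h_exp : Real.exp (4 * m * z.2) ≤ Real.exp (4 * m * T) :=
    Real.exp_le_exp.2 (mul_le_mul_of_nonneg_left hz.2.2 (by linarith))
  refine (neg_le_neg (mul_le_mul_of_nonneg_right h_exp h_nonneg)).trans ?_
  rw [← mul_neg]
  refine mul_le_mul_of_nonneg_left ?_ (Real.exp_pos _).le
  linarith [sq_nonneg (ρ z.2 * S.φ z + ρ' z.2 * S.φ z),
    sq_nonneg (S.cutoffG ρ T z + ρ' z.2 * S.G z)]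

theorem integral_cutoff_initial_le (h : IsConeCutoff T K ρ ρ') (hT : 0 ≤ T) (hm : 1 ≤ m)
    (hb : Integrable (fun z => b z ^ 2) (muQ T))
    (hF : ∀ᵐ z ∂(muQ T), |S.F z| ≤ m ^ 2 * |S.φ z| + |b z|) :
    ∫ x in (0 : ℝ)..1,
        (S.φ (x, 0) ^ 2 + S.cutoffG ρ T (x, 0) ^ 2 + S.cutoffSource ρ T (x, 0) ^ 2 / m ^ 2)
      ≤ Real.exp (4 * m * T) *
        (K * (∫ z, coneWeight T m z * (S.φ z ^ 2 + S.G z ^ 2) ∂(muQ T))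
          + ∫ z, b z ^ 2 ∂(muQ T)) := by
  have hφ := S.hφ; have hG := S.hG
  have hχ := continuous_coneWeight T m
  have h_cone : Integrable (fun z => coneWeight T m z * (S.φ z ^ 2 + S.G z ^ 2)) (muQ T) :=
    integrable_muQ (by fun_prop) T
  have h_div := S.isDivergence_cutoff h.hasDerivAt h.continuous_deriv T m
  have h_pointwise := hF.mp ((ae_muQ_mem_Icc T).mono fun z hzQ hz =>
    S.neg_le_divergence_cutoff h hm hzQ hz)
  have h_integrated := integral_mono_ae
    (((h_cone.const_mul K).add hb).const_mul (Real.exp (4 * m * T))).neg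
    (integrable_muQ h_div.continuous T) h_pointwise
  have h_source_final (x : ℝ) : S.cutoffSource ρ T (x, T) = 0 := by simp [cutoffSource]
  have h_G_final (x : ℝ) : S.cutoffG ρ T (x, T) = 0 := by
    simp [cutoffG, cutoffCorrector, h.final]
  have h_G_one (t : ℝ) : S.cutoffG ρ T (1, t) = 0 := by
    simp [cutoffG, S.cutoffCorrector_one, S.G_one]
  rw [integral_neg', integral_const_mul, integral_add' (h_cone.const_mul K) hb, integral_const_mul,
    integral_muQ_eq_interval hT h_div.continuous, h_div.integral_eq] at h_integrated
  simp only [h.final, h_source_final, h_G_final, h_G_one, S.φ_zero, h.initial, zero_mul, mul_zero,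
    neg_zero, sub_zero, intervalIntegral.integral_zero, zero_add, one_mul, Real.exp_zero, zero_sub,
    ne_eq, OfNat.ofNat_ne_zero, not_false_eq_true, zero_pow, zero_div, add_zero,
    intervalIntegral.integral_neg] at h_integrated
  linarith

theorem energy_zero_le_integral_cutoff (hρ : Continuous ρ) (hρ0 : ρ 0 = 1) (T : ℝ) (hm : 1 ≤ m) :
    S.energy 0 ≤ 3 * m ^ 2 * ∫ x in (0 : ℝ)..1,
      (S.φ (x, 0) ^ 2 + S.cutoffG ρ T (x, 0) ^ 2 + S.cutoffSource ρ T (x, 0) ^ 2 / m ^ 2) := by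
  have hφ := S.hφ; have hG := S.hG
  have hg := S.continuous_cutoffG hρ T; have hJ := S.continuous_cutoffSource hρ T
  set W := ∫ x in (0 : ℝ)..1, S.cutoffSource ρ T (x, 0) ^ 2
  have h_corrector {x : ℝ} (hx : x ∈ Icc (0 : ℝ) 1) : S.cutoffCorrector ρ T (x, 0) ^ 2 ≤ W := by
    simpa only [neg_sq] using (S.hasDerivX_cutoffCorrector hρ T).sq_le_of_eq_zero_at_one hJ.neg
      (S.cutoffCorrector_one ρ T 0) hx
  have h_density {x : ℝ} (hx : x ∈ Icc (0 : ℝ) 1) :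
      S.φ (x, 0) ^ 2 + S.G (x, 0) ^ 2 ≤ S.φ (x, 0) ^ 2 + 2 * S.cutoffG ρ T (x, 0) ^ 2 + 2 * W := by
    have hG_eq : S.G (x, 0) = S.cutoffG ρ T (x, 0) - S.cutoffCorrector ρ T (x, 0) := by
      simp [cutoffG, hρ0]
    rw [hG_eq]
    linarith [h_corrector hx,
      sq_nonneg (S.cutoffG ρ T (x, 0) + S.cutoffCorrector ρ T (x, 0))]
  have hm2 : 1 ≤ m ^ 2 := one_le_pow₀ hm
  calc S.energy 0 ≤ ∫ x in (0 : ℝ)..1,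
          (S.φ (x, 0) ^ 2 + 2 * S.cutoffG ρ T (x, 0) ^ 2 + 2 * W) :=
        integral_mono_on_of_continuous (by fun_prop) (by fun_prop) zero_le_one
          fun x hx => h_density hx
    _ = ∫ x in (0 : ℝ)..1, (S.φ (x, 0) ^ 2 + 2 * S.cutoffG ρ T (x, 0) ^ 2
          + 2 * S.cutoffSource ρ T (x, 0) ^ 2) := by
        rw [intervalIntegral.integral_add, intervalIntegral.integral_add
          (f := fun x => S.φ (x, 0) ^ 2 + 2 * S.cutoffG ρ T (x, 0) ^ 2),
          intervalIntegral.integral_const_mul]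
        · simp [W]
        all_goals exact Continuous.intervalIntegrable (by fun_prop) _ _
    _ ≤ ∫ x in (0 : ℝ)..1, 3 * m ^ 2 * (S.φ (x, 0) ^ 2 + S.cutoffG ρ T (x, 0) ^ 2
          + S.cutoffSource ρ T (x, 0) ^ 2 / m ^ 2) := by
        refine integral_mono_on_of_continuous (by fun_prop) (by fun_prop) zero_le_one fun x _ => ?_
        have h_cancel : m ^ 2 * (S.cutoffSource ρ T (x, 0) ^ 2 / m ^ 2)
            = S.cutoffSource ρ T (x, 0) ^ 2 := by field_simp
        nlinarith [mul_nonneg (sub_nonneg.2 hm2) (sq_nonneg (S.φ (x, 0))),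
          mul_nonneg (sub_nonneg.2 hm2) (sq_nonneg (S.cutoffG ρ T (x, 0)))]
    _ = _ := intervalIntegral.integral_const_mul _ _

end Cutoff

theorem exp_weights_le {T K a m U : ℝ} (hK : 0 ≤ K) (ha : m = 1 + Real.sqrt a) (hU : 0 ≤ U) :
    3 * m ^ 2 * (Real.exp (4 * m * T) * (K * (Real.exp (4 * m) * T ^ 4 * U) + U))
      ≤ 3 * (K * T ^ 4 + 1) * Real.exp (4 * T + 6) * Real.exp ((4 * T + 6) * Real.sqrt a) * U := by
  have hm : 0 ≤ m := by linarith [Real.sqrt_nonneg a]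
  have h_sq : m ^ 2 ≤ Real.exp (2 * m) := by
    rw [two_mul, Real.exp_add, ← sq]
    gcongr
    linarith [Real.add_one_le_exp m]
  have h_sum :
      K * (Real.exp (4 * m) * T ^ 4 * U) + U ≤ (K * T ^ 4 + 1) * (Real.exp (4 * m) * U) := by
    nlinarith [mul_le_mul_of_nonneg_right (Real.one_le_exp (by positivity : 0 ≤ 4 * m)) hU]
  calc 3 * m ^ 2 * (Real.exp (4 * m * T) * (K * (Real.exp (4 * m) * T ^ 4 * U) + U))
      ≤ 3 * Real.exp (2 * m) * (Real.exp (4 * m * T) *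
          ((K * T ^ 4 + 1) * (Real.exp (4 * m) * U))) := by gcongr
    _ = 3 * (K * T ^ 4 + 1) * (Real.exp (2 * m) * Real.exp (4 * m * T) * Real.exp (4 * m)) * U := by
        ring
    _ = _ := by
        rw [mul_assoc (3 * (K * T ^ 4 + 1)) (Real.exp (4 * T + 6)), ← Real.exp_add, ← Real.exp_add,
          ← Real.exp_add, ha]
        ring_nf

theorem observability {T : ℝ} (hT : 2 < T) : ∃ C : ℝ, 0 < C ∧ ∀ (S : WaveSolution) (a : ℝ),
    0 ≤ a → ∀ b : ℝ × ℝ → ℝ, Integrable (fun z => b z ^ 2) (muQ T) →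
      (∀ᵐ z ∂(muQ T), |S.F z| ≤ a * |S.φ z| + |b z|) →
      S.energy 0 ≤ C * Real.exp (C * Real.sqrt a) *
        ((∫ t in (0 : ℝ)..T, S.φ (1, t) ^ 2) + ∫ z, b z ^ 2 ∂(muQ T)) := by
  have hT0 : 0 ≤ T := by linarith
  obtain ⟨K, ρ, ρ', hK, hρ⟩ := exists_isConeCutoff hT
  set c := 4 * T + 6
  set k := 3 * (K * T ^ 4 + 1) * Real.exp c
  have hc : 0 < c := by positivity
  have hk : 0 < k := by positivity
  refine ⟨k + c, add_pos hk hc, fun S a ha b hb hF => ?_⟩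
  set m := 1 + Real.sqrt a with hm_def
  have hm : 1 ≤ m := le_add_of_nonneg_right (Real.sqrt_nonneg a)
  have ham : a ≤ m ^ 2 := by nlinarith [Real.sq_sqrt ha, Real.sqrt_nonneg a]
  have hF' : ∀ᵐ z ∂(muQ T), |S.F z| ≤ m ^ 2 * |S.φ z| + |b z| :=
    hF.mono fun z hz => hz.trans (by gcongr)
  set U := ∫ t in (0 : ℝ)..T, S.φ (1, t) ^ 2
  set V := ∫ z, b z ^ 2 ∂(muQ T)
  have hU : 0 ≤ U := intervalIntegral.integral_nonneg hT0 fun _ _ => sq_nonneg _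
  have hV : 0 ≤ V := integral_nonneg fun _ => sq_nonneg _
  have hρ_cont : Continuous ρ :=
    continuous_iff_continuousAt.2 fun t => (hρ.hasDerivAt t).continuousAt
  calc S.energy 0
      ≤ 3 * m ^ 2 * (Real.exp (4 * m * T) *
          (K * (∫ z, coneWeight T m z * (S.φ z ^ 2 + S.G z ^ 2) ∂(muQ T)) + V)) :=
        (S.energy_zero_le_integral_cutoff hρ_cont hρ.initial T hm).trans
          (by gcongr; exact S.integral_cutoff_initial_le hρ hT0 hm hb hF')
    _ ≤ 3 * m ^ 2 * (Real.exp (4 * m * T) *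
          (K * (Real.exp (4 * m) * T ^ 4 * (U + V)) + (U + V))) := by
        gcongr
        · exact S.integral_coneWeight_le hT0 hm hb hF'
        · linarith
    _ ≤ k * Real.exp (c * Real.sqrt a) * (U + V) :=
        exp_weights_le hK hm_def (add_nonneg hU hV)
    _ ≤ (k + c) * Real.exp ((k + c) * Real.sqrt a) * (U + V) := by
        gcongr <;> linarith

end WaveSolution

/-! ### The spaces `H¹₍₀₎(Ω)` and `H⁻¹₍₀₎(Ω)` -/

theorem L2Om.intervalIntegrable_unit (f : L2Om) : IntervalIntegrable (f : ℝ → ℝ) volume 0 1 := by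
  rw [intervalIntegrable_iff_integrableOn_Ioo_of_le zero_le_one]
  exact f.integrable

namespace H10

theorem dx_surjective : Function.Surjective dx := by
  intro f
  have hi : Integrable ((Ioo (0 : ℝ) 1).indicator (f : ℝ → ℝ)) volume :=
    (integrable_indicator_iff measurableSet_Ioo).2 f.integrable
  have hc : Continuous fun x => ∫ s in (0 : ℝ)..x, (Ioo (0 : ℝ) 1).indicator (f : ℝ → ℝ) s :=
    intervalIntegral.continuous_primitive (fun _ _ => hi.intervalIntegrable) 0
  have hmem : (L2Om.ofContinuous _ hc, f) ∈ H10Sub := by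
    change (L2Om.ofContinuous _ hc : ℝ → ℝ) =ᵐ[muOm] fun x => ∫ s in (0 : ℝ)..x, f s
    filter_upwards [L2Om.coeFn_ofContinuous hc, ae_restrict_mem measurableSet_Ioo] with x hx hx1
    rw [hx]
    refine L2Om.primitive_congr ?_ hx1
    filter_upwards [ae_restrict_mem measurableSet_Ioo] with y hy
    rw [indicator_of_mem hy]
  exact ⟨⟨_, hmem⟩, rfl⟩

/-- The derivative as a continuous linear map `H¹₍₀₎(Ω) → L²(Ω)`. -/
def dxL : H10 →L[ℝ] L2Om := dx.mkContinuous 1 fun z => by rw [one_mul]; exact (norm_def z).ge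

theorem toL2_ae (z : H10) : (toL2 z : ℝ → ℝ) =ᵐ[muOm] fun x => ∫ s in (0 : ℝ)..x, dx z s :=
  fn_ae z

theorem integral_deriv_mul {G p : ℝ → ℝ} (hp : Continuous p) (hG : ∀ x, HasDerivAt G (p x) x)
    (hG1 : G 1 = 0) (z : H10) :
    ∫ x, p x * toL2 z x ∂muOm = -∫ x, G x * dx z x ∂muOm := by
  have hf := (dx z).intervalIntegrable_unit
  have hdG : deriv G = p := funext fun x => (hG x).deriv
  have hGac : AbsolutelyContinuousOnInterval G 0 1 := by
    refine ContDiffOn.absolutelyContinuousOnInterval (ContDiff.contDiffOn ?_)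
    exact contDiff_one_iff_deriv.2 ⟨fun x => (hG x).differentiableAt, by rwa [hdG]⟩
  have hPac : AbsolutelyContinuousOnInterval (fun x => ∫ s in (0 : ℝ)..x, dx z s) 0 1 :=
    hf.absolutelyContinuousOnInterval_intervalIntegral (by simp)
  have hibp := hGac.integral_mul_deriv_eq_deriv_mul hPac
  rw [hG1, hdG, intervalIntegral.integral_same] at hibp
  have h1 : ∫ x, p x * toL2 z x ∂muOm = ∫ x in (0 : ℝ)..1, p x * ∫ s in (0 : ℝ)..x, dx z s := by
    rw [← integral_muOm]
    exact integral_congr_ae ((toL2_ae z).mono fun x hx => by simp only [hx])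
  have h2 : ∫ x, G x * dx z x ∂muOm
      = ∫ x in (0 : ℝ)..1, G x * deriv (fun x => ∫ s in (0 : ℝ)..x, dx z s) x := by
    rw [integral_muOm]
    refine intervalIntegral.integral_congr_ae ?_
    filter_upwards [hf.ae_hasDerivAt_integral] with x hx hx1
    rw [(hx (uIoc_subset_uIcc hx1) 0 (by simp)).deriv]
  rw [h1, h2, hibp]
  simp

end H10

/-- The map `L²(Ω) → H⁻¹₍₀₎(Ω)`, `f ↦ (z ↦ ⟨f, K z⟩)`. -/
def pairing (K : H10 →L[ℝ] L2Om) : L2Om →L[ℝ] Hm1 :=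
  LinearMap.mkContinuous
    { toFun := fun f => (innerSL ℝ f).comp K
      map_add' := fun f g => by ext z; simp
      map_smul' := fun c f => by ext z; simp } ‖K‖ fun f => by
    refine (ContinuousLinearMap.opNorm_comp_le _ _).trans ?_
    rw [innerSL_apply_norm, mul_comm]

theorem pairing_apply (K : H10 →L[ℝ] L2Om) (f : L2Om) (z : H10) :
    pairing K f z = inner ℝ f (K z) := rfl

theorem L2toHm1_eq (f : L2Om) : L2toHm1 f = pairing H10.toL2 f := rfl

/-- The functional `z ↦ -∫_Ω G ∂ₓz`, that is the derivative of `G ∈ L²(Ω)`. -/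
def dxDual : L2Om →L[ℝ] Hm1 := -pairing H10.dxL

theorem dxDual_apply (G : L2Om) (z : H10) : dxDual G z = -∫ x, G x * H10.dx z x ∂muOm := by
  rw [← Lp_two_inner]; rfl

theorem norm_dxDual_le (G : L2Om) : ‖dxDual G‖ ≤ ‖G‖ := by
  refine ContinuousLinearMap.opNorm_le_bound _ (norm_nonneg _) fun z => ?_
  change ‖-(inner ℝ G (H10.dx z))‖ ≤ _
  rw [norm_neg]
  exact norm_inner_le_norm _ _

theorem dxDual_surjective : Function.Surjective dxDual := by
  intro ψ
  let e := LinearEquiv.ofBijective H10.dx ⟨H10.dx_injective, H10.dx_surjective⟩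
  let ℓ : L2Om →L[ℝ] ℝ := LinearMap.mkContinuous (ψ.toLinearMap.comp e.symm.toLinearMap) ‖ψ‖
    fun f => by
      refine (ψ.le_opNorm _).trans (le_of_eq ?_)
      rw [H10.norm_def]
      congr 2
      exact e.apply_symm_apply f
  refine ⟨-(InnerProductSpace.toDual ℝ L2Om).symm ℓ, ?_⟩
  ext z
  change -(inner ℝ (-(InnerProductSpace.toDual ℝ L2Om).symm ℓ) (H10.dx z)) = ψ z
  rw [inner_neg_left, neg_neg, InnerProductSpace.toDual_symm_apply]
  change ψ (e.symm (H10.dx z)) = ψ z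
  exact congrArg ψ (e.symm_apply_apply z)

theorem L2toHm1_ofContinuous_eq_dxDual {G p : ℝ → ℝ} (hp : Continuous p)
    (hG : ∀ x, HasDerivAt G (p x) x) (hGc : Continuous G) (hG1 : G 1 = 0) :
    L2toHm1 (L2Om.ofContinuous p hp) = dxDual (L2Om.ofContinuous G hGc) := by
  ext z
  rw [dxDual_apply]
  change inner ℝ (L2Om.ofContinuous p hp) (H10.toL2 z) = _
  rw [Lp_two_inner]
  have h1 : ∫ x, L2Om.ofContinuous p hp x * H10.toL2 z x ∂muOm = ∫ x, p x * H10.toL2 z x ∂muOm :=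
    integral_congr_ae ((L2Om.coeFn_ofContinuous hp).mono fun x hx => by simp only [hx])
  have h2 : ∫ x, L2Om.ofContinuous G hGc x * H10.dx z x ∂muOm = ∫ x, G x * H10.dx z x ∂muOm :=
    integral_congr_ae ((L2Om.coeFn_ofContinuous hGc).mono fun x hx => by simp only [hx])
  rw [h1, h2]
  exact H10.integral_deriv_mul hp hG hG1 z

/-! ### Separated solutions -/

/-- The frequencies `(n + 1/2) π`. -/
def freq (n : ℕ) : ℝ := (n + 1 / 2) * Real.pi

theorem freq_pos (n : ℕ) : 0 < freq n := by unfold freq; positivity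

theorem cos_freq (n : ℕ) : Real.cos (freq n) = 0 := by
  rw [Real.cos_eq_zero_iff]
  exact ⟨n, by unfold freq; push_cast; ring⟩

theorem exists_oscillator {l : ℝ} (hl : l ≠ 0) {h : ℝ → ℝ} (hh : Continuous h) (t₀ α β : ℝ) :
    ∃ b b' : ℝ → ℝ, (∀ t, HasDerivAt b (b' t) t) ∧ (∀ t, HasDerivAt b' (h t - l ^ 2 * b t) t) ∧
      b t₀ = α ∧ b' t₀ = β := by
  set P : ℝ → ℝ := fun t => ∫ s in t₀..t, Real.cos (l * s) * h s with hP
  set R : ℝ → ℝ := fun t => ∫ s in t₀..t, Real.sin (l * s) * h s with hR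
  have dP : ∀ t, HasDerivAt P (Real.cos (l * t) * h t) t := fun t =>
    (Continuous.integral_hasStrictDerivAt (by fun_prop) t₀ t).hasDerivAt
  have dR : ∀ t, HasDerivAt R (Real.sin (l * t) * h t) t := fun t =>
    (Continuous.integral_hasStrictDerivAt (by fun_prop) t₀ t).hasDerivAt
  have d1 : ∀ t, HasDerivAt (fun t => l * t) l t := fun t => by
    simpa using (hasDerivAt_id' t).const_mul l
  have d2 : ∀ t, HasDerivAt (fun t => l * (t - t₀)) l t := fun t => by
    simpa using ((hasDerivAt_id' t).sub_const t₀).const_mul l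
  refine ⟨fun t => α * Real.cos (l * (t - t₀)) + β / l * Real.sin (l * (t - t₀))
      + (Real.sin (l * t) * P t - Real.cos (l * t) * R t) / l,
    fun t => -(α * l) * Real.sin (l * (t - t₀)) + β * Real.cos (l * (t - t₀))
      + (Real.cos (l * t) * P t + Real.sin (l * t) * R t), fun t => ?_, fun t => ?_, ?_, ?_⟩
  · convert! (((d2 t).cos.const_mul α).fun_add ((d2 t).sin.const_mul (β / l))).fun_add
      ((((d1 t).sin.fun_mul (dP t)).fun_sub ((d1 t).cos.fun_mul (dR t))).div_const l) using 1
    field_simp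
    ring
  · convert! (((d2 t).sin.const_mul (-(α * l))).fun_add ((d2 t).cos.const_mul β)).fun_add
      (((d1 t).cos.fun_mul (dP t)).fun_add ((d1 t).sin.fun_mul (dR t))) using 1
    have := Real.sin_sq_add_cos_sq (l * t)
    field_simp
    linear_combination (-h t) * this
  · simp [hP, hR]
  · simp [hP, hR]

/-- The classical solution `sin((n + 1/2) π x) b(t)`. -/
def WaveSolution.mode (n : ℕ) (b b' h : ℝ → ℝ) (hh : Continuous h)
    (hb : ∀ t, HasDerivAt b (b' t) t)
    (hb' : ∀ t, HasDerivAt b' (h t - freq n ^ 2 * b t) t) : WaveSolution :=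
  have cb : Continuous b := continuous_iff_continuousAt.2 fun t => (hb t).continuousAt
  have cb' : Continuous b' := continuous_iff_continuousAt.2 fun t => (hb' t).continuousAt
  have d1 : ∀ x, HasDerivAt (fun x => freq n * x) (freq n) x := fun x => by
    simpa using (hasDerivAt_id' x).const_mul (freq n)
  have hn : freq n ≠ 0 := (freq_pos n).ne'
  { φ := fun z => Real.sin (freq n * z.1) * b z.2
    G := fun z => -(Real.cos (freq n * z.1) / freq n) * b' z.2
    H := fun z => -(Real.cos (freq n * z.1) / freq n) * h z.2
    F := fun z => Real.sin (freq n * z.1) * h z.2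
    p := fun z => Real.sin (freq n * z.1) * b' z.2
    q := fun z => Real.cos (freq n * z.1) * freq n * b z.2
    hφ := by fun_prop
    hG := by fun_prop
    hH := by fun_prop
    hF := by fun_prop
    hp := by fun_prop
    hq := by fun_prop
    φ_dx := fun x t => (d1 x).sin.mul_const (b t)
    φ_dt := fun x t => (hb t).const_mul (Real.sin (freq n * x))
    G_dx := fun x t => by
      convert! (((d1 x).cos.div_const (freq n)).fun_neg).mul_const (b' t) using 1
      field_simp
    G_dt := fun x t => by
      convert! (hb' t).const_mul (-(Real.cos (freq n * x) / freq n)) using 1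
      field_simp
      ring
    H_dx := fun x t => by
      convert! (((d1 x).cos.div_const (freq n)).fun_neg).mul_const (h t) using 1
      field_simp
    φ_zero := fun t => by simp
    G_one := fun t => by simp [cos_freq]
    H_one := fun t => by simp [cos_freq] }

/-! ### Totality of the trigonometric systems -/

theorem integrable_mul_of_continuous {f g : ℝ → ℝ} (hf : Integrable f muOm) (hg : Continuous g) :
    Integrable (fun x => f x * g x) muOm :=
  hf.mul_of_top_left (memLp_muOm hg ∞)

theorem ae_eq_zero_of_integral_mul_continuous {f : ℝ → ℝ} {a b : ℝ}
    (hf : Integrable f (volume.restrict (Ioo a b)))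
    (h : ∀ g : ℝ → ℝ, Continuous g → ∫ x in Ioo a b, f x * g x = 0) :
    ∀ᵐ x ∂volume.restrict (Ioo a b), f x = 0 := by
  have h_ae := isOpen_Ioo.ae_eq_zero_of_integral_contDiff_smul_eq_zero (U := Ioo a b)
    (μ := volume) (IntegrableOn.locallyIntegrableOn hf) fun g hg _ hsupp => by
      rw [← setIntegral_eq_integral_of_forall_compl_eq_zero fun x hx => by
        rw [image_eq_zero_of_notMem_tsupport fun hx' => hx (hsupp hx'), zero_smul]]
      simpa only [smul_eq_mul, mul_comm] using h g hg.continuous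
  exact (ae_restrict_iff' measurableSet_Ioo).2 h_ae

/-- On `[0,1]` the function `sin²(πx/2)` is a homeomorphism onto `[0,1]`, so that Weierstrass'
theorem applies in this variable. -/
theorem exists_polynomial_sin_sq_near {g : ℝ → ℝ} (hg : Continuous g) {ε : ℝ} (hε : 0 < ε) :
    ∃ P : Polynomial ℝ, ∀ x ∈ Icc (0 : ℝ) 1,
      |P.eval (Real.sin (Real.pi / 2 * x) ^ 2) - g x| < ε := by
  obtain ⟨P, hP⟩ := exists_polynomial_near_of_continuousOn 0 1
    (fun s => g (2 / Real.pi * Real.arcsin (Real.sqrt s)))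
    (hg.comp (continuous_const.mul
      (Real.continuous_arcsin.comp Real.continuous_sqrt))).continuousOn ε hε
  refine ⟨P, fun x hx => ?_⟩
  have hpi := Real.pi_pos
  have h_le : Real.pi / 2 * x ≤ Real.pi / 2 := by nlinarith [hx.2]
  have h_nonneg : 0 ≤ Real.pi / 2 * x := mul_nonneg (by positivity) hx.1
  have h_sin : 0 ≤ Real.sin (Real.pi / 2 * x) :=
    Real.sin_nonneg_of_nonneg_of_le_pi h_nonneg (by linarith)
  have h_inv : 2 / Real.pi * Real.arcsin (Real.sqrt (Real.sin (Real.pi / 2 * x) ^ 2)) = x := by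
    rw [Real.sqrt_sq h_sin, Real.arcsin_sin (by linarith) h_le]
    field_simp
  simpa only [h_inv] using hP (Real.sin (Real.pi / 2 * x) ^ 2) ⟨sq_nonneg _, Real.sin_sq_le_one _⟩

section Recurrence

variable {f : ℝ → ℝ} {e : ℕ → ℝ → ℝ} {κ : ℕ → ℝ}

theorem integral_mul_pow_eq_zero_of_recurrence {y : ℝ → ℝ} (hf : Integrable f muOm)
    (he : ∀ n, Continuous (e n)) (hy : Continuous y)
    (hrec : ∀ n x, e n x * y x = 1 / 2 * e n x - 1 / 4 * e (n + 1) x - κ n * e (n - 1) x)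
    (h : ∀ n, ∫ x, f x * e n x ∂muOm = 0) (k n : ℕ) :
    ∫ x, f x * (e n x * y x ^ k) ∂muOm = 0 := by
  induction k generalizing n with
  | zero => simpa using h n
  | succ k ih =>
    have hk : ∀ j, Integrable (fun x => f x * (e j x * y x ^ k)) muOm :=
      fun j => integrable_mul_of_continuous hf ((he j).mul (hy.pow k))
    have h_step : ∀ x, f x * (e n x * y x ^ (k + 1)) = 1 / 2 * (f x * (e n x * y x ^ k))
        - 1 / 4 * (f x * (e (n + 1) x * y x ^ k)) - κ n * (f x * (e (n - 1) x * y x ^ k)) := by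
      intro x
      rw [pow_succ]
      linear_combination (f x * y x ^ k) * hrec n x
    simp_rw [h_step]
    have h_sub : Integrable (fun x => 1 / 2 * (f x * (e n x * y x ^ k))
        - 1 / 4 * (f x * (e (n + 1) x * y x ^ k))) muOm :=
      ((hk n).const_mul _).sub ((hk (n + 1)).const_mul _)
    rw [integral_sub h_sub ((hk (n - 1)).const_mul _),
      integral_sub ((hk n).const_mul _) ((hk (n + 1)).const_mul _), integral_const_mul,
      integral_const_mul, integral_const_mul, ih, ih, ih]
    simp

theorem integral_mul_polynomial_eq_zero {w y : ℝ → ℝ} (hw : Integrable w muOm)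
    (hy : Continuous y) (h : ∀ k, ∫ x, w x * y x ^ k ∂muOm = 0) (P : Polynomial ℝ) :
    ∫ x, w x * P.eval (y x) ∂muOm = 0 := by
  have hi : ∀ k, Integrable (fun x => w x * y x ^ k) muOm :=
    fun k => integrable_mul_of_continuous hw (hy.pow k)
  simp_rw [Polynomial.eval_eq_sum_range, Finset.mul_sum, mul_left_comm (w _)]
  rw [integral_finsetSum _ fun k _ => (hi k).const_mul _]
  simp only [integral_const_mul, h, mul_zero, Finset.sum_const_zero]

theorem integral_mul_eq_zero_of_integral_mul_sin_sq_pow {w : ℝ → ℝ} (hw : Integrable w muOm)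
    (h : ∀ k, ∫ x, w x * (Real.sin (Real.pi / 2 * x) ^ 2) ^ k ∂muOm = 0) {g : ℝ → ℝ}
    (hg : Continuous g) : ∫ x, w x * g x ∂muOm = 0 := by
  set M := ∫ x, ‖w x‖ ∂muOm with hM
  have h_le : ∀ ε > 0, |∫ x, w x * g x ∂muOm| ≤ ε * M := by
    intro ε hε
    obtain ⟨P, hP⟩ := exists_polynomial_sin_sq_near hg hε
    have hP_cont : Continuous fun x => P.eval (Real.sin (Real.pi / 2 * x) ^ 2) := by fun_prop
    have h_sub : ∫ x, w x * g x ∂muOm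
        = ∫ x, w x * (g x - P.eval (Real.sin (Real.pi / 2 * x) ^ 2)) ∂muOm := by
      simp_rw [mul_sub]
      rw [integral_sub (integrable_mul_of_continuous hw hg)
          (integrable_mul_of_continuous hw hP_cont),
        integral_mul_polynomial_eq_zero hw (by fun_prop) h, sub_zero]
    rw [h_sub, ← Real.norm_eq_abs, hM, ← integral_const_mul]
    refine norm_integral_le_of_norm_le (hw.norm.const_mul ε) ?_
    filter_upwards [ae_restrict_mem measurableSet_Ioo] with x hx
    rw [norm_mul, mul_comm, Real.norm_eq_abs (g x - _), abs_sub_comm]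
    gcongr
    exact (hP x (Ioo_subset_Icc_self hx)).le
  have h_lim : Tendsto (fun ε : ℝ => ε * M) (𝓝[>] 0) (𝓝 0) :=
    tendsto_nhdsWithin_of_tendsto_nhds (by simpa using (continuous_mul_const M).tendsto 0)
  exact abs_nonpos_iff.1
    (ge_of_tendsto h_lim (eventually_mem_nhdsWithin.mono fun ε hε => h_le ε hε))

/-- Multiplying by `sin²(πx/2)` repeatedly, the recurrence reduces the claim to the density of
the polynomials in this variable. -/
theorem ae_eq_zero_of_integral_mul_recurrence (hf : Integrable f muOm)
    (he : ∀ n, Continuous (e n))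
    (hrec : ∀ n x, e n x * Real.sin (Real.pi / 2 * x) ^ 2
      = 1 / 2 * e n x - 1 / 4 * e (n + 1) x - κ n * e (n - 1) x)
    (h0 : ∀ x ∈ Ioo (0 : ℝ) 1, e 0 x ≠ 0) (h : ∀ n, ∫ x, f x * e n x ∂muOm = 0) :
    ∀ᵐ x ∂muOm, f x = 0 := by
  have hw := integrable_mul_of_continuous hf (he 0)
  have h_ae : ∀ᵐ x ∂muOm, f x * e 0 x = 0 :=
    ae_eq_zero_of_integral_mul_continuous hw fun g hg =>
      integral_mul_eq_zero_of_integral_mul_sin_sq_pow hw (fun k => by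
        simpa only [mul_assoc] using
          integral_mul_pow_eq_zero_of_recurrence hf he (by fun_prop) hrec h k 0) hg
  filter_upwards [h_ae, ae_restrict_mem measurableSet_Ioo] with x hx hx1
  exact (mul_eq_zero.1 hx).resolve_right (h0 x hx1)

end Recurrence

theorem ae_eq_zero_of_integral_mul_sin {f : ℝ → ℝ} (hf : Integrable f muOm)
    (h : ∀ n, ∫ x, f x * Real.sin (freq n * x) ∂muOm = 0) : ∀ᵐ x ∂muOm, f x = 0 := by
  refine ae_eq_zero_of_integral_mul_recurrence hf (e := fun n x => Real.sin (freq n * x))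
    (κ := fun n => if n = 0 then -1 / 4 else 1 / 4) (fun n => by fun_prop) (fun n x => ?_)
    (fun x hx => ?_) h
  · have h1 : Real.sin (Real.pi / 2 * x) ^ 2 = 1 / 2 - Real.cos (Real.pi * x) / 2 := by
      rw [Real.sin_sq_eq_half_sub]; congr 3; ring
    have h2 : Real.sin (freq (n + 1) * x) = Real.sin (freq n * x) * Real.cos (Real.pi * x)
        + Real.cos (freq n * x) * Real.sin (Real.pi * x) := by
      rw [← Real.sin_add]; congr 1; unfold freq; push_cast; ring
    rcases Nat.eq_zero_or_pos n with rfl | hn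
    · have h3 : Real.sin (freq 0 * x) = -(Real.sin (freq 0 * x) * Real.cos (Real.pi * x)
          - Real.cos (freq 0 * x) * Real.sin (Real.pi * x)) := by
        rw [← Real.sin_sub, ← Real.sin_neg]; congr 1; unfold freq; push_cast; ring
      simp only [if_true]
      rw [h1, h2]
      linear_combination (-1 / 4) * h3
    · have h3 : Real.sin (freq (n - 1) * x) = Real.sin (freq n * x) * Real.cos (Real.pi * x)
          - Real.cos (freq n * x) * Real.sin (Real.pi * x) := by
        rw [← Real.sin_sub]; congr 1; unfold freq; push_cast [Nat.cast_sub hn]; ring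
      simp only [hn.ne', if_false]
      rw [h1, h2, h3]
      ring
  · have hpi := Real.pi_pos
    refine (Real.sin_pos_of_pos_of_lt_pi ?_ ?_).ne'
    · have := hx.1; have := freq_pos 0; positivity
    · unfold freq; push_cast; nlinarith [hx.2]

theorem ae_eq_zero_of_integral_mul_cos {f : ℝ → ℝ} (hf : Integrable f muOm)
    (h : ∀ n, ∫ x, f x * Real.cos (freq n * x) ∂muOm = 0) : ∀ᵐ x ∂muOm, f x = 0 := by
  refine ae_eq_zero_of_integral_mul_recurrence hf (e := fun n x => Real.cos (freq n * x))
    (κ := fun _ => 1 / 4) (fun n => by fun_prop) (fun n x => ?_) (fun x hx => ?_) h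
  · have h1 : Real.sin (Real.pi / 2 * x) ^ 2 = 1 / 2 - Real.cos (Real.pi * x) / 2 := by
      rw [Real.sin_sq_eq_half_sub]; congr 3; ring
    have h2 : Real.cos (freq (n + 1) * x) = Real.cos (freq n * x) * Real.cos (Real.pi * x)
        - Real.sin (freq n * x) * Real.sin (Real.pi * x) := by
      rw [← Real.cos_add]; congr 1; unfold freq; push_cast; ring
    have h3 : Real.cos (freq (n - 1) * x) = Real.cos (freq n * x) * Real.cos (Real.pi * x)
        + Real.sin (freq n * x) * Real.sin (Real.pi * x) := by
      rw [← Real.cos_sub]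
      rcases Nat.eq_zero_or_pos n with rfl | hn
      · rw [← Real.cos_neg]; congr 1; unfold freq; push_cast; ring
      · congr 1; unfold freq; push_cast [Nat.cast_sub hn]; ring
    rw [h1, h2, h3]
    ring
  · have hpi := Real.pi_pos
    have h1 : 0 < freq 0 * x := mul_pos (freq_pos 0) hx.1
    refine (Real.cos_pos_of_mem_Ioo ⟨by linarith, ?_⟩).ne'
    unfold freq; push_cast; nlinarith [hx.2]

theorem L2Q.eq_zero_of_integral_mul_sin {T : ℝ} (f : L2Q T)
    (h : ∀ (n : ℕ) (η : ℝ → ℝ), Continuous η →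
      ∫ p, f p * (Real.sin (freq n * p.1) * η p.2) ∂(muQ T) = 0) : f = 0 := by
  have : IsFiniteMeasure (muQ T) := by rw [muQ_eq_prod]; infer_instance
  have hf : Integrable (f : ℝ × ℝ → ℝ) (muQ T) := (Lp.memLp f).integrable (by norm_num)
  have hi : ∀ g : ℝ × ℝ → ℝ, Continuous g → Integrable (fun p => f p * g p) (muQ T) :=
    fun g hg => hf.mul_of_top_left (memLp_muQ hg T ∞)
  have h_coeff : ∀ n : ℕ, ∀ᵐ t ∂(muT T), ∫ x, f (x, t) * Real.sin (freq n * x) ∂muOm = 0 := by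
    intro n
    have h_prod : Integrable (fun p => f p * Real.sin (freq n * p.1)) (muOm.prod (muT T)) :=
      muQ_eq_prod T ▸ hi (fun p => Real.sin (freq n * p.1)) (by fun_prop)
    refine ae_eq_zero_of_integral_mul_continuous h_prod.integral_prod_right fun η hη => ?_
    refine Eq.trans ?_ (h n η hη)
    rw [integral_muQ_eq_iterated (hi _ (by fun_prop))]
    simp_rw [← integral_mul_const, mul_assoc]
  have h_slice : ∀ᵐ t ∂(muT T), Integrable (fun x => f (x, t)) muOm :=
    (show Integrable f (muOm.prod (muT T)) by rwa [← muQ_eq_prod]).prod_left_ae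
  have h_zero : ∀ᵐ t ∂(muT T), ∫ x, f (x, t) ^ 2 ∂muOm = 0 := by
    filter_upwards [ae_all_iff.2 h_coeff, h_slice] with t h_coeff h_int
    refine integral_eq_zero_of_ae ?_
    filter_upwards [ae_eq_zero_of_integral_mul_sin h_int h_coeff] with x hx
    simp [hx]
  have h_norm : ‖f‖ ^ 2 = 0 := by
    rw [Lp_two_norm_sq, integral_muQ_eq_iterated (Lp.memLp f).integrable_sq]
    exact integral_eq_zero_of_ae h_zero
  exact norm_eq_zero.1 (pow_eq_zero_iff two_ne_zero |>.1 h_norm)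

theorem L2Om.inner_ofContinuous (f : L2Om) {g : ℝ → ℝ} (hg : Continuous g) :
    inner ℝ f (ofContinuous g hg) = ∫ x, f x * g x ∂muOm := by
  rw [Lp_two_inner]
  exact integral_congr_ae ((coeFn_ofContinuous hg).mono fun x hx => by simp only [hx])

theorem L2Om.inner_ofContinuous_ofContinuous {f g : ℝ → ℝ} (hf : Continuous f)
    (hg : Continuous g) :
    inner ℝ (ofContinuous f hf) (ofContinuous g hg) = ∫ x in (0 : ℝ)..1, f x * g x := by
  rw [inner_ofContinuous, ← integral_muOm]
  exact integral_congr_ae ((coeFn_ofContinuous hf).mono fun x hx => by simp only [hx])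

theorem L2Q.inner_ofContinuous {T : ℝ} (f : L2Q T) {g : ℝ × ℝ → ℝ} (hg : Continuous g) :
    inner ℝ f (ofContinuous T g hg) = ∫ p, f p * g p ∂(muQ T) := by
  rw [Lp_two_inner]
  exact integral_congr_ae ((coeFn_ofContinuous hg).mono fun x hx => by simp only [hx])

/-- The mode `sin((n + 1/2) π x)` in `L²(Ω)`. -/
def sinMode (n : ℕ) : L2Om := L2Om.ofContinuous (fun x => Real.sin (freq n * x)) (by fun_prop)

/-- The mode `cos((n + 1/2) π x)` in `L²(Ω)`. -/
def cosMode (n : ℕ) : L2Om := L2Om.ofContinuous (fun x => Real.cos (freq n * x)) (by fun_prop)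

/-- The source term `sin((n + 1/2) π x) η(t)` in `L²(Q_T)`. -/
def sinModeQ (T : ℝ) (n : ℕ) (η : C(ℝ, ℝ)) : L2Q T :=
  L2Q.ofContinuous T (fun p => Real.sin (freq n * p.1) * η p.2) (by fun_prop)

theorem L2Om.eq_zero_of_inner_sinMode {f : L2Om} (h : ∀ n, inner ℝ f (sinMode n) = 0) : f = 0 :=
  Lp.eq_zero_iff_ae_eq_zero.2 <| ae_eq_zero_of_integral_mul_sin f.integrable fun n =>
    (f.inner_ofContinuous _).symm.trans (h n)

theorem L2Om.eq_zero_of_inner_cosMode {f : L2Om} (h : ∀ n, inner ℝ f (cosMode n) = 0) : f = 0 :=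
  Lp.eq_zero_iff_ae_eq_zero.2 <| ae_eq_zero_of_integral_mul_cos f.integrable fun n =>
    (f.inner_ofContinuous _).symm.trans (h n)

theorem L2Q.eq_zero_of_inner_sinModeQ {T : ℝ} {f : L2Q T}
    (h : ∀ n η, inner ℝ f (sinModeQ T n η) = 0) : f = 0 :=
  f.eq_zero_of_integral_mul_sin fun n η hη => (f.inner_ofContinuous _).symm.trans (h n ⟨η, hη⟩)

/-! ### Time slices -/

theorem continuous_of_norm_sub_sq_eq_integral {E : Type*} [NormedAddCommGroup E] {u : ℝ → E}
    {f : ℝ × ℝ → ℝ} (hf : Continuous f) {a b : ℝ}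
    (h : ∀ s t, ‖u s - u t‖ ^ 2 = ∫ x in a..b, (f (x, s) - f (x, t)) ^ 2) : Continuous u := by
  refine continuous_iff_continuousAt.2 fun t => tendsto_iff_norm_sub_tendsto_zero.2 ?_
  have h_norm : ∀ s, ‖u s - u t‖ = √(∫ x in a..b, (f (x, s) - f (x, t)) ^ 2) := fun s => by
    rw [← h, Real.sqrt_sq (norm_nonneg _)]
  simp_rw [h_norm]
  have h_cont : Continuous fun s => √(∫ x in a..b, (f (x, s) - f (x, t)) ^ 2) :=
    (continuous_integral_slice_left (f := fun z => (f z - f (z.1, t)) ^ 2) (by fun_prop) a b).sqrt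
  simpa using h_cont.tendsto t

/-- The slice `f(·,t)` of a continuous function as an element of `L²(Ω)`. -/
def L2Om.slice (f : ℝ × ℝ → ℝ) (hf : Continuous f) (t : ℝ) : L2Om :=
  ofContinuous (fun x => f (x, t)) (by fun_prop)

theorem L2Om.continuous_slice {f : ℝ × ℝ → ℝ} (hf : Continuous f) : Continuous (slice f hf) :=
  continuous_of_norm_sub_sq_eq_integral hf fun s t =>
    norm_sq_ofContinuous (f := fun x => f (x, s) - f (x, t)) (by fun_prop)

theorem L2Om.slice_eq_add_integral {f p : ℝ × ℝ → ℝ} (hf : Continuous f) (hp : Continuous p)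
    (h : HasDerivT f p) (t : ℝ) :
    slice f hf t = slice f hf 0 + ∫ s in (0 : ℝ)..t, slice p hp s := by
  refine sub_eq_zero.1 (eq_zero_of_inner_sinMode fun n => ?_)
  have h_inner : ∀ {u : ℝ × ℝ → ℝ} (hu : Continuous u) (s : ℝ),
      inner ℝ (sinMode n) (slice u hu s) = ∫ x in (0 : ℝ)..1, Real.sin (freq n * x) * u (x, s) :=
    fun _ _ => inner_ofContinuous_ofContinuous _ _
  have h_int : inner ℝ (sinMode n) (∫ s in (0 : ℝ)..t, slice p hp s)
      = ∫ x in (0 : ℝ)..1, Real.sin (freq n * x) * (f (x, t) - f (x, 0)) := by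
    rw [← innerSL_apply_apply ℝ, ← ContinuousLinearMap.intervalIntegral_comp_comm _
      ((continuous_slice hp).intervalIntegrable _ _)]
    simp_rw [innerSL_apply_apply, h_inner]
    rw [intervalIntegral_swap (f := fun z => Real.sin (freq n * z.1) * p z) (by fun_prop)]
    simp_rw [intervalIntegral.integral_const_mul, h.integral_eq_sub hp]
  rw [real_inner_comm, inner_sub_right, inner_add_right, h_inner, h_inner, h_int,
    ← intervalIntegral.integral_add (Continuous.intervalIntegrable (by fun_prop) _ _)
      (Continuous.intervalIntegrable (by fun_prop) _ _), sub_eq_zero]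
  exact intervalIntegral.integral_congr fun x _ => by ring

/-! ### Density of the data of classical solutions -/

theorem map_mem_of_total {ι E X : Type*} [NormedAddCommGroup E]
    [InnerProductSpace ℝ E] [CompleteSpace E] [NormedAddCommGroup X] [NormedSpace ℝ X]
    {e : ι → E} (he : ∀ v, (∀ i, inner ℝ v (e i) = 0) → v = 0) (L : E →L[ℝ] X)
    {V : Submodule ℝ X} (hV : IsClosed (V : Set X)) (h : ∀ i, L (e i) ∈ V) (v : E) : L v ∈ V := by
  have h_closed : IsClosed (V.comap L.toLinearMap : Set E) := hV.preimage L.continuous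
  have h_top : V.comap L.toLinearMap = ⊤ := by
    rw [← h_closed.submodule_topologicalClosure_eq, Submodule.topologicalClosure_eq_top_iff,
      Submodule.eq_bot_iff]
    exact fun f hf => he f fun i => (Submodule.mem_orthogonal' _ f).1 hf _ (h i)
  exact h_top.ge (Submodule.mem_top (x := v))

namespace WaveSolution

variable (S : WaveSolution)

/-- `φ(·,t)` as an element of `L²(Ω)`. -/
def phiAt : ℝ → L2Om := L2Om.slice S.φ S.hφ

/-- `G(·,t)` as an element of `L²(Ω)`. -/
def GAt : ℝ → L2Om := L2Om.slice S.G S.hG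

/-- The data `(φ(·,0), G(·,0), F)` of a classical solution. -/
def data (T : ℝ) : L2Om × L2Om × L2Q T := (S.phiAt 0, S.GAt 0, L2Q.ofContinuous T S.F S.hF)

theorem data_addSMul (c : ℝ) (S' : WaveSolution) (T : ℝ) :
    (S.addSMul c S').data T = S.data T + c • S'.data T := rfl

theorem data_zero (T : ℝ) : zero.data T = 0 := rfl

/-- The data of classical solutions. -/
def dataSubmodule (T : ℝ) : Submodule ℝ (L2Om × L2Om × L2Q T) where
  carrier := range fun S : WaveSolution => S.data T
  zero_mem' := ⟨zero, data_zero T⟩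
  add_mem' := by
    rintro _ _ ⟨S, rfl⟩ ⟨S', rfl⟩
    exact ⟨S.addSMul 1 S', by simp [data_addSMul]⟩
  smul_mem' := by
    rintro c _ ⟨S, rfl⟩
    exact ⟨zero.addSMul c S, by simp [data_addSMul, data_zero]⟩

theorem modeData_mem_dataSubmodule (T : ℝ) (n : ℕ) (α β : ℝ) (η : C(ℝ, ℝ)) :
    (α • sinMode n, β • cosMode n, sinModeQ T n η) ∈ dataSubmodule T := by
  have hn := (freq_pos n).ne'
  obtain ⟨b, b', hb, hb', h0, h1⟩ := exists_oscillator hn η.continuous 0 α (-(β * freq n))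
  refine ⟨mode n b b' η η.continuous hb hb', Prod.ext ?_ (Prod.ext ?_ rfl)⟩
  · change L2Om.ofContinuous (fun x => Real.sin (freq n * x) * b 0) (by fun_prop)
      = L2Om.ofContinuous (fun x => α * Real.sin (freq n * x)) (by fun_prop)
    congr 1
    ext x
    rw [h0, mul_comm]
  · change L2Om.ofContinuous (fun x => -(Real.cos (freq n * x) / freq n) * b' 0) (by fun_prop)
      = L2Om.ofContinuous (fun x => β * Real.cos (freq n * x)) (by fun_prop)
    congr 1
    ext x
    rw [h1]
    field_simp

theorem dataSubmodule_dense (T : ℝ) : (dataSubmodule T).topologicalClosure = ⊤ := by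
  set V := (dataSubmodule T).topologicalClosure
  have hV : IsClosed (V : Set (L2Om × L2Om × L2Q T)) := Submodule.isClosed_topologicalClosure _
  have h_mode : ∀ n α β η, (α • sinMode n, β • cosMode n, sinModeQ T n η) ∈ V := fun n α β η =>
    Submodule.le_topologicalClosure _ (modeData_mem_dataSubmodule T n α β η)
  have h_zero : ∀ n, sinModeQ T n 0 = 0 := fun n => by
    change L2Q.ofContinuous T (fun p => Real.sin (freq n * p.1) * 0) _
      = L2Q.ofContinuous T (fun _ => 0) continuous_const
    simp_rw [mul_zero]
  refine eq_top_iff.2 fun d _ => ?_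
  have h_phi : (d.1, 0, 0) ∈ V :=
    map_mem_of_total (fun v => L2Om.eq_zero_of_inner_sinMode (f := v))
      (.inl ℝ L2Om (L2Om × L2Q T)) hV
      (fun n => by simpa [h_zero, Prod.mk_zero_zero] using h_mode n 1 0 0) d.1
  have h_G : (0, d.2.1, 0) ∈ V :=
    map_mem_of_total (fun v => L2Om.eq_zero_of_inner_cosMode (f := v))
      ((ContinuousLinearMap.inr ℝ L2Om (L2Om × L2Q T)).comp (.inl ℝ L2Om (L2Q T))) hV
      (fun n => by simpa [h_zero] using h_mode n 0 1 0) d.2.1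
  have h_F : (0, 0, d.2.2) ∈ V :=
    map_mem_of_total (e := fun i : ℕ × C(ℝ, ℝ) => sinModeQ T i.1 i.2)
      (fun v hv => L2Q.eq_zero_of_inner_sinModeQ fun n η => hv (n, η))
      ((ContinuousLinearMap.inr ℝ L2Om (L2Om × L2Q T)).comp (.inr ℝ L2Om (L2Q T))) hV
      (fun i => by simpa using h_mode i.1 0 0 i.2) d.2.2
  simpa using V.add_mem (V.add_mem h_phi h_G) h_F

end WaveSolution

/-! ### Stability of classical solutions -/

namespace WaveSolution

variable (S : WaveSolution)

/-- `φ(1,·)` as an element of `L²(0,T)`. -/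
def trace (T : ℝ) : L2T T :=
  have := S.hφ
  L2T.ofContinuous T (fun t => S.φ (1, t)) (by fun_prop)

/-- `φ` as an element of `L²(Q_T)`. -/
def phiQ (T : ℝ) : L2Q T := L2Q.ofContinuous T S.φ S.hφ

theorem continuous_integral_near_one :
    Continuous fun z : ℝ × ℝ => ∫ s in (0 : ℝ)..1, S.φ (1 - z.2 * s, z.1) :=
  have := S.hφ
  intervalIntegral.continuous_parametric_intervalIntegral_of_continuous'
    (f := fun (z : ℝ × ℝ) s => S.φ (1 - z.2 * s, z.1)) (by fun_prop) 0 1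

theorem continuous_integral_near_one_left (ε : ℝ) :
    Continuous fun t => ∫ s in (0 : ℝ)..1, S.φ (1 - ε * s, t) :=
  S.continuous_integral_near_one.comp (.prodMk_left ε)

/-- The mean of `φ(x,·)` over `1 - ε < x < 1` as an element of `L²(0,T)`. The integral is scaled
to the unit interval, so that `ε = 0` gives the trace. -/
def average (T ε : ℝ) : L2T T :=
  L2T.ofContinuous T (fun t => ∫ s in (0 : ℝ)..1, S.φ (1 - ε * s, t))
    (S.continuous_integral_near_one_left ε)

theorem average_zero (T : ℝ) : S.average T 0 = S.trace T := by
  simp [average, trace]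

theorem continuous_average {T : ℝ} (hT : 0 ≤ T) : Continuous (S.average T) :=
  continuous_of_norm_sub_sq_eq_integral S.continuous_integral_near_one fun ε δ =>
    L2T.norm_sq_ofContinuous hT
      ((S.continuous_integral_near_one_left ε).sub (S.continuous_integral_near_one_left δ))

theorem phiAt_addSMul (S' : WaveSolution) (c t : ℝ) :
    (S.addSMul c S').phiAt t = S.phiAt t + c • S'.phiAt t := rfl

theorem GAt_addSMul (S' : WaveSolution) (c t : ℝ) :
    (S.addSMul c S').GAt t = S.GAt t + c • S'.GAt t := rfl

theorem phiQ_addSMul (S' : WaveSolution) (c T : ℝ) :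
    (S.addSMul c S').phiQ T = S.phiQ T + c • S'.phiQ T := rfl

theorem average_addSMul (S' : WaveSolution) (c T ε : ℝ) :
    (S.addSMul c S').average T ε = S.average T ε + c • S'.average T ε := by
  have := S.hφ
  have := S'.hφ
  have h_int : ∀ t, ∫ s in (0 : ℝ)..1, (S.addSMul c S').φ (1 - ε * s, t)
      = (∫ s in (0 : ℝ)..1, S.φ (1 - ε * s, t)) + c * ∫ s in (0 : ℝ)..1, S'.φ (1 - ε * s, t) :=
    fun t => by
      simp only [addSMul]
      rw [intervalIntegral.integral_add (Continuous.intervalIntegrable (by fun_prop) _ _)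
        (Continuous.intervalIntegrable (by fun_prop) _ _), intervalIntegral.integral_const_mul]
  unfold average
  simp_rw [h_int]
  rfl

/-- The stability constant of the wave equation on `(0,T)`. -/
def stabConst (T : ℝ) : ℝ := √(3 * ((4 * T + 6) * Real.exp T))

theorem stabConst_nonneg (T : ℝ) : 0 ≤ stabConst T := Real.sqrt_nonneg _

theorem norm_sq_phiAt_add (t : ℝ) : ‖S.phiAt t‖ ^ 2 + ‖S.GAt t‖ ^ 2 = S.energy t := by
  have := S.hφ
  have := S.hG
  unfold phiAt GAt L2Om.slice energy
  rw [L2Om.norm_sq_ofContinuous, L2Om.norm_sq_ofContinuous, intervalIntegral.integral_add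
    (Continuous.intervalIntegrable (by fun_prop) _ _)
    (Continuous.intervalIntegrable (by fun_prop) _ _)]

theorem dataSq_le {T : ℝ} (hT : 0 ≤ T) : S.dataSq T ≤ 3 * ‖S.data T‖ ^ 2 := by
  have h_phi : ‖S.phiAt 0‖ ≤ ‖S.data T‖ := norm_fst_le (S.data T)
  have h_G : ‖S.GAt 0‖ ≤ ‖S.data T‖ := (norm_fst_le (S.data T).2).trans (norm_snd_le (S.data T))
  have h_F : ‖L2Q.ofContinuous T S.F S.hF‖ ≤ ‖S.data T‖ :=
    (norm_snd_le (S.data T).2).trans (norm_snd_le (S.data T))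
  unfold dataSq
  rw [← norm_sq_phiAt_add, ← integral_muQ_eq_interval hT (f := fun z => S.F z ^ 2) (S.hF.pow 2),
    ← L2Q.norm_sq_ofContinuous S.hF]
  linarith [pow_le_pow_left₀ (norm_nonneg _) h_phi 2, pow_le_pow_left₀ (norm_nonneg _) h_G 2,
    pow_le_pow_left₀ (norm_nonneg _) h_F 2]

theorem le_stabConst_mul {T a : ℝ} (hT : 0 ≤ T)
    (h : a ^ 2 ≤ (4 * T + 6) * (Real.exp T * S.dataSq T)) : a ≤ stabConst T * ‖S.data T‖ := by
  refine le_of_sq_le_sq ?_ (mul_nonneg (stabConst_nonneg T) (norm_nonneg _))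
  calc a ^ 2 ≤ (4 * T + 6) * (Real.exp T * S.dataSq T) := h
    _ ≤ (4 * T + 6) * (Real.exp T * (3 * ‖S.data T‖ ^ 2)) := by gcongr; exact S.dataSq_le hT
    _ = (stabConst T * ‖S.data T‖) ^ 2 := by
      rw [mul_pow, stabConst, Real.sq_sqrt (by positivity)]; ring

theorem energy_le_mul_dataSq {T t : ℝ} (ht : t ∈ Icc 0 T) :
    S.energy t ≤ (4 * T + 6) * (Real.exp T * S.dataSq T) := by
  have hT := ht.1.trans ht.2
  refine (S.energy_le ht).trans (le_mul_of_one_le_left ?_ (by linarith))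
  exact mul_nonneg (Real.exp_pos T).le (S.dataSq_nonneg hT)

theorem norm_phiAt_le {T t : ℝ} (ht : t ∈ Icc 0 T) : ‖S.phiAt t‖ ≤ stabConst T * ‖S.data T‖ :=
  S.le_stabConst_mul (ht.1.trans ht.2) <| (S.energy_le_mul_dataSq ht).trans' <| by
    rw [← norm_sq_phiAt_add]; exact le_add_of_nonneg_right (sq_nonneg _)

theorem norm_GAt_le {T t : ℝ} (ht : t ∈ Icc 0 T) : ‖S.GAt t‖ ≤ stabConst T * ‖S.data T‖ :=
  S.le_stabConst_mul (ht.1.trans ht.2) <| (S.energy_le_mul_dataSq ht).trans' <| by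
    rw [← norm_sq_phiAt_add]; exact le_add_of_nonneg_left (sq_nonneg _)

theorem norm_phiQ_le {T : ℝ} (hT : 0 ≤ T) : ‖S.phiQ T‖ ≤ stabConst T * ‖S.data T‖ := by
  refine S.le_stabConst_mul hT ?_
  have h_nonneg : 0 ≤ Real.exp T * S.dataSq T :=
    mul_nonneg (Real.exp_pos T).le (S.dataSq_nonneg hT)
  calc ‖S.phiQ T‖ ^ 2 = ∫ t in (0 : ℝ)..T, ∫ x in (0 : ℝ)..1, S.φ (x, t) ^ 2 := by
        rw [phiQ, L2Q.norm_sq_ofContinuous,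
          integral_muQ_eq_interval hT (f := fun z => S.φ z ^ 2) (S.hφ.pow 2)]
    _ ≤ ∫ _ in (0 : ℝ)..T, Real.exp T * S.dataSq T :=
        integral_mono_on_of_continuous (continuous_integral_slice_left (S.hφ.pow 2) 0 1)
          continuous_const hT fun t ht => by
            refine (S.energy_le ht).trans' ?_
            rw [← norm_sq_phiAt_add, phiAt, L2Om.slice, L2Om.norm_sq_ofContinuous]
            exact le_add_of_nonneg_right (sq_nonneg _)
    _ = T * (Real.exp T * S.dataSq T) := by
        rw [intervalIntegral.integral_const, sub_zero, smul_eq_mul]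
    _ ≤ (4 * T + 6) * (Real.exp T * S.dataSq T) := by gcongr; linarith

theorem norm_average_le {T ε : ℝ} (hT : 0 ≤ T) (hε : ε ∈ Icc (0 : ℝ) (1 / 2)) :
    ‖S.average T ε‖ ≤ stabConst T * ‖S.data T‖ := by
  refine S.le_stabConst_mul hT ?_
  have := S.hφ
  have h_cont : Continuous fun z : ℝ × ℝ => S.φ (1 - ε * z.1, z.2) ^ 2 := by fun_prop
  calc ‖S.average T ε‖ ^ 2
      = ∫ t in (0 : ℝ)..T, (∫ s in (0 : ℝ)..1, S.φ (1 - ε * s, t)) ^ 2 :=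
        L2T.norm_sq_ofContinuous hT _
    _ ≤ ∫ t in (0 : ℝ)..T, ∫ s in (0 : ℝ)..1, S.φ (1 - ε * s, t) ^ 2 :=
        integral_mono_on_of_continuous ((S.continuous_integral_near_one_left ε).pow 2)
          (continuous_integral_slice_left h_cont 0 1) hT fun t _ => by
            simpa using sq_intervalIntegral_le_mul
              (f := fun s => S.φ (1 - ε * s, t)) (by fun_prop) zero_le_one
    _ = ∫ s in (0 : ℝ)..1, ∫ t in (0 : ℝ)..T, S.φ (1 - ε * s, t) ^ 2 :=
        intervalIntegral_swap h_cont 0 T 0 1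
    _ ≤ ∫ _ in (0 : ℝ)..1, (4 * T + 6) * (Real.exp T * S.dataSq T) :=
        integral_mono_on_of_continuous (continuous_integral_slice_right h_cont 0 T)
          continuous_const zero_le_one fun s hs =>
            S.integral_sq_slice_le (x₀ := 1 - ε * s) hT (by nlinarith [hε.1, hε.2, hs.1, hs.2])
              (by nlinarith [hε.1, hs.1])
    _ = (4 * T + 6) * (Real.exp T * S.dataSq T) := by simp

theorem L2toHm1_phiAt (t : ℝ) :
    L2toHm1 (S.phiAt t) = L2toHm1 (S.phiAt 0) + ∫ s in (0 : ℝ)..t, dxDual (S.GAt s) := by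
  have h_phi : S.phiAt t = S.phiAt 0 + ∫ s in (0 : ℝ)..t, L2Om.slice S.p S.hp s :=
    L2Om.slice_eq_add_integral S.hφ S.hp S.φ_dt t
  rw [h_phi, L2toHm1_eq, L2toHm1_eq, map_add, ← ContinuousLinearMap.intervalIntegral_comp_comm _
    ((L2Om.continuous_slice S.hp).intervalIntegrable _ _)]
  have := S.hG
  congr 1
  exact intervalIntegral.integral_congr fun s _ =>
    L2toHm1_ofContinuous_eq_dxDual _ (fun x => S.G_dx x s) (by fun_prop) (S.G_one s)

theorem continuous_phiAt : Continuous S.phiAt := L2Om.continuous_slice S.hφ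

theorem continuous_GAt : Continuous S.GAt := L2Om.continuous_slice S.hG

end WaveSolution

/-! ### Limits of classical solutions -/

theorem tendsto_mul_dist_of_cauchySeq {Y : Type*} [PseudoMetricSpace Y] {d : ℕ → Y}
    (hd : CauchySeq d) (K : ℝ) :
    Tendsto (fun m : ℕ × ℕ => K * dist (d m.1) (d m.2)) atTop (𝓝 0) := by
  simpa using (cauchySeq_iff_tendsto_dist_atTop_0.1 hd).const_mul K

theorem cauchySeq_of_dist_le_mul {X Y : Type*} [PseudoMetricSpace X] [PseudoMetricSpace Y]
    {x : ℕ → X} {d : ℕ → Y} {K : ℝ} (hd : CauchySeq d)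
    (h : ∀ j k, dist (x j) (x k) ≤ K * dist (d j) (d k)) : CauchySeq x :=
  cauchySeq_iff_tendsto_dist_atTop_0.2 <|
    squeeze_zero (fun _ => dist_nonneg) (fun m => h m.1 m.2) (tendsto_mul_dist_of_cauchySeq hd K)

theorem exists_tendstoUniformlyOn_of_dist_le_mul {α X Y : Type*} [PseudoMetricSpace X]
    [CompleteSpace X] [PseudoMetricSpace Y] {f : ℕ → α → X} {s : Set α} {d : ℕ → Y} {K : ℝ}
    (hd : CauchySeq d) (h : ∀ j k, ∀ t ∈ s, dist (f j t) (f k t) ≤ K * dist (d j) (d k)) :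
    ∃ g : α → X, TendstoUniformlyOn f g atTop s := by
  have h_unif : UniformCauchySeqOn f atTop s := fun u hu => by
    obtain ⟨ε, hε, hεu⟩ := Metric.mem_uniformity_dist.1 hu
    rw [prod_atTop_atTop_eq]
    filter_upwards [(tendsto_mul_dist_of_cauchySeq hd K).eventually (gt_mem_nhds hε)] with m hm t ht
    exact hεu ((h m.1 m.2 t ht).trans_lt hm)
  have h_lim (t : α) : ∃ x, t ∈ s → Tendsto (fun k => f k t) atTop (𝓝 x) := by
    by_cases ht : t ∈ s
    · obtain ⟨x, hx⟩ := cauchySeq_tendsto_of_complete (h_unif.cauchySeq ht)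
      exact ⟨x, fun _ => hx⟩
    · exact ⟨f 0 t, fun h => absurd h ht⟩
  choose g hg using h_lim
  exact ⟨g, h_unif.tendstoUniformlyOn_of_tendsto hg⟩

/-- The classical solutions `S k` converge to a solution with data `d`: `φ → Φ` and `G → Γ`
uniformly on `[0,T]` with values in `L²(Ω)`, `φ → ψ` in `L²(Q_T)`, and the averages over
`(1 - ε, 1)` converge to `v ε` in `L²(0,T)`, uniformly in `ε`, so that `v 0` is the limit of the
traces. -/
structure IsWaveLimit (T : ℝ) (d : L2Om × L2Om × L2Q T) (S : ℕ → WaveSolution)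
    (Φ Γ : ℝ → L2Om) (ψ : L2Q T) (v : ℝ → L2T T) : Prop where
  data : Tendsto (fun k => (S k).data T) atTop (𝓝 d)
  phi : TendstoUniformlyOn (fun k => (S k).phiAt) Φ atTop (Icc 0 T)
  G : TendstoUniformlyOn (fun k => (S k).GAt) Γ atTop (Icc 0 T)
  phiQ : Tendsto (fun k => (S k).phiQ T) atTop (𝓝 ψ)
  average : TendstoUniformlyOn (fun k => (S k).average T) v atTop (Icc 0 (1 / 2))

namespace WaveSolution

variable (S S' : WaveSolution) {T : ℝ}

theorem data_sub : (S.addSMul (-1) S').data T = S.data T - S'.data T := by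
  rw [data_addSMul, neg_one_smul, sub_eq_add_neg]

theorem dist_phiAt_le {t : ℝ} (ht : t ∈ Icc 0 T) :
    dist (S.phiAt t) (S'.phiAt t) ≤ stabConst T * dist (S.data T) (S'.data T) := by
  simpa only [dist_eq_norm, data_sub, phiAt_addSMul, neg_one_smul, ← sub_eq_add_neg]
    using (S.addSMul (-1) S').norm_phiAt_le ht

theorem dist_GAt_le {t : ℝ} (ht : t ∈ Icc 0 T) :
    dist (S.GAt t) (S'.GAt t) ≤ stabConst T * dist (S.data T) (S'.data T) := by
  simpa only [dist_eq_norm, data_sub, GAt_addSMul, neg_one_smul, ← sub_eq_add_neg]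
    using (S.addSMul (-1) S').norm_GAt_le ht

theorem dist_phiQ_le (hT : 0 ≤ T) :
    dist (S.phiQ T) (S'.phiQ T) ≤ stabConst T * dist (S.data T) (S'.data T) := by
  simpa only [dist_eq_norm, data_sub, phiQ_addSMul, neg_one_smul, ← sub_eq_add_neg]
    using (S.addSMul (-1) S').norm_phiQ_le hT

theorem dist_average_le (hT : 0 ≤ T) {ε : ℝ} (hε : ε ∈ Icc (0 : ℝ) (1 / 2)) :
    dist (S.average T ε) (S'.average T ε) ≤ stabConst T * dist (S.data T) (S'.data T) := by
  simpa only [dist_eq_norm, data_sub, average_addSMul, neg_one_smul, ← sub_eq_add_neg]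
    using (S.addSMul (-1) S').norm_average_le hT hε

end WaveSolution

open WaveSolution in
theorem exists_isWaveLimit {T : ℝ} (hT : 0 ≤ T) (d : L2Om × L2Om × L2Q T) :
    ∃ S Φ Γ ψ v, IsWaveLimit T d S Φ Γ ψ v := by
  have h_mem : d ∈ closure (dataSubmodule T : Set (L2Om × L2Om × L2Q T)) := by
    rw [← Submodule.topologicalClosure_coe, dataSubmodule_dense]
    trivial
  obtain ⟨e, he, h_lim⟩ := mem_closure_iff_seq_limit.1 h_mem
  choose S hS using he
  have h_data : Tendsto (fun k => (S k).data T) atTop (𝓝 d) := h_lim.congr fun k => (hS k).symm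
  have h_cauchy := h_data.cauchySeq
  obtain ⟨Φ, hΦ⟩ := exists_tendstoUniformlyOn_of_dist_le_mul (f := fun k => (S k).phiAt)
    (s := Icc 0 T) h_cauchy fun j k _ ht => (S j).dist_phiAt_le (S k) ht
  obtain ⟨Γ, hΓ⟩ := exists_tendstoUniformlyOn_of_dist_le_mul (f := fun k => (S k).GAt)
    (s := Icc 0 T) h_cauchy fun j k _ ht => (S j).dist_GAt_le (S k) ht
  obtain ⟨ψ, hψ⟩ := cauchySeq_tendsto_of_complete
    (cauchySeq_of_dist_le_mul h_cauchy fun j k => (S j).dist_phiQ_le (S k) hT)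
  obtain ⟨v, hv⟩ := exists_tendstoUniformlyOn_of_dist_le_mul (f := fun k => (S k).average T)
    (s := Icc 0 (1 / 2)) h_cauchy fun j k _ hε => (S j).dist_average_le (S k) hT hε
  exact ⟨S, Φ, Γ, ψ, v, h_data, hΦ, hΓ, hψ, hv⟩

section Slices

variable {T : ℝ}

theorem integrable_muQ_iff_integrable_prod {f : ℝ × ℝ → ℝ} :
    Integrable f (muQ T) ↔ Integrable f (muOm.prod (muT T)) := by
  rw [muQ_eq_prod]

theorem L2Q.memLp_slice (f : L2Q T) : ∀ᵐ t ∂(muT T), MemLp (fun x => f (x, t)) 2 muOm := by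
  have : IsFiniteMeasure (muQ T) := by rw [muQ_eq_prod]; infer_instance
  have h_int := integrable_muQ_iff_integrable_prod.1 ((Lp.memLp f).integrable (by norm_num))
  have h_int_sq := integrable_muQ_iff_integrable_prod.1 (Lp.memLp f).integrable_sq
  filter_upwards [h_int.prod_left_ae, h_int_sq.prod_left_ae] with t ht ht_sq
  exact (memLp_two_iff_integrable_sq ht.aestronglyMeasurable).2 ht_sq

theorem L2Q.exists_seq_tendsto_integral_sq_slice {f : ℕ → L2Q T}
    (hf : Tendsto f atTop (𝓝 0)) : ∃ ns : ℕ → ℕ, StrictMono ns ∧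
      ∀ᵐ t ∂(muT T), Tendsto (fun i => ∫ x, f (ns i) (x, t) ^ 2 ∂muOm) atTop (𝓝 0) := by
  set g : ℕ → ℝ → ℝ := fun k t => ∫ x, f k (x, t) ^ 2 ∂muOm
  have h_sq (k : ℕ) : Integrable (fun p => f k p ^ 2) (muQ T) := (Lp.memLp (f k)).integrable_sq
  have h_int (k : ℕ) : Integrable (g k) (muT T) :=
    (integrable_muQ_iff_integrable_prod.1 (h_sq k)).integral_prod_right
  have h_norm (k : ℕ) : eLpNorm (g k - 0) 1 (muT T) = ENNReal.ofReal (‖f k‖ ^ 2) := by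
    rw [sub_zero, eLpNorm_one_eq_lintegral_enorm, ← ofReal_integral_norm_eq_lintegral_enorm
      (h_int k), Lp_two_norm_sq, integral_muQ_eq_iterated (h_sq k)]
    congr 1
    exact integral_congr_ae (.of_forall fun t =>
      Real.norm_of_nonneg (integral_nonneg fun _ => sq_nonneg _))
  have h_tendsto : Tendsto (fun k => eLpNorm (g k - 0) 1 (muT T)) atTop (𝓝 0) := by
    simp_rw [h_norm]
    simpa using ENNReal.tendsto_ofReal (hf.norm.pow 2)
  exact (tendstoInMeasure_of_tendsto_eLpNorm one_ne_zero (fun k => (h_int k).aestronglyMeasurable)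
    aestronglyMeasurable_zero h_tendsto).exists_seq_tendsto_ae

theorem L2Om.tendsto_toLp {f : ℝ → ℝ} (hf : MemLp f 2 muOm) {F : ℕ → L2Om}
    (h : Tendsto (fun i => ∫ x, (F i x - f x) ^ 2 ∂muOm) atTop (𝓝 0)) :
    Tendsto F atTop (𝓝 (hf.toLp f)) := by
  have h_norm (i : ℕ) : √(∫ x, (F i x - f x) ^ 2 ∂muOm) = ‖F i - hf.toLp f‖ := by
    rw [← Real.sqrt_sq (norm_nonneg (F i - hf.toLp f)), Lp_two_norm_sq]
    congr 1
    refine integral_congr_ae ?_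
    filter_upwards [Lp.coeFn_sub (F i) (hf.toLp f), hf.coeFn_toLp] with x h_sub h_toLp
    rw [h_sub, Pi.sub_apply, h_toLp]
  rw [tendsto_iff_norm_sub_tendsto_zero]
  simpa only [Real.sqrt_zero, h_norm] using h.sqrt

theorem L2Q.ae_eq_slice_of_tendsto {f : ℕ → L2Q T} {ψ : L2Q T} {F : ℕ → ℝ → L2Om}
    {Φ : ℝ → L2Om} (hf : Tendsto f atTop (𝓝 ψ))
    (hF : ∀ k, ∀ᵐ t ∂(muT T), F k t =ᵐ[muOm] fun x => f k (x, t))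
    (hΦ : ∀ᵐ t ∂(muT T), Tendsto (fun k => F k t) atTop (𝓝 (Φ t))) :
    ∀ᵐ t ∂(muT T), Φ t =ᵐ[muOm] fun x => ψ (x, t) := by
  obtain ⟨ns, hns, h_ae⟩ := L2Q.exists_seq_tendsto_integral_sq_slice
    (f := fun k => f k - ψ) (by simpa using hf.sub_const ψ)
  have h_sub : ∀ᵐ t ∂(muT T), ∀ k, ∀ᵐ x ∂muOm, (f k - ψ) (x, t) = f k (x, t) - ψ (x, t) :=
    ae_all_iff.2 fun k => ae_muQ_slice (Lp.coeFn_sub (f k) ψ)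
  filter_upwards [h_ae, h_sub, ae_all_iff.2 hF, hΦ, ψ.memLp_slice]
    with t h_ae h_sub hF hΦ hψ
  have h_lim : Tendsto (fun i => F (ns i) t) atTop (𝓝 (hψ.toLp _)) :=
    L2Om.tendsto_toLp hψ <| h_ae.congr fun i => integral_congr_ae <| by
      filter_upwards [h_sub (ns i), hF (ns i)] with x hx hFx
      rw [hx, hFx]
  rw [tendsto_nhds_unique (hΦ.comp hns.tendsto_atTop) h_lim]
  exact hψ.coeFn_toLp

theorem intervalIntegral_near_one_congr {f g : ℝ → ℝ} (h : f =ᵐ[muOm] g) {ε : ℝ} (hε : 0 ≤ ε)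
    (hε' : ε ≤ 1) : ∫ x in (1 - ε)..1, f x = ∫ x in (1 - ε)..1, g x := by
  rw [intervalIntegral.integral_of_le (by linarith), intervalIntegral.integral_of_le (by linarith),
    integral_Ioc_eq_integral_Ioo, integral_Ioc_eq_integral_Ioo]
  exact integral_congr_ae (ae_mono
    (Measure.restrict_mono (Ioo_subset_Ioo_left (by linarith)) le_rfl) h)

theorem continuous_intervalIntegral_near_one {ε : ℝ} (hε : 0 ≤ ε) (hε' : ε ≤ 1) :
    Continuous fun f : L2Om => ∫ x in (1 - ε)..1, f x := by
  have h_meas : MeasurableSet (Ioo (1 - ε) 1) := measurableSet_Ioo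
  have h_inner (f : L2Om) : ∫ x in (1 - ε)..1, f x
      = inner ℝ (indicatorConstLp 2 h_meas (measure_ne_top muOm _) (1 : ℝ)) f := by
    rw [L2.inner_indicatorConstLp_one, Measure.restrict_restrict h_meas,
      inter_eq_left.2 (Ioo_subset_Ioo_left (by linarith)),
      intervalIntegral.integral_of_le (by linarith), integral_Ioc_eq_integral_Ioo]
  simp_rw [h_inner]
  fun_prop

end Slices

theorem WaveSolution.coeFn_phiAt (S : WaveSolution) (t : ℝ) :
    S.phiAt t =ᵐ[muOm] fun x => S.φ (x, t) :=
  have := S.hφ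
  L2Om.coeFn_ofContinuous (f := fun x => S.φ (x, t)) (by fun_prop)

theorem WaveSolution.coeFn_average (S : WaveSolution) (T : ℝ) {ε : ℝ} (hε : ε ∈ Ioc (0 : ℝ) 1) :
    ∀ᵐ t ∂(muT T), S.average T ε t = ε⁻¹ * ∫ x in (1 - ε)..1, S.phiAt t x := by
  filter_upwards [L2T.coeFn_ofContinuous (S.continuous_integral_near_one_left ε)] with t ht
  rw [average, ht, intervalIntegral_near_one_congr (S.coeFn_phiAt t) hε.1.le hε.2,
    intervalIntegral.integral_comp_sub_mul (fun x => S.φ (x, t)) hε.1.ne']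
  simp

theorem hasDerivWithinAt_integral_Icc {E : Type*} [NormedAddCommGroup E]
    [NormedSpace ℝ E] [CompleteSpace E] {f : ℝ → E} {a b t : ℝ} (hf : ContinuousOn f (Icc a b))
    (ht : t ∈ Icc a b) : HasDerivWithinAt (fun s => ∫ r in a..s, f r) (f t) (Icc a b) t := by
  have h_int : IntervalIntegrable f volume a t :=
    (hf.mono (by rw [uIcc_of_le ht.1]; exact Icc_subset_Icc_right ht.2)).intervalIntegrable
  have := Fact.mk ht
  exact intervalIntegral.integral_hasDerivWithinAt_right h_int
    (hf.stronglyMeasurableAtFilter_nhdsWithin measurableSet_Icc t) (hf t ht)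

namespace IsWaveLimit

open WaveSolution

variable {T : ℝ} {d : L2Om × L2Om × L2Q T} {S : ℕ → WaveSolution} {Φ Γ : ℝ → L2Om} {ψ : L2Q T}
  {v : ℝ → L2T T}

theorem phi_zero (h : IsWaveLimit T d S Φ Γ ψ v) (hT : 0 ≤ T) : Φ 0 = d.1 :=
  tendsto_nhds_unique (h.phi.tendsto_at ⟨le_rfl, hT⟩) h.data.fst_nhds

theorem G_zero (h : IsWaveLimit T d S Φ Γ ψ v) (hT : 0 ≤ T) : Γ 0 = d.2.1 :=
  tendsto_nhds_unique (h.G.tendsto_at ⟨le_rfl, hT⟩) h.data.snd_nhds.fst_nhds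

theorem continuousOn_phi (h : IsWaveLimit T d S Φ Γ ψ v) : ContinuousOn Φ (Icc 0 T) :=
  h.phi.continuousOn (.of_forall fun k => (S k).continuous_phiAt.continuousOn)

theorem continuousOn_G (h : IsWaveLimit T d S Φ Γ ψ v) : ContinuousOn Γ (Icc 0 T) :=
  h.G.continuousOn (.of_forall fun k => (S k).continuous_GAt.continuousOn)

theorem tendsto_phiAt (h : IsWaveLimit T d S Φ Γ ψ v) :
    ∀ᵐ t ∂(muT T), Tendsto (fun k => (S k).phiAt t) atTop (𝓝 (Φ t)) := by
  filter_upwards [ae_restrict_mem measurableSet_Ioo] with t ht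
  exact h.phi.tendsto_at (Ioo_subset_Icc_self ht)

theorem ae_eq_slice (h : IsWaveLimit T d S Φ Γ ψ v) :
    ∀ᵐ t ∂(muT T), (Φ t : ℝ → ℝ) =ᵐ[muOm] fun x => ψ (x, t) := by
  refine L2Q.ae_eq_slice_of_tendsto h.phiQ (fun k => ?_) h.tendsto_phiAt
  filter_upwards [ae_muQ_slice (L2Q.coeFn_ofContinuous (T := T) (S k).hφ)] with t ht
  filter_upwards [(S k).coeFn_phiAt t, ht] with x hx hxQ
  exact hx.trans hxQ.symm

theorem L2toHm1_phi (h : IsWaveLimit T d S Φ Γ ψ v) {t : ℝ} (ht : t ∈ Icc 0 T) :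
    L2toHm1 (Φ t) = L2toHm1 (Φ 0) + ∫ s in (0 : ℝ)..t, dxDual (Γ s) := by
  have h_phi {s : ℝ} (hs : s ∈ Icc 0 T) :
      Tendsto (fun k => L2toHm1 ((S k).phiAt s)) atTop (𝓝 (L2toHm1 (Φ s))) :=
    ((pairing H10.toL2).continuous.tendsto _).comp (h.phi.tendsto_at hs)
  have h_subset : uIcc 0 t ⊆ Icc 0 T := by
    rw [uIcc_of_le ht.1]; exact Icc_subset_Icc_right ht.2
  have h_int : Tendsto (fun k => ∫ s in (0 : ℝ)..t, dxDual ((S k).GAt s)) atTop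
      (𝓝 (∫ s in (0 : ℝ)..t, dxDual (Γ s))) :=
    TendstoUniformlyOn.tendsto_intervalIntegral_of_continuousOn
      (F := fun k s => dxDual ((S k).GAt s))
      (.of_forall fun k => (dxDual.continuous.comp (S k).continuous_GAt).continuousOn)
      (dxDual.uniformContinuous.comp_tendstoUniformlyOn (h.G.mono h_subset))
  exact tendsto_nhds_unique (h_phi ht) <|
    ((h_phi ⟨le_rfl, ht.1.trans ht.2⟩).add h_int).congr fun k => ((S k).L2toHm1_phiAt t).symm

theorem isTimeRepresentative (h : IsWaveLimit T d S Φ Γ ψ v) :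
    IsTimeRepresentative T ψ Φ fun t => dxDual (Γ t) where
  ae_eq := h.ae_eq_slice
  continuousOn := h.continuousOn_phi
  hasDeriv _ ht :=
    ((hasDerivWithinAt_integral_Icc (dxDual.continuous.comp_continuousOn h.continuousOn_G) ht
      ).const_add _).congr_of_mem (fun _ hs => h.L2toHm1_phi hs) ht
  continuousOn_deriv := dxDual.continuous.comp_continuousOn h.continuousOn_G

theorem tendsto_trace (h : IsWaveLimit T d S Φ Γ ψ v) :
    Tendsto (fun k => (S k).trace T) atTop (𝓝 (v 0)) := by
  simpa only [average_zero] using h.average.tendsto_at (left_mem_Icc.2 (by norm_num))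

theorem coeFn_average (h : IsWaveLimit T d S Φ Γ ψ v) {ε : ℝ} (hε : ε ∈ Ioc (0 : ℝ) (1 / 2)) :
    v ε =ᵐ[muT T] fun t => ε⁻¹ * ∫ x in (1 - ε)..1, ψ (x, t) := by
  have hε1 : ε ≤ 1 := hε.2.trans (by norm_num)
  obtain ⟨ns, hns, h_ae⟩ := (tendstoInMeasure_of_tendsto_Lp
    (h.average.tendsto_at (Ioc_subset_Icc_self hε))).exists_seq_tendsto_ae
  filter_upwards [h_ae, ae_all_iff.2 fun k => (S k).coeFn_average T ⟨hε.1, hε1⟩, h.ae_eq_slice,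
    h.tendsto_phiAt] with t h_ae h_average h_slice h_phi
  rw [← intervalIntegral_near_one_congr h_slice hε.1.le hε1]
  have h_lim := ((continuous_intervalIntegral_near_one hε.1.le hε1).tendsto (Φ t)).comp
    (h_phi.comp hns.tendsto_atTop)
  exact tendsto_nhds_unique h_ae <| (h_lim.const_mul ε⁻¹).congr fun i => (h_average (ns i)).symm

theorem isTraceAtOne (h : IsWaveLimit T d S Φ Γ ψ v) (hT : 0 ≤ T) : IsTraceAtOne T ψ (v 0) := by
  have h_mem : Ioc (0 : ℝ) (1 / 2) ∈ 𝓝[>] 0 := Ioc_mem_nhdsGT (by norm_num)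
  have h_contOn : ContinuousOn v (Icc 0 (1 / 2)) :=
    h.average.continuousOn (.of_forall fun k => ((S k).continuous_average hT).continuousOn)
  have h_lim : Tendsto v (𝓝[>] 0) (𝓝 (v 0)) :=
    (h_contOn 0 (left_mem_Icc.2 (by norm_num))).mono_of_mem_nhdsWithin
      (mem_of_superset h_mem Ioc_subset_Icc_self)
  refine (Lp.tendsto_Lp_iff_tendsto_eLpNorm' _ _ |>.1 h_lim).congr' ?_
  filter_upwards [h_mem] with ε hε
  exact eLpNorm_congr_ae ((h.coeFn_average hε).sub .rfl)

end IsWaveLimit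

/-! ### The multiplication operator of a bounded potential -/

theorem LinfQ.ae_abs_le {T : ℝ} (A : LinfQ T) : ∀ᵐ p ∂(muQ T), |A p| ≤ ‖A‖ := by
  filter_upwards [ae_le_eLpNormEssSup (f := A) (μ := muQ T)] with p hp
  rw [← eLpNorm_exponent_top] at hp
  rw [Lp.norm_def, ← Real.norm_eq_abs, ← toReal_enorm]
  exact ENNReal.toReal_mono (Lp.eLpNorm_ne_top A) hp

theorem LinfQ.integrable_slice_mul {T : ℝ} (A : LinfQ T) :
    ∀ᵐ t ∂(muT T), ∀ f g : L2Om, Integrable (fun x => A (x, t) * f x * g x) muOm := by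
  filter_upwards [ae_muQ_slice A.ae_abs_le] with t ht f g
  simp_rw [mul_assoc]
  exact ((Lp.memLp f).integrable_mul (Lp.memLp g)).bdd_mul
    ((Lp.stronglyMeasurable A).comp_measurable (by fun_prop)).aestronglyMeasurable ht

/-- Multiplication by `A ∈ L^∞(Q_T)` on `L²(Q_T)`. -/
def potential {T : ℝ} (A : LinfQ T) : L2Q T →L[ℝ] L2Q T :=
  LinearMap.mkContinuous
    { toFun := fun f => (A • f : L2Q T)
      map_add' := fun f g => Lp.add_smul A f g
      map_smul' := fun c f => (Lp.smul_comm c A f).symm } ‖A‖ fun f => Lp.norm_smul_le A f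

theorem coeFn_potential {T : ℝ} (A : LinfQ T) (f : L2Q T) :
    (potential A f : ℝ × ℝ → ℝ) =ᵐ[muQ T] fun p => A p * f p :=
  Lp.coeFn_lpSMul (r := 2) A f

theorem inner_potential {T : ℝ} (A : LinfQ T) (f g : L2Q T) :
    inner ℝ f (potential A g) = inner ℝ (potential A f) g := by
  rw [Lp_two_inner, Lp_two_inner]
  refine integral_congr_ae ?_
  filter_upwards [coeFn_potential A f, coeFn_potential A g] with p hf hg
  rw [hf, hg]
  ring

/-! ### Separated solutions of the backward problem -/

section Eigenmode

variable {T : ℝ} {A : LinfQ T} {s : H10} {l : ℝ}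

theorem eigenmode_equation
    (hs : ∀ z, inner ℝ (H10.dx s) (H10.dx z) = l * inner ℝ (H10.toL2 s) (H10.toL2 z))
    {a η : ℝ → ℝ} {g : L2Q T} (hg : ∀ᵐ t ∂(muT T), ∀ᵐ x ∂muOm,
      g (x, t) = η t * H10.toL2 s x + A (x, t) * H10.toL2 (a t • s) x) :
    ∀ᵐ t ∂(muT T), ∀ z : H10, ((η t - l * a t) • L2toHm1 (H10.toL2 s)) z
        + (∫ x, H10.dx (a t • s) x * H10.dx z x ∂muOm)
        + (∫ x, A (x, t) * H10.toL2 (a t • s) x * H10.toL2 z x ∂muOm)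
      = ∫ x, g (x, t) * H10.toL2 z x ∂muOm := by
  filter_upwards [hg, A.integrable_slice_mul] with t hgt hAt z
  have h_source : ∫ x, g (x, t) * H10.toL2 z x ∂muOm = η t * inner ℝ (H10.toL2 s) (H10.toL2 z)
      + ∫ x, A (x, t) * H10.toL2 (a t • s) x * H10.toL2 z x ∂muOm := by
    have h_int : Integrable (fun x => H10.toL2 s x * H10.toL2 z x) muOm :=
      (Lp.memLp (H10.toL2 s)).integrable_mul (Lp.memLp (H10.toL2 z))
    rw [Lp_two_inner, ← integral_const_mul, ← integral_add (h_int.const_mul _) (hAt _ _)]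
    exact integral_congr_ae (hgt.mono fun x hx => by simp only [hx]; ring)
  rw [h_source, ← Lp_two_inner, map_smul H10.dx, real_inner_smul_left, hs,
    _root_.smul_apply, smul_eq_mul, L2toHm1_eq, pairing_apply]
  ring

theorem isBackwardWeakSolution_of_eigenmode
    (hs : ∀ z, inner ℝ (H10.dx s) (H10.dx z) = l * inner ℝ (H10.toL2 s) (H10.toL2 z))
    {a a' η : ℝ → ℝ} (hη : Continuous η) (ha : ∀ t, HasDerivAt a (a' t) t)
    (ha' : ∀ t, HasDerivAt a' (η t - l * a t) t) (haT : a T = 0) (haT' : a' T = 0)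
    {g : L2Q T} (hg : ∀ᵐ t ∂(muT T), ∀ᵐ x ∂muOm,
      g (x, t) = η t * H10.toL2 s x + A (x, t) * H10.toL2 (a t • s) x) :
    IsBackwardWeakSolution T A g (fun t => a t • s) (fun t => a' t • H10.toL2 s)
      (fun t => (η t - l * a t) • L2toHm1 (H10.toL2 s)) := by
  have hac : Continuous a := continuous_iff_continuousAt.2 fun t => (ha t).continuousAt
  have hac' : Continuous a' := continuous_iff_continuousAt.2 fun t => (ha' t).continuousAt
  have hw₂ : Continuous fun t => (η t - l * a t) • L2toHm1 (H10.toL2 s) := by fun_prop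
  refine ⟨by fun_prop, fun t _ => ?_, by fun_prop, memLp_muT hw₂ T 2, fun t _ => ?_,
    eigenmode_equation hs hg, by simp [haT], by simp [haT']⟩
  · simp only [map_smul]
    exact ((ha t).smul_const _).hasDerivWithinAt
  · rw [intervalIntegral.integral_eq_sub_of_hasDerivAt
      (fun r _ => HasDerivAt.smul_const (F := Hm1) (ha' r) _) (hw₂.intervalIntegrable _ _)]
    simp only [L2toHm1_eq, map_smul, add_sub_cancel]

end Eigenmode

theorem hasDerivAt_sin_mul (l x : ℝ) :
    HasDerivAt (fun y => Real.sin (l * y)) (l * Real.cos (l * x)) x := by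
  simpa [mul_comm] using ((hasDerivAt_id' x).const_mul l).sin

theorem hasDerivAt_cos_mul (l x : ℝ) :
    HasDerivAt (fun y => Real.cos (l * y)) (-l * Real.sin (l * x)) x := by
  simpa [mul_comm] using ((hasDerivAt_id' x).const_mul l).cos

theorem exists_sineMode (n : ℕ) :
    ∃ s : H10, H10.dx s = freq n • cosMode n ∧ H10.toL2 s = sinMode n := by
  obtain ⟨s, hs⟩ := H10.dx_surjective (freq n • cosMode n)
  refine ⟨s, hs, Lp.ext ?_⟩
  have hc : Continuous fun x => freq n * Real.cos (freq n * x) := by fun_prop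
  filter_upwards [H10.toL2_ae s, L2Om.coeFn_ofContinuous (f := fun x => Real.sin (freq n * x))
    (by fun_prop), ae_restrict_mem measurableSet_Ioo] with x h_toL2 h_sin hx
  have h_cos : freq n • cosMode n = L2Om.ofContinuous _ hc := rfl
  rw [h_toL2, hs, sinMode, h_sin, h_cos, L2Om.primitive_congr (L2Om.coeFn_ofContinuous hc) hx,
    intervalIntegral.integral_eq_sub_of_hasDerivAt
      (fun y _ => hasDerivAt_sin_mul (freq n) y) (hc.intervalIntegrable _ _)]
  simp

theorem inner_cosMode_dx (n : ℕ) (z : H10) :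
    inner ℝ (cosMode n) (H10.dx z) = freq n * inner ℝ (sinMode n) (H10.toL2 z) := by
  have h := DFunLike.congr_fun (L2toHm1_ofContinuous_eq_dxDual (by fun_prop)
    (hasDerivAt_cos_mul (freq n)) (by fun_prop) (by simp [cos_freq])) z
  rw [dxDual_apply, ← Lp_two_inner, L2toHm1_eq, pairing_apply] at h
  change inner ℝ (-freq n • sinMode n) _ = -inner ℝ (cosMode n) _ at h
  rw [real_inner_smul_left] at h
  linarith

theorem sinModeQ_ae_slice (T : ℝ) (n : ℕ) (η : C(ℝ, ℝ)) :
    ∀ᵐ t ∂(muT T), ∀ᵐ x ∂muOm, sinModeQ T n η (x, t) = η t * sinMode n x := by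
  filter_upwards [ae_muQ_slice (T := T) (L2Q.coeFn_ofContinuous
    (f := fun p => Real.sin (freq n * p.1) * η p.2) (by fun_prop))] with t ht
  filter_upwards [ht, L2Om.coeFn_ofContinuous (f := fun x => Real.sin (freq n * x))
    (by fun_prop)] with x hx h_sin
  rw [sinModeQ, hx, sinMode, h_sin, mul_comm]

theorem isBackwardWeakSolution_sineMode {T : ℝ} (A : LinfQ T) (n : ℕ) {a η : C(ℝ, ℝ)} {a' : ℝ → ℝ}
    (ha : ∀ t, HasDerivAt a (a' t) t) (ha' : ∀ t, HasDerivAt a' (η t - freq n ^ 2 * a t) t)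
    (haT : a T = 0) (haT' : a' T = 0) {s : H10} (hs : H10.dx s = freq n • cosMode n)
    (hs' : H10.toL2 s = sinMode n) :
    IsBackwardWeakSolution T A (sinModeQ T n η + potential A (sinModeQ T n a))
      (fun t => a t • s) (fun t => a' t • H10.toL2 s)
      (fun t => (η t - freq n ^ 2 * a t) • L2toHm1 (H10.toL2 s)) := by
  refine isBackwardWeakSolution_of_eigenmode (fun z => ?_) η.continuous ha ha' haT haT' ?_
  · rw [hs, hs', real_inner_smul_left, inner_cosMode_dx]
    ring
  · filter_upwards [ae_muQ_slice (Lp.coeFn_add (sinModeQ T n η) (potential A (sinModeQ T n a))),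
      ae_muQ_slice (coeFn_potential A (sinModeQ T n a)), sinModeQ_ae_slice T n η,
      sinModeQ_ae_slice T n a] with t h_add h_pot h_η h_a
    filter_upwards [h_add, h_pot, h_η, h_a, Lp.coeFn_smul (a t) (sinMode n)]
      with x h_add h_pot h_η h_a h_smul
    rw [h_add, Pi.add_apply, h_pot, h_η, h_a, map_smul, hs', h_smul, Pi.smul_apply, smul_eq_mul]

theorem integral_mul_toL2_sineMode {T : ℝ} (B : L2Q T) (n : ℕ) (a : C(ℝ, ℝ)) {s : H10}
    (hs : H10.toL2 s = sinMode n) :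
    ∫ t, ∫ x, B (x, t) * H10.toL2 (a t • s) x ∂muOm ∂(muT T) = inner ℝ B (sinModeQ T n a) := by
  have h_int : Integrable (fun p => B p * sinModeQ T n a p) (muQ T) :=
    (Lp.memLp B).integrable_mul (Lp.memLp _)
  rw [Lp_two_inner, integral_muQ_eq_iterated h_int]
  refine integral_congr_ae ?_
  filter_upwards [sinModeQ_ae_slice T n a] with t ht
  refine integral_congr_ae ?_
  filter_upwards [ht, Lp.coeFn_smul (a t) (sinMode n)] with x hx h_smul
  rw [hx, map_smul, hs, h_smul, Pi.smul_apply, smul_eq_mul]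

/-! ### Green's formula for limits of classical solutions -/

theorem L2Om.slice_eq_zero {f : ℝ × ℝ → ℝ} (hf : Continuous f) {t : ℝ} (h : ∀ x, f (x, t) = 0) :
    L2Om.slice f hf t = 0 := by
  unfold L2Om.slice
  simp_rw [h]
  rfl

namespace WaveTest

variable {T : ℝ}

/-- The test function `sin((n + 1/2) π x) a(t)`, where `a'' = η - ((n + 1/2) π)² a`. -/
def mode (n : ℕ) {a η : C(ℝ, ℝ)} {a' : ℝ → ℝ} (ha : ∀ t, HasDerivAt a (a' t) t)
    (ha' : ∀ t, HasDerivAt a' (η t - freq n ^ 2 * a t) t) (haT : a T = 0) (haT' : a' T = 0) :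
    WaveTest T :=
  have hac' : Continuous a' := continuous_iff_continuousAt.2 fun t => (ha' t).continuousAt
  { w := fun z => Real.sin (freq n * z.1) * a z.2
    wt := fun z => Real.sin (freq n * z.1) * a' z.2
    wx := fun z => freq n * Real.cos (freq n * z.1) * a z.2
    wtt := fun z => Real.sin (freq n * z.1) * (η z.2 - freq n ^ 2 * a z.2)
    wtx := fun z => freq n * Real.cos (freq n * z.1) * a' z.2
    wxx := fun z => freq n * (-freq n * Real.sin (freq n * z.1)) * a z.2
    hw := by fun_prop
    hwt := by fun_prop
    hwx := by fun_prop
    hwtt := by fun_prop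
    hwtx := by fun_prop
    hwxx := by fun_prop
    w_dx := fun x t => (hasDerivAt_sin_mul (freq n) x).mul_const (a t)
    wt_dt := fun x t => (ha' t).const_mul (Real.sin (freq n * x))
    wt_dx := fun x t => (hasDerivAt_sin_mul (freq n) x).mul_const (a' t)
    wx_dt := fun x t => (ha t).const_mul (freq n * Real.cos (freq n * x))
    wx_dx := fun x t => ((hasDerivAt_cos_mul (freq n) x).const_mul (freq n)).mul_const (a t)
    w_zero := by simp
    wt_zero := by simp
    wx_one := by simp [cos_freq]
    wt_final := by simp [haT']
    wx_final := by simp [haT] }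

/-- `∂ₜₜw - ∂ₓₓw` as an element of `L²(Q_T)`. -/
def boxQ (W : WaveTest T) : L2Q T :=
  L2Q.ofContinuous T (fun z => W.wtt z - W.wxx z) (W.hwtt.sub W.hwxx)

theorem boxQ_mode (n : ℕ) {a η : C(ℝ, ℝ)} {a' : ℝ → ℝ} (ha : ∀ t, HasDerivAt a (a' t) t)
    (ha' : ∀ t, HasDerivAt a' (η t - freq n ^ 2 * a t) t) (haT : a T = 0) (haT' : a' T = 0) :
    (mode n ha ha' haT haT').boxQ = sinModeQ T n η := by
  unfold boxQ sinModeQ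
  congr 1
  ext z
  simp only [mode]
  ring

end WaveTest

theorem WaveSolution.abs_F_le (S : WaveSolution) {T : ℝ} (A : LinfQ T) : ∀ᵐ z ∂(muQ T),
    |S.F z| ≤ ‖A‖ * |S.φ z| + |((S.data T).2.2 + potential A (S.phiQ T) : L2Q T) z| := by
  filter_upwards [Lp.coeFn_add (S.data T).2.2 (potential A (S.phiQ T)),
    L2Q.coeFn_ofContinuous (T := T) S.hF, coeFn_potential A (S.phiQ T),
    L2Q.coeFn_ofContinuous (T := T) S.hφ, A.ae_abs_le] with z h_add h_F h_pot h_φ hA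
  rw [h_add, Pi.add_apply, h_pot, data, phiQ, h_F, h_φ]
  calc |S.F z| = |(S.F z + A z * S.φ z) - A z * S.φ z| := by rw [add_sub_cancel_right]
    _ ≤ |S.F z + A z * S.φ z| + |A z| * |S.φ z| := by rw [← abs_mul]; exact abs_sub _ _
    _ ≤ ‖A‖ * |S.φ z| + |S.F z + A z * S.φ z| := by rw [add_comm]; gcongr

theorem WaveSolution.inner_green (S : WaveSolution) {T : ℝ} (hT : 0 ≤ T) (W : WaveTest T) :
    inner ℝ (S.phiQ T) W.boxQ = inner ℝ (S.data T).2.2 (L2Q.ofContinuous T W.w W.hw)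
      - inner ℝ (S.data T).1 (L2Om.slice W.wt W.hwt 0)
      - inner ℝ (S.data T).2.1 (L2Om.slice W.wx W.hwx 0) := by
  have h_inner {f g : ℝ × ℝ → ℝ} (hf : Continuous f) (hg : Continuous g) :
      inner ℝ (L2Q.ofContinuous T f hf) (L2Q.ofContinuous T g hg) = ∫ p, f p * g p ∂(muQ T) := by
    rw [L2Q.inner_ofContinuous]
    exact integral_congr_ae ((L2Q.coeFn_ofContinuous hf).mono fun p hp => by simp only [hp])
  have h_slice {f g : ℝ × ℝ → ℝ} (hf : Continuous f) (hg : Continuous g) :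
      inner ℝ (L2Om.slice f hf 0) (L2Om.slice g hg 0) = ∫ x in (0 : ℝ)..1, f (x, 0) * g (x, 0) :=
    L2Om.inner_ofContinuous_ofContinuous _ _
  exact (h_inner S.hφ (W.hwtt.sub W.hwxx)).trans <| (S.green hT W).trans <|
    (congrArg₂ _ (congrArg₂ _ (h_inner S.hF W.hw) (h_slice S.hφ W.hwt)) (h_slice S.hG W.hwx)).symm

section TestFunction

/-- `∂ₓf`, where points of the plane are written `(x, t)`. -/
def partialX (f : ℝ × ℝ → ℝ) (z : ℝ × ℝ) : ℝ := fderiv ℝ f z (1, 0)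

/-- `∂ₜf`, where points of the plane are written `(x, t)`. -/
def partialT (f : ℝ × ℝ → ℝ) (z : ℝ × ℝ) : ℝ := fderiv ℝ f z (0, 1)

variable {f : ℝ × ℝ → ℝ}

theorem contDiff_partialX (hf : ContDiff ℝ ∞ f) : ContDiff ℝ ∞ (partialX f) :=
  (hf.fderiv_right (by norm_cast)).clm_apply contDiff_const

theorem contDiff_partialT (hf : ContDiff ℝ ∞ f) : ContDiff ℝ ∞ (partialT f) :=
  (hf.fderiv_right (by norm_cast)).clm_apply contDiff_const

theorem hasDerivX_partialX (hf : ContDiff ℝ ∞ f) : HasDerivX f (partialX f) := fun x t =>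
  (hf.differentiable (by simp) (x, t)).hasFDerivAt.comp_hasDerivAt x
    ((hasDerivAt_id' x).prodMk (hasDerivAt_const x t))

theorem hasDerivT_partialT (hf : ContDiff ℝ ∞ f) : HasDerivT f (partialT f) := fun x t =>
  (hf.differentiable (by simp) (x, t)).hasFDerivAt.comp_hasDerivAt t
    ((hasDerivAt_const t x).prodMk (hasDerivAt_id' t))

theorem partialX_partialT (hf : ContDiff ℝ ∞ f) :
    partialX (partialT f) = partialT (partialX f) := by
  ext z
  have h_apply (v w : ℝ × ℝ) :
      fderiv ℝ (fun y => fderiv ℝ f y v) z w = fderiv ℝ (fderiv ℝ f) z w v := by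
    rw [fderiv_clm_apply ((hf.fderiv_right (m := ∞) (by norm_cast)).differentiable (by simp) z)
      (differentiableAt_const v)]
    simp
  have h_symm := hf.contDiffAt.isSymmSndFDerivAt (x := z) (by simpa using ENat.LEInfty.out)
  exact (h_apply (0, 1) (1, 0)).trans <| (h_symm (1, 0) (0, 1)).trans (h_apply (1, 0) (0, 1)).symm

variable {T : ℝ}

/-- A smooth function with support in the open set `Q_T` as a test function on `Q_T`. -/
def WaveTest.ofContDiff (hf : ContDiff ℝ ∞ f) (h_supp : tsupport f ⊆ Ioo 0 1 ×ˢ Ioo 0 T) :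
    WaveTest T :=
  have h_zero {z : ℝ × ℝ} (hz : z ∉ Ioo (0 : ℝ) 1 ×ˢ Ioo 0 T) : f z = 0 ∧ fderiv ℝ f z = 0 :=
    ⟨image_eq_zero_of_notMem_tsupport fun h => hz (h_supp h),
      fderiv_of_notMem_tsupport ℝ fun h => hz (h_supp h)⟩
  { w := f
    wt := partialT f
    wx := partialX f
    wtt := partialT (partialT f)
    wtx := partialT (partialX f)
    wxx := partialX (partialX f)
    hw := hf.continuous
    hwt := (contDiff_partialT hf).continuous
    hwx := (contDiff_partialX hf).continuous
    hwtt := (contDiff_partialT (contDiff_partialT hf)).continuous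
    hwtx := (contDiff_partialT (contDiff_partialX hf)).continuous
    hwxx := (contDiff_partialX (contDiff_partialX hf)).continuous
    w_dx := hasDerivX_partialX hf
    wt_dt := hasDerivT_partialT (contDiff_partialT hf)
    wt_dx := partialX_partialT hf ▸ hasDerivX_partialX (contDiff_partialT hf)
    wx_dt := hasDerivT_partialT (contDiff_partialX hf)
    wx_dx := hasDerivX_partialX (contDiff_partialX hf)
    w_zero := fun t => (h_zero (by simp)).1
    wt_zero := fun t => by simp [partialT, h_zero (z := (0, t)) (by simp)]
    wx_one := fun t => by simp [partialX, h_zero (z := (1, t)) (by simp)]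
    wt_final := fun x => by simp [partialT, h_zero (z := (x, T)) (by simp)]
    wx_final := fun x => by simp [partialX, h_zero (z := (x, T)) (by simp)] }

theorem WaveTest.slice_ofContDiff_eq_zero (hf : ContDiff ℝ ∞ f)
    (h_supp : tsupport f ⊆ Ioo 0 1 ×ˢ Ioo 0 T) :
    L2Om.slice (ofContDiff hf h_supp).wt (hwt _) 0 = 0
      ∧ L2Om.slice (ofContDiff hf h_supp).wx (hwx _) 0 = 0 := by
  have h_zero (x : ℝ) : fderiv ℝ f (x, 0) = 0 :=
    fderiv_of_notMem_tsupport ℝ fun h => by simpa using h_supp h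
  exact ⟨L2Om.slice_eq_zero _ fun x => by simp [ofContDiff, partialT, h_zero],
    L2Om.slice_eq_zero _ fun x => by simp [ofContDiff, partialX, h_zero]⟩

theorem iteratedDeriv_two_eq {g g' : ℝ → ℝ} {x c : ℝ} (h : ∀ y, HasDerivAt g (g' y) y)
    (h' : HasDerivAt g' c x) : iteratedDeriv 2 g x = c := by
  rw [iteratedDeriv_succ, iteratedDeriv_one, funext fun y => (h y).deriv]
  exact h'.deriv

end TestFunction

namespace IsWaveLimit

variable {T : ℝ} {d : L2Om × L2Om × L2Q T} {S : ℕ → WaveSolution} {Φ Γ : ℝ → L2Om} {ψ : L2Q T}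
  {v : ℝ → L2T T}

theorem inner_green (h : IsWaveLimit T d S Φ Γ ψ v) (hT : 0 ≤ T) (W : WaveTest T) :
    inner ℝ ψ W.boxQ = inner ℝ d.2.2 (L2Q.ofContinuous T W.w W.hw)
      - inner ℝ d.1 (L2Om.slice W.wt W.hwt 0) - inner ℝ d.2.1 (L2Om.slice W.wx W.hwx 0) :=
  tendsto_nhds_unique (h.phiQ.inner tendsto_const_nhds) <|
    (((h.data.snd_nhds.snd_nhds.inner tendsto_const_nhds).sub
      (h.data.fst_nhds.inner tendsto_const_nhds)).sub
      (h.data.snd_nhds.fst_nhds.inner tendsto_const_nhds)).congr fun k =>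
        ((S k).inner_green hT W).symm

theorem inner_sinModeQ (h : IsWaveLimit T d S Φ Γ ψ v) (hT : 0 ≤ T) (n : ℕ) {a η : C(ℝ, ℝ)}
    {a' : ℝ → ℝ} (ha : ∀ t, HasDerivAt a (a' t) t)
    (ha' : ∀ t, HasDerivAt a' (η t - freq n ^ 2 * a t) t) (haT : a T = 0) (haT' : a' T = 0) :
    inner ℝ ψ (sinModeQ T n η) = inner ℝ d.2.2 (sinModeQ T n a)
      - a' 0 * inner ℝ d.1 (sinMode n) - a 0 * (freq n * inner ℝ d.2.1 (cosMode n)) := by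
  have h_wt : L2Om.slice (WaveTest.mode n ha ha' haT haT').wt (WaveTest.hwt _) 0
      = a' 0 • sinMode n := by
    change L2Om.ofContinuous (fun x => Real.sin (freq n * x) * a' 0) (by fun_prop)
      = L2Om.ofContinuous (fun x => a' 0 * Real.sin (freq n * x)) (by fun_prop)
    simp_rw [mul_comm]
  have h_wx : L2Om.slice (WaveTest.mode n ha ha' haT haT').wx (WaveTest.hwx _) 0
      = a 0 • freq n • cosMode n := by
    change L2Om.ofContinuous (fun x => freq n * Real.cos (freq n * x) * a 0) (by fun_prop)
      = L2Om.ofContinuous (fun x => a 0 * (freq n * Real.cos (freq n * x))) (by fun_prop)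
    congr 1
    ext x
    ring
  rw [← WaveTest.boxQ_mode n ha ha' haT haT', h.inner_green hT, h_wt, h_wx,
    real_inner_smul_right, real_inner_smul_right, real_inner_smul_right]
  rfl

theorem eq_of_isTranspositionSolution {A : LinfQ T} {B φ : L2Q T} {φ₀ G₀ : L2Om}
    (h : IsWaveLimit T (φ₀, G₀, B - potential A φ) S Φ Γ ψ v) (hT : 0 ≤ T)
    (hφ : IsTranspositionSolution T A B φ₀ (dxDual G₀) φ) : ψ = φ := by
  refine sub_eq_zero.1 (L2Q.eq_zero_of_inner_sinModeQ fun n η => ?_)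
  obtain ⟨a, a', ha, ha', haT, haT'⟩ := exists_oscillator (freq_pos n).ne' η.continuous T 0 0
  lift a to C(ℝ, ℝ) using continuous_iff_continuousAt.2 fun t => (ha t).continuousAt
  obtain ⟨s, hs, hs'⟩ := exists_sineMode n
  have h_transposition :=
    hφ _ _ _ _ (isBackwardWeakSolution_sineMode A n ha ha' haT haT' hs hs')
  rw [integral_mul_toL2_sineMode B n a hs', ← Lp_two_inner, ← Lp_two_inner, inner_add_right,
    inner_potential, dxDual_apply, ← Lp_two_inner, map_smul, real_inner_smul_right,
    real_inner_smul_right, hs, hs', real_inner_smul_right] at h_transposition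
  have h_limit := h.inner_sinModeQ hT n ha ha' haT haT'
  rw [inner_sub_left] at h_limit
  rw [inner_sub_left, h_limit]
  linarith

theorem isWaveOperator {A : LinfQ T} {B : L2Q T} (h : IsWaveLimit T d S Φ Γ ψ v) (hT : 0 ≤ T)
    (hd : d.2.2 = B - potential A ψ) : IsWaveOperator T A ψ B := by
  intro θ hθ _ h_supp
  set W := WaveTest.ofContDiff hθ h_supp
  set θQ := L2Q.ofContinuous T θ hθ.continuous
  obtain ⟨h_wt, h_wx⟩ := WaveTest.slice_ofContDiff_eq_zero hθ h_supp
  have h_weak : inner ℝ ψ (W.boxQ + potential A θQ) = inner ℝ B θQ := by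
    rw [inner_add_right, h.inner_green hT W, h_wt, h_wx, inner_zero_right, inner_zero_right,
      sub_zero, sub_zero, hd, inner_potential]
    change inner ℝ (B - potential A ψ) θQ + _ = _
    rw [← inner_add_left, sub_add_cancel]
  rw [L2Q.inner_ofContinuous, Lp_two_inner] at h_weak
  rw [← h_weak]
  refine integral_congr_ae ?_
  filter_upwards [Lp.coeFn_add W.boxQ (potential A θQ), coeFn_potential A θQ,
    L2Q.coeFn_ofContinuous (T := T) (f := fun z => W.wtt z - W.wxx z) (W.hwtt.sub W.hwxx),
    L2Q.coeFn_ofContinuous (T := T) hθ.continuous] with p h_add h_pot h_box h_θ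
  rw [h_add, Pi.add_apply, h_pot, WaveTest.boxQ, h_box, h_θ,
    iteratedDeriv_two_eq (hasDerivT_partialT hθ p.1) (W.wt_dt p.1 p.2),
    iteratedDeriv_two_eq (fun x => hasDerivX_partialX hθ x p.2) (W.wx_dx p.1 p.2)]

theorem observability (h : IsWaveLimit T d S Φ Γ ψ v) {A : LinfQ T} (hT : 0 ≤ T) {K : ℝ}
    (hK : ∀ (S : WaveSolution) (b : ℝ × ℝ → ℝ), Integrable (fun z => b z ^ 2) (muQ T) →
      (∀ᵐ z ∂(muQ T), |S.F z| ≤ ‖A‖ * |S.φ z| + |b z|) →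
      S.energy 0 ≤ K * ((∫ t in (0 : ℝ)..T, S.φ (1, t) ^ 2) + ∫ z, b z ^ 2 ∂(muQ T))) :
    ‖d.1‖ ^ 2 + ‖d.2.1‖ ^ 2 ≤ K * (‖v 0‖ ^ 2 + ‖d.2.2 + potential A ψ‖ ^ 2) := by
  have h_source : Tendsto (fun k => ((S k).data T).2.2 + potential A ((S k).phiQ T)) atTop
      (𝓝 (d.2.2 + potential A ψ)) :=
    h.data.snd_nhds.snd_nhds.add (((potential A).continuous.tendsto ψ).comp h.phiQ)
  refine le_of_tendsto_of_tendsto'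
    ((h.data.fst_nhds.norm.pow 2).add (h.data.snd_nhds.fst_nhds.norm.pow 2))
    (((h.tendsto_trace.norm.pow 2).add (h_source.norm.pow 2)).const_mul K) fun k => ?_
  set b := ((S k).data T).2.2 + potential A ((S k).phiQ T)
  have h_obs := hK (S k) b (Lp.memLp b).integrable_sq ((S k).abs_F_le A)
  rw [← WaveSolution.norm_sq_phiAt_add, ← Lp_two_norm_sq] at h_obs
  rw [WaveSolution.trace, L2T.norm_sq_ofContinuous hT]
  exact h_obs

end IsWaveLimit

end

theorem theorem1 (T : ℝ) (hT : 2 < T) :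
    ∃ C : ℝ, 0 < C ∧
      ∀ (A : LinfQ T) (B : L2Q T) (φ₀ : L2Om) (φ₁ : Hm1) (φ : L2Q T),
        IsTranspositionSolution T A B φ₀ φ₁ φ →
          ∃ (Φ : ℝ → L2Om) (Φ' : ℝ → Hm1) (u : L2T T),
            IsTimeRepresentative T φ Φ Φ' ∧ Φ 0 = φ₀ ∧ Φ' 0 = φ₁ ∧
            IsTraceAtOne T φ u ∧
            IsWaveOperator T A φ B ∧
            ‖Φ 0‖ ^ 2 + ‖Φ' 0‖ ^ 2
              ≤ C * Real.exp (C * Real.sqrt ‖A‖) * (‖u‖ ^ 2 + ‖B‖ ^ 2) := by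
  obtain ⟨C, hC, hobs⟩ := WaveSolution.observability hT
  have hT0 : 0 ≤ T := by linarith
  refine ⟨C, hC, fun A B φ₀ φ₁ φ hφ => ?_⟩
  obtain ⟨G₀, rfl⟩ := dxDual_surjective φ₁
  obtain ⟨S, Φ, Γ, ψ, v, h⟩ := exists_isWaveLimit hT0 (φ₀, G₀, B - potential A φ)
  obtain rfl := h.eq_of_isTranspositionSolution hT0 hφ
  have hΦ : Φ 0 = φ₀ := h.phi_zero hT0
  have hΓ : Γ 0 = G₀ := h.G_zero hT0
  refine ⟨Φ, fun t => dxDual (Γ t), v 0, h.isTimeRepresentative, hΦ, congrArg dxDual hΓ,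
    h.isTraceAtOne hT0, h.isWaveOperator hT0 rfl, ?_⟩
  have hle := h.observability (A := A) hT0 fun S => hobs S ‖A‖ (norm_nonneg A)
  simp only [sub_add_cancel] at hle
  simp only [hΦ, hΓ]
  refine le_trans ?_ hle
  gcongr
  exact norm_dxDual_le G₀
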